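/- Let $R$ be a commutative ring and let $\alpha\in R$ be such that $1-4\alpha$ is invertible. Put $K=R[t]/(t^2-t+\alpha)$ with the $R$-linear involution $k\mapsto\bar k$, $\bar t=1-t$. A hermitian cubic norm structure over $K/R$ is a $K$-module $J$ with polynomial laws over $R$ $N:J\to K$ (homogeneous cubic, with $N(kj)=k^3N(j)$ for $k\in K$) and $\sharp:J\to J$ (quadratic, with $(kj)^\sharp=\bar k^2j^\sharp$ for $k \in K$), the linearisation $\times$ of $\sharp$, which is conjugate-linear in both arguments, and a hermitian form $T:J\times J\to K$ ($K$-linear in the first argument, $T(b,a)=\overline{T(a,b)}$), such that, over all scalar extensions of $R$, $$N^{(1,2)}(a,b)=T(a,b^\sharp),\quad (a^\sharp)^\sharp=N(a)a,\quad (a^\sharp\times b)\times a=\overline{N(a)}\,b+T(b,a)a^\sharp,\quad N(T(a,b)a-a^\sharp\times b)=N(a)^2\,\overline{N(b)},$$ where $N(\lambda a+\mu b)=\lambda^3N(a)+\lambda^2\mu N^{(2,1)}(a,b)+\lambda\mu^2N^{(1,2)}(a,b)+\mu^3N(b)$. Let $A=K\oplus J$ with product $(k_1,j_1)(k_2,j_2)=(k_1k_2+T(j_1,j_2),\,k_1j_2+\bar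 k_2j_1+j_1\times j_2)$ and involution $\overline{(k,j)}=(\bar k,j)$. Put $V_{a,b}c=-(a\bar b)c-(c\bar b)a+(c\bar a)b$ and let $I\subseteq\operatorname{End}_R(A)\times\operatorname{End}_R(A)$ be the $R$-span of all $(V_{a,b},-V_{b,a})$; it is closed under commutators. The associated Lie algebra is the $\mathbb Z$-graded $R$-Lie algebra $$L=R(t-\bar t)_{2}\oplus A_1\oplus I\oplus A_{-1}\oplus R(t-\bar t)_{-2}$$ (components of degrees $2,1,0,-1,-2$) in which $I$ is a subalgebra with the commutator bracket, $[(f,g),(x,y)]=(fx,gy)$ for $(f,g)\in I$ and $(x,y)\in A_1\times A_{-1}$, and $$[(x_1,y_1),(x_2,y_2)]=(x_1\bar x_2-x_2\bar x_1)_2+(V_{x_1,y_2}-V_{x_2,y_1},\,-V_{y_2,x_1}+V_{y_1,x_2})+(y_1\bar y_2-y_2\bar y_1)_{-2};$$ the remaining brackets are determined by these, e.g. $[y_{-1},s_2]=(sy)_1$ and $[x_1,s_{-2}]=(sx)_{-1}$. Let $G$ be the set of all $((a,v),(u,av+v^\sharp))\in A^2$ with $u+\bar u=a\bar a+T(v,v)$.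 For $(x,y)\in G$, $\exp_+(x,y)$ denotes the unique Lie algebra automorphism of $L$ of the form $1+\varphi_1+\varphi_2+\varphi_3+\varphi_4$ with $\varphi_i$ $R$-linear and raising the degree by $i$, such that $\varphi_1=\operatorname{ad}x_1$ and, for all $c\in A$, $$\varphi_2(c_{-1})=((x\bar c)x-yc)_1,\qquad \varphi_3(c_{-1})=(T_{(x,y)}c)_2,$$ where, for $x=(a,v)$, $y=(u,av+v^\sharp)$ and $c=(b,w)$, $T_{(x,y)}c=F-\overline F$ with $$F=(T(v,v)-\bar u)\,a\bar b+(a\bar a-\bar u)\,T(v,w)+a\,T(w,v^\sharp)+b\,N(v)-T(w,v\times v^\sharp).$$ $\exp_-(x,y)$ is the same automorphism with the grading reversed, i.e. the conjugate of $\exp_+(x,y)$ by the automorphism $(s,x',(f,g),y',r)\mapsto(r,y',(g,f),x',s)$ of $L$. An element $g\in G$ is called one-invertible if there are $g_l,g_r\in G$ such that $\exp_-(g_l)\exp_+(g)\exp_-(g_r)$ maps the component $L_i$ of $L$ onto $L_{-i}$ for all $i$. The quartic norm of $g=((a,v),(u,av+v^\sharp))\in G$ is $$\nu(g)=u\bar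 u-a\bar a\,T(v,v)+a\,N(v)+\bar a\,\overline{N(v)}-T(v^\sharp,v^\sharp)\in R.$$ **Proposition.** Let $J$ be an arbitrary hermitian cubic norm structure over $K/R$ and let $g=((a,v),(u,av+v^\sharp))\in G$ be such that $N(v^\sharp)=\overline{N(v)}^2$. Then $g$ is one-invertible if and only if $\nu(g)$ is invertible in $R$. -/

import Mathlib

set_option linter.unusedSimpArgs false
set_option linter.unusedSectionVars false

open scoped TensorProduct

universe u v

/-- The quadratic extension `K = R[t]/(t² - t + α)`, with `t = ω` and the involution `star`,
which is `R`-linear and maps `t` to `1 - t`. -/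
abbrev QuadExt (R : Type u) [CommRing R] (α : R) : Type u := QuadraticAlgebra R (-α) 1

namespace QuadExt

variable (R : Type u) [CommRing R] (α : R)

/-- The involution of `K` as an `R`-linear map. -/
def conj : QuadExt R α →ₗ[R] QuadExt R α where
  toFun := star
  map_add' := star_add
  map_smul' r z := by ext <;> simp <;> ring

/-- The submodule `R (t - t̄)` of `K`. -/
def skew : Submodule R (QuadExt R α) :=
  Submodule.span R {QuadraticAlgebra.omega - star QuadraticAlgebra.omega}

variable {R α}

theorem sub_star_mem_skew (z : QuadExt R α) : z - star z ∈ skew R α := by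
  rw [QuadraticAlgebra.sub_star]
  exact Submodule.smul_mem _ _ (Submodule.subset_span rfl)

theorem star_of_mem_skew {s : QuadExt R α} (hs : s ∈ skew R α) : star s = -s := by
  obtain ⟨r, rfl⟩ := Submodule.mem_span_singleton.1 hs
  ext <;> simp <;> ring

end QuadExt

section ScalarExtension

variable {R : Type u} [CommRing R] {α : R} {J : Type v} [AddCommGroup J] [Module (QuadExt R α) J]
  [Module R J] [IsScalarTower R (QuadExt R α) J]
  (S : Type u) [CommRing S] [Algebra R S]

/-- The extension to `S` of an `R`-bilinear map. -/
noncomputable def bilinExt {M N P : Type*} [AddCommGroup M] [Module R M] [AddCommGroup N]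
    [Module R N] [AddCommGroup P] [Module R P] (f : M →ₗ[R] N →ₗ[R] P) :
    (S ⊗[R] M) →ₗ[R] (S ⊗[R] N) →ₗ[R] (S ⊗[R] P) :=
  TensorProduct.map₂ (LinearMap.mul R S) f

/-- The involution of `K_S = S ⊗ K ≅ S[t]/(t² - t + α)`. -/
noncomputable def conjExt : (S ⊗[R] QuadExt R α) →ₗ[S] (S ⊗[R] QuadExt R α) :=
  (QuadExt.conj R α).baseChange S

/-- The action of `K_S` on `J_S = S ⊗ J`. -/
noncomputable def smulExt :
    (S ⊗[R] QuadExt R α) →ₗ[R] (S ⊗[R] J) →ₗ[R] (S ⊗[R] J) :=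
  bilinExt S (Algebra.lsmul R R J).toLinearMap

end ScalarExtension

/-- A hermitian cubic norm structure on the `K`-module `J`. The maps `N` and `♯` are polynomial laws
over `R`, and the axioms are imposed over all scalar extensions `S ⊗ K ≅ S[t]/(t² - t + α)` of `K`
that come from commutative `R`-algebras `S`. -/
structure HermitianCubicNormStructure (R : Type u) [CommRing R] (α : R) (J : Type v)
    [AddCommGroup J] [Module (QuadExt R α) J] [Module R J] [IsScalarTower R (QuadExt R α) J] where
  /-- `1 - 4 α` is invertible. -/
  isUnit_disc : IsUnit (1 - 4 * α)
  /-- The cubic norm. -/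
  N : J →ₚₗ[R] QuadExt R α
  /-- The quadratic map `♯`. -/
  sharp : J →ₚₗ[R] J
  /-- The linearisation `×` of `♯`. -/
  cross : J →ₗ[R] J →ₗ[R] J
  /-- The hermitian form, linear in the first argument. -/
  T : J →ₗ[R] J →ₗ[R] QuadExt R α
  /-- `N` is `K`-homogeneous of degree `3`. -/
  N_smul (S : Type u) [CommRing S] [Algebra R S] (k : S ⊗[R] QuadExt R α) (a : S ⊗[R] J) :
    N.toFun' S (smulExt S k a) = k ^ 3 * N.toFun' S a
  /-- `(k a)♯ = k̄² a♯`. -/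
  sharp_smul (S : Type u) [CommRing S] [Algebra R S] (k : S ⊗[R] QuadExt R α) (a : S ⊗[R] J) :
    sharp.toFun' S (smulExt S k a) = smulExt S (conjExt S k ^ 2) (sharp.toFun' S a)
  /-- `♯` is quadratic with linearisation `×`. -/
  sharp_add (S : Type u) [CommRing S] [Algebra R S] (a b : S ⊗[R] J) :
    sharp.toFun' S (a + b) = sharp.toFun' S a + sharp.toFun' S b + bilinExt S cross a b
  cross_smul_left (k : QuadExt R α) (a b : J) : cross (k • a) b = star k • cross a b
  cross_smul_right (k : QuadExt R α) (a b : J) : cross a (k • b) = star k • cross a b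
  T_smul_left (k : QuadExt R α) (a b : J) : T (k • a) b = k * T a b
  T_symm (a b : J) : T b a = star (T a b)
  /-- `N` is cubic, and its linearisation of degree `(1, 2)` satisfies `N^{(1,2)}(a, b) = T(a, b♯)`;
  the one of degree `(2, 1)` is `N^{(2,1)}(a, b) = N^{(1,2)}(b, a)`. -/
  N_linearisation (S : Type u) [CommRing S] [Algebra R S] (r s : S) (a b : S ⊗[R] J) :
    N.toFun' S (r • a + s • b) = r ^ 3 • N.toFun' S a
      + (r ^ 2 * s) • bilinExt S T b (sharp.toFun' S a)
      + (r * s ^ 2) • bilinExt S T a (sharp.toFun' S b) + s ^ 3 • N.toFun' S b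
  /-- `(a♯)♯ = N(a) a`. -/
  sharp_sharp (S : Type u) [CommRing S] [Algebra R S] (a : S ⊗[R] J) :
    sharp.toFun' S (sharp.toFun' S a) = smulExt S (N.toFun' S a) a
  /-- `(a♯ × b) × a = N(a)̄ b + T(b, a) a♯`, where `N(a)̄` is the conjugate of `N(a)`. -/
  cross_cross (S : Type u) [CommRing S] [Algebra R S] (a b : S ⊗[R] J) :
    bilinExt S cross (bilinExt S cross (sharp.toFun' S a) b) a =
      smulExt S (conjExt S (N.toFun' S a)) b + smulExt S (bilinExt S T b a) (sharp.toFun' S a)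
  /-- `N(T(a, b) a - a♯ × b) = N(a)² N(b)̄`, where `N(b)̄` is the conjugate of `N(b)`. -/
  N_adjoint (S : Type u) [CommRing S] [Algebra R S] (a b : S ⊗[R] J) :
    N.toFun' S (smulExt S (bilinExt S T a b) a - bilinExt S cross (sharp.toFun' S a) b) =
      N.toFun' S a ^ 2 * conjExt S (N.toFun' S b)

namespace HermitianCubicNormStructure

variable {R : Type u} [CommRing R] {α : R} {J : Type v} [AddCommGroup J] [Module (QuadExt R α) J]
  [Module R J] [IsScalarTower R (QuadExt R α) J] (H : HermitianCubicNormStructure R α J)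

theorem one_tmul_inj {M : Type*} [AddCommGroup M] [Module R M] {a b : M}
    (h : (1 : R) ⊗ₜ[R] a = 1 ⊗ₜ[R] b) : a = b := by
  simpa using congrArg (TensorProduct.lid R M) h

theorem sharp_add' (a b : J) : H.sharp (a + b) = H.sharp a + H.sharp b + H.cross a b := by
  have := H.sharp_add R (1 ⊗ₜ a) (1 ⊗ₜ b)
  rw [← TensorProduct.tmul_add] at this
  simp only [← PolynomialLaw.one_tmul_ground_apply', bilinExt, TensorProduct.map₂_apply_tmul] at this
  apply one_tmul_inj (R := R)
  simp only [this, TensorProduct.tmul_add]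
  simp

theorem N_add' (a b : J) : H.N (a + b) =
    H.N a + H.T b (H.sharp a) + H.T a (H.sharp b) + H.N b := by
  have := H.N_linearisation R 1 1 (1 ⊗ₜ a) (1 ⊗ₜ b)
  simp only [one_smul, one_pow, mul_one] at this
  rw [← TensorProduct.tmul_add] at this
  simp only [← PolynomialLaw.one_tmul_ground_apply', bilinExt, TensorProduct.map₂_apply_tmul] at this
  apply one_tmul_inj (R := R)
  simp only [this, TensorProduct.tmul_add]
  simp

theorem cross_cross' (a b : J) : H.cross (H.cross (H.sharp a) b) a =
    star (H.N a) • b + H.T b a • H.sharp a := by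
  have := H.cross_cross R (1 ⊗ₜ a) (1 ⊗ₜ b)
  simp only [← PolynomialLaw.one_tmul_ground_apply', bilinExt, smulExt, conjExt,
    TensorProduct.map₂_apply_tmul, LinearMap.baseChange_tmul] at this
  apply one_tmul_inj (R := R)
  simpa [TensorProduct.tmul_add, QuadExt.conj] using this

theorem cross_comm (a b : J) : H.cross a b = H.cross b a := by
  have h1 := H.sharp_add' a b
  have h2 := H.sharp_add' b a
  rw [add_comm b a, h1, add_comm (H.sharp b)] at h2
  exact add_left_cancel h2

theorem T_smul_right (k : QuadExt R α) (a b : J) : H.T a (k • b) = star k * H.T a b := by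
  rw [H.T_symm, H.T_smul_left, star_mul', ← H.T_symm]

theorem star_T (a b : J) : star (H.T a b) = H.T b a := (H.T_symm a b).symm

theorem T_cross_comm (a b c : J) : H.T a (H.cross b c) = H.T b (H.cross a c) := by
  have h1 := H.N_add' (a + b) c
  have h2 := H.N_add' (c + b) a
  rw [show c + b + a = a + b + c by abel, h1] at h2
  simp only [H.sharp_add', H.N_add', map_add, LinearMap.add_apply] at h2
  have h3 := H.N_add' (a + c) b
  rw [show a + c + b = a + b + c by abel, h1] at h3
  simp only [H.sharp_add', H.N_add', map_add, LinearMap.add_apply] at h3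
  have h4 : H.T c (H.cross a b) = H.T a (H.cross b c) := by
    rw [H.cross_comm b c]; linear_combination h2
  have h5 : H.T c (H.cross a b) = H.T b (H.cross a c) := by linear_combination h3
  rw [← h4, h5]

theorem T_cross_left (a b c : J) : H.T (H.cross b c) a = H.T (H.cross a c) b := by
  rw [← H.star_T, H.T_cross_comm, H.star_T]

theorem cross_cross_linear (a b c d : J) :
    H.cross (H.cross (H.cross a c) b) d + H.cross (H.cross (H.cross a d) b) c
      + H.cross (H.cross (H.cross c d) b) a =
    H.T (H.cross c d) a • b + H.T b a • H.cross c d + H.T b c • H.cross a d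
      + H.T b d • H.cross a c := by
  have e0 := H.cross_cross' (a + c + d) b
  have e1 := H.cross_cross' (a + c) b
  have e2 := H.cross_cross' (a + d) b
  have e3 := H.cross_cross' (c + d) b
  have e4 := H.cross_cross' a b
  have e5 := H.cross_cross' c b
  have e6 := H.cross_cross' d b
  simp only [H.sharp_add', H.N_add', map_add, LinearMap.add_apply, star_add, H.star_T, add_smul,
    smul_add] at e0 e1 e2 e3
  have hc : H.T (H.cross a c) d = H.T (H.cross c d) a := by
    rw [H.cross_comm a c, H.T_cross_left, H.cross_comm d a, H.T_cross_left, H.cross_comm c d,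
      H.T_cross_left]
  rw [← hc]
  linear_combination (norm := module) e0 - e1 - e2 - e3 + e4 + e5 + e6

theorem star_smul' (r : R) (k : QuadExt R α) : star (r • k) = r • star k :=
  (QuadExt.conj R α).map_smul r k

/-- The product of the associated structurable algebra `A = K ⊕ J`. -/
def mul : (QuadExt R α × J) →ₗ[R] (QuadExt R α × J) →ₗ[R] (QuadExt R α × J) :=
  LinearMap.mk₂ R
    (fun x y => (x.1 * y.1 + H.T x.2 y.2, x.1 • y.2 + star y.1 • x.2 + H.cross x.2 y.2))
    (fun x x' y => by ext1 <;> simp [add_mul, add_smul] <;> abel)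
    (fun r x y => by ext1 <;> simp [smul_add, smul_comm r])
    (fun x y y' => by ext1 <;> simp [mul_add, add_smul] <;> abel)
    (fun r x y => by ext1 <;> simp [smul_add, smul_comm r, star_smul'])

/-- The involution of `A`. -/
def bar : (QuadExt R α × J) →ₗ[R] (QuadExt R α × J) := (QuadExt.conj R α).prodMap LinearMap.id

/-- `V_{a,b} c = -(a b̄) c - (c b̄) a + (c ā) b`. -/
def V : (QuadExt R α × J) →ₗ[R] (QuadExt R α × J) →ₗ[R] Module.End R (QuadExt R α × J) :=
  LinearMap.mk₂ R
    (fun a b =>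
      { toFun := fun c =>
          -H.mul (H.mul a (bar b)) c - H.mul (H.mul c (bar b)) a + H.mul (H.mul c (bar a)) b
        map_add' := fun c c' => by simp only [map_add, LinearMap.add_apply]; abel
        map_smul' := fun r c => by
          simp only [map_smul, LinearMap.smul_apply, RingHom.id_apply, smul_add, smul_sub,
            smul_neg] })
    (fun a a' b => by
      refine LinearMap.ext fun c => ?_
      simp only [map_add, LinearMap.add_apply, LinearMap.coe_mk, AddHom.coe_mk]; abel)
    (fun r a b => by
      refine LinearMap.ext fun c => ?_
      simp only [map_smul, LinearMap.smul_apply, LinearMap.coe_mk, AddHom.coe_mk, smul_add,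
        smul_sub, smul_neg])
    (fun a b b' => by
      refine LinearMap.ext fun c => ?_
      simp only [map_add, LinearMap.add_apply, LinearMap.coe_mk, AddHom.coe_mk]; abel)
    (fun r a b => by
      refine LinearMap.ext fun c => ?_
      simp only [map_smul, LinearMap.smul_apply, LinearMap.coe_mk, AddHom.coe_mk, smul_add,
        smul_sub, smul_neg])

theorem mul_apply (x y : QuadExt R α × J) : H.mul x y =
    (x.1 * y.1 + H.T x.2 y.2, x.1 • y.2 + star y.1 • x.2 + H.cross x.2 y.2) := rfl

theorem bar_apply (x : QuadExt R α × J) : bar x = (star x.1, x.2) := rfl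

theorem V_apply (a b c : QuadExt R α × J) : H.V a b c =
    -H.mul (H.mul a (bar b)) c - H.mul (H.mul c (bar b)) a + H.mul (H.mul c (bar a)) b := rfl

/-- An auxiliary trilinear map on `J`, used to describe the restriction of `V` to `J`. -/
def D (a b c : J) : J := H.T a b • c + H.T c b • a - H.cross (H.cross a c) b

theorem D_smul (k : QuadExt R α) (a b c : J) : H.D a b (k • c) = k • H.D a b c := by
  simp only [D, H.T_smul_left, H.cross_smul_left, H.cross_smul_right, star_star]
  module

theorem D_add (a b c d : J) : H.D a b (c + d) = H.D a b c + H.D a b d := by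
  simp only [D, map_add, LinearMap.add_apply]
  module

theorem T_D (a b c d : J) : H.T (H.D a b c) d = H.T c (H.D b a d) := by
  have h : H.T (H.cross (H.cross a c) b) d = H.T c (H.cross (H.cross b d) a) := by
    rw [H.T_cross_left, H.cross_comm a c, H.T_cross_comm, H.cross_comm d b]
  simp only [D, map_add, map_sub, LinearMap.add_apply, LinearMap.sub_apply, H.T_smul_left,
    H.T_smul_right, h, H.star_T]
  ring

theorem D_cross (a b c d : J) : H.D b a (H.cross c d) =
    2 • H.T b a • H.cross c d - H.cross (H.D a b c) d - H.cross c (H.D a b d) := by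
  have := H.cross_cross_linear a b c d
  rw [H.cross_comm c (H.D a b d)]
  simp only [D, map_add, map_sub, LinearMap.add_apply, LinearMap.sub_apply, H.cross_smul_left,
    H.star_T, H.cross_comm b (H.cross c d), H.cross_comm d c]
  linear_combination (norm := module) -this

theorem V_formula (a b c : QuadExt R α × J) : H.V a b c =
    ((star a.1 * b.1 - 2 * a.1 * star b.1 - H.T b.2 a.2) * c.1
        - H.T (a.1 • b.2 + b.1 • a.2 + H.cross a.2 b.2) c.2,
      (-(star a.1 * b.1) - H.T b.2 a.2) • c.2 + H.D b.2 a.2 c.2 - H.D a.2 b.2 c.2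
        - star c.1 • (a.1 • b.2 + b.1 • a.2 + H.cross a.2 b.2)
        - H.cross (a.1 • b.2 + b.1 • a.2 + H.cross a.2 b.2) c.2) := by
  obtain ⟨a0, a⟩ := a
  obtain ⟨b0, b⟩ := b
  obtain ⟨c0, c⟩ := c
  simp only [V_apply, mul_apply, bar_apply, Prod.mk_add_mk, Prod.neg_mk, Prod.mk_sub_mk]
  ext1
  · simp only [map_add, LinearMap.add_apply, H.T_smul_left, star_star]
    have h1 := H.T_cross_left a c b
    have h2 := H.T_cross_left b c a
    rw [H.cross_comm b a] at h2
    linear_combination -h1 + h2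
  · simp only [D, map_add, LinearMap.add_apply, H.cross_smul_left, star_star, H.cross_comm b a,
      H.cross_comm c a, H.cross_comm c b]
    module

theorem sharp_sharp' (a : J) : H.sharp (H.sharp a) = H.N a • a := by
  have := H.sharp_sharp R (1 ⊗ₜ a)
  simp only [← PolynomialLaw.one_tmul_ground_apply', bilinExt, smulExt,
    TensorProduct.map₂_apply_tmul] at this
  apply one_tmul_inj (R := R)
  simpa using this

theorem T_cross_cyc (a b c : J) : H.T c (H.cross a b) = H.T a (H.cross b c) := by
  rw [H.cross_comm b c, H.T_cross_comm]

/-- The part of `♯♯ = N · id` of degree `(2,1,1)`, plus that of degree `(1,2,1)`, `(1,1,2)`. -/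
theorem sharp_sharp_aux (a b : J) : H.cross (H.sharp a) (H.sharp b) + H.sharp (H.cross a b)
      + H.cross (H.sharp a) (H.cross a b) + H.cross (H.sharp b) (H.cross a b) =
    H.T b (H.sharp a) • (a + b) + H.T a (H.sharp b) • (a + b) + H.N a • b + H.N b • a := by
  have e0 := H.sharp_sharp' (a + b)
  have e1 := H.sharp_sharp' a
  have e2 := H.sharp_sharp' b
  simp only [H.sharp_add', H.N_add', map_add, LinearMap.add_apply] at e0
  linear_combination (norm := module) e0 - e1 - e2

theorem cross_cross_cross (a b c d : J) :
    H.cross (H.cross a b) (H.cross c d) + H.cross (H.cross a c) (H.cross b d)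
      + H.cross (H.cross a d) (H.cross b c) =
    H.T a (H.cross b c) • d + H.T a (H.cross b d) • c + H.T a (H.cross c d) • b
      + H.T b (H.cross c d) • a := by
  have e0 := H.sharp_sharp_aux (a + b) (c + d)
  have e1 := H.sharp_sharp_aux a c
  have e2 := H.sharp_sharp_aux a d
  have e3 := H.sharp_sharp_aux b c
  have e4 := H.sharp_sharp_aux b d
  have e5 := H.sharp_sharp_aux (a + b) c
  have e6 := H.sharp_sharp_aux (a + b) d
  have e7 := H.sharp_sharp_aux a (c + d)
  have e8 := H.sharp_sharp_aux b (c + d)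
  simp only [H.sharp_add', H.N_add', map_add, LinearMap.add_apply] at e0 e5 e6 e7 e8
  have h1 := H.T_cross_cyc a b c
  have h2 := H.T_cross_cyc a b d
  simp only [H.cross_comm (H.cross b c) (H.cross a d), h1, h2] at e0 e5 e6 e7 e8
  linear_combination (norm := module) e0 - e5 - e6 - e7 - e8 + e1 + e2 + e3 + e4

theorem D_add_left (a a' b c : J) : H.D (a + a') b c = H.D a b c + H.D a' b c := by
  simp only [D, map_add, LinearMap.add_apply]; module
theorem D_add_mid (a b b' c : J) : H.D a (b + b') c = H.D a b c + H.D a b' c := by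
  simp only [D, map_add, LinearMap.add_apply]; module
theorem D_sub_left (a a' b c : J) : H.D (a - a') b c = H.D a b c - H.D a' b c := by
  simp only [D, map_sub, LinearMap.sub_apply]; module
theorem D_sub_mid (a b b' c : J) : H.D a (b - b') c = H.D a b c - H.D a b' c := by
  simp only [D, map_sub, LinearMap.sub_apply]; module
theorem D_sub (a b c c' : J) : H.D a b (c - c') = H.D a b c - H.D a b c' := by
  simp only [D, map_sub, LinearMap.sub_apply]; module
theorem D_smul_left (k : QuadExt R α) (a b c : J) : H.D (k • a) b c = k • H.D a b c := by
  simp only [D, H.T_smul_left, H.cross_smul_left, H.cross_smul_right, star_star]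
  module
theorem D_smul_mid (k : QuadExt R α) (a b c : J) : H.D a (k • b) c = star k • H.D a b c := by
  simp only [D, H.T_smul_right, H.cross_smul_right]
  module

theorem D_cross_left (a b c e : J) : H.D (H.cross a b) c e + H.D (H.cross a c) b e
    + H.D (H.cross b c) a e = (2 * H.T (H.cross a b) c) • e := by
  have h := H.cross_cross_linear a e b c
  have h1 : H.T (H.cross a c) b = H.T (H.cross a b) c := by
    rw [H.cross_comm a c, H.T_cross_left, H.cross_comm b a]
  have h2 : H.T (H.cross b c) a = H.T (H.cross a b) c := by
    rw [H.cross_comm b c, H.T_cross_left, H.cross_comm]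
  simp only [D, h1, h2] at h ⊢
  linear_combination (norm := module) -h

theorem D_cross_mid (a b c e : J) : H.D c (H.cross a b) e + H.D b (H.cross a c) e
    + H.D a (H.cross b c) e = (2 * H.T a (H.cross b c)) • e := by
  have h := H.cross_cross_cross e a b c
  have h1 : H.T b (H.cross a c) = H.T a (H.cross b c) := H.T_cross_comm _ _ _
  have h2 : H.T c (H.cross a b) = H.T a (H.cross b c) := by
    rw [H.T_cross_comm, H.cross_comm c b]
  simp only [D, h1, h2] at h ⊢
  rw [H.cross_comm c e, H.cross_comm b e, H.cross_comm a e,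
    H.cross_comm (H.cross e c), H.cross_comm (H.cross e b),
    H.cross_comm (H.cross e a)]
  rw [H.cross_comm (H.cross e a), H.cross_comm (H.cross e b), H.cross_comm (H.cross e c)] at h
  linear_combination (norm := module) -h

/-- `D a b` as a `K`-linear map. -/
def DL (a b : J) : J →ₗ[QuadExt R α] J where
  toFun := H.D a b
  map_add' := H.D_add a b
  map_smul' k c := H.D_smul k a b c

/-- An auxiliary description of the elements `(f, g)` of the inner structure algebra. -/
structure InnerData (f g : Module.End R (QuadExt R α × J)) where
  l : QuadExt R α
  m : J
  Δ : J →ₗ[QuadExt R α] J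
  hf : ∀ c, f c = (l * c.1 - H.T m c.2, Δ c.2 - star c.1 • m - H.cross m c.2)
  hg : ∀ c, g c = (-star l * c.1 + H.T m c.2,
    Δ c.2 - (l + star l) • c.2 + star c.1 • m + H.cross m c.2)
  hT : ∀ c d, H.T (Δ c) d = (l + star l) * H.T c d - H.T c (Δ d)
  hX : ∀ c d, Δ (H.cross c d) = H.cross (Δ c) d + H.cross c (Δ d) - l • H.cross c d

/-- The description of `(V_{a,b}, -V_{b,a})`. -/
def InnerData.ofV (a b : QuadExt R α × J) : H.InnerData (H.V a b) (-H.V b a) where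
  l := star a.1 * b.1 - 2 * a.1 * star b.1 - H.T b.2 a.2
  m := a.1 • b.2 + b.1 • a.2 + H.cross a.2 b.2
  Δ := (-(star a.1 * b.1) - H.T b.2 a.2) • LinearMap.id + H.DL b.2 a.2 - H.DL a.2 b.2
  hf c := by
    rw [H.V_formula]; ext1
    · rfl
    · simp [DL]
  hg c := by
    rw [LinearMap.neg_apply, H.V_formula, add_comm (b.1 • a.2), H.cross_comm b.2 a.2]; ext1
    · simp [H.star_T, -neg_sub]; ring
    · simp [DL, H.star_T]; module
  hT c d := by
    simp only [LinearMap.sub_apply, LinearMap.add_apply, LinearMap.smul_apply, LinearMap.id_apply,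
      map_add, map_sub, H.T_smul_left, H.T_smul_right, DL, LinearMap.coe_mk, AddHom.coe_mk,
      H.T_D, star_add, star_sub, star_mul', star_neg, star_star, H.star_T, star_ofNat]
    ring
  hX c d := by
    simp only [LinearMap.sub_apply, LinearMap.add_apply, LinearMap.smul_apply, LinearMap.id_apply,
      map_add, map_sub, H.cross_smul_left, H.cross_smul_right, DL, LinearMap.coe_mk, AddHom.coe_mk,
      H.D_cross, star_add, star_sub, star_mul', star_neg, star_star, H.star_T]
    module

theorem InnerData.V_comm {H : HermitianCubicNormStructure R α J} {f g : Module.End R (QuadExt R α × J)} (h : H.InnerData f g)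
    (c d e : QuadExt R α × J) :
    f (H.V c d e) - H.V c d (f e) = H.V (f c) d e + H.V c (g d) e := by
  obtain ⟨l, m, Δ, hf, hg, hT, hX⟩ := h
  simp only [hf, hg, H.V_formula]
  obtain ⟨c0, c⟩ := c
  obtain ⟨d0, d⟩ := d
  obtain ⟨e0, e⟩ := e
  have hD : ∀ a b c, Δ (H.D a b c) = H.D (Δ a) b c + H.D a (Δ b) c - (l + star l) • H.D a b c
      + H.D a b (Δ c) := by
    intro a b c
    simp only [D, map_add, map_sub, LinearMap.map_smul, hX, hT, LinearMap.add_apply,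
      LinearMap.sub_apply, H.cross_smul_left, H.T_smul_left]
    rw [H.cross_comm (H.cross a c) (Δ b), H.cross_comm (Δ b)]
    module
  ext1
  · simp only [Prod.fst_sub, Prod.snd_sub, Prod.fst_add, Prod.snd_add, map_add, map_sub,
      LinearMap.add_apply, LinearMap.sub_apply, LinearMap.map_smul, map_neg, LinearMap.neg_apply,
      H.T_smul_left, H.T_smul_right, H.cross_smul_left, H.cross_smul_right, hX,
      hT, star_add, star_sub, star_mul', star_neg, star_star, H.star_T, star_ofNat]
    have t1 := hT (H.cross c d) e
    rw [hX] at t1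
    simp only [map_add, map_sub, LinearMap.add_apply, LinearMap.sub_apply, H.T_smul_left] at t1
    have t2 := H.T_cross_comm m (H.cross c d) e
    have t3 : ∀ c d, H.T (H.cross (H.cross m c) d) e = H.T m (H.cross (H.cross d e) c) := by
      intro c d
      rw [H.T_cross_left, H.T_cross_comm, H.cross_comm e d]
    have t4 := t3 c d
    have t5 := t3 d c
    have t6 := H.T_cross_comm m c e
    have t7 := H.T_cross_comm m d e
    have t8 := H.T_cross_comm m c d
    have t9 := H.T_cross_comm m d c
    have t10 := H.T_cross_left m c d
    have t11 := H.T_cross_left c m d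
    rw [H.cross_comm d c] at t9
    rw [H.cross_comm c (H.cross m d), H.cross_comm c m]
    simp only [D, map_add, map_sub, H.T_smul_right, H.star_T]
    linear_combination t1 + t2 - t4 + t5 + d0 * t6 + c0 * t7 + e0 * t9 - e0 * t10
  · have h1 := H.D_cross_left m c d e
    have h2 := H.D_cross_mid m c d e
    have u : ∀ a b c, H.D a b c = H.T a b • c + H.T c b • a - H.cross (H.cross a c) b :=
      fun _ _ _ => rfl
    simp only [Prod.fst_sub, Prod.snd_sub, Prod.fst_add, Prod.snd_add, map_add, map_sub,
      LinearMap.add_apply, LinearMap.sub_apply, LinearMap.map_smul, map_neg, LinearMap.neg_apply,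
      H.D_add_left, H.D_add_mid, H.D_add, H.D_sub_left, H.D_sub_mid, H.D_sub, 
      H.D_smul_left, H.D_smul_mid, H.D_smul, hD, H.D_cross,
      H.T_smul_left, H.T_smul_right, H.cross_smul_left, H.cross_smul_right, hX,
      hT, star_add, star_sub, star_mul', star_neg, star_star, H.star_T, star_ofNat]
    rw [u (H.cross c d) m] at h1
    rw [u m (H.cross c d)] at h2
    rw [u c d m, u d c m, u d m, u m d, u c m, u m c]
    have t1 : H.T (H.cross m d) c = H.T (H.cross m c) d := by
      rw [H.T_cross_left, H.cross_comm c d, H.T_cross_left]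
    have t3 : H.T (H.cross c d) m = H.T (H.cross m c) d := by
      rw [H.cross_comm c d, H.T_cross_left]
    have t2 : H.T d (H.cross m c) = H.T m (H.cross c d) := by
      rw [H.T_cross_comm, H.cross_comm c d]
    have k1 : ∀ x y, H.cross m (H.cross x y) = H.cross (H.cross x y) m := fun x y => H.cross_comm _ _
    have k2 : ∀ x y, H.cross c (H.cross x y) = H.cross (H.cross x y) c := fun x y => H.cross_comm _ _
    have k3 : ∀ x y, H.cross d (H.cross x y) = H.cross (H.cross x y) d := fun x y => H.cross_comm _ _
    have k4 := H.cross_comm (H.cross c d) (H.cross m e)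
    simp only [k1, k2, k3, k4, H.cross_comm d c, H.cross_comm d m, H.cross_comm c m,
      H.cross_comm e m, t1, t2, t3, map_add, map_sub, LinearMap.add_apply, LinearMap.sub_apply,
      H.cross_smul_left, H.cross_smul_right, H.star_T] at h1 h2 ⊢
    linear_combination (norm := module) -h1 + h2

/-- The description of `(g, f)`. -/
def InnerData.swap {H : HermitianCubicNormStructure R α J} {f g : Module.End R (QuadExt R α × J)}
    (h : H.InnerData f g) : H.InnerData g f where
  l := -star h.l
  m := -h.m
  Δ := h.Δ - (h.l + star h.l) • LinearMap.id
  hf c := by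
    rw [h.hg]; ext1
    · simp
    · simp
  hg c := by
    rw [h.hf]; ext1
    · simp; abel
    · simp; module
  hT c d := by
    simp only [LinearMap.sub_apply, LinearMap.smul_apply, LinearMap.id_apply, map_sub, h.hT,
      H.T_smul_left, H.T_smul_right, star_neg, star_star, star_add]
    ring
  hX c d := by
    simp only [LinearMap.sub_apply, LinearMap.smul_apply, LinearMap.id_apply, map_sub, h.hX,
      H.cross_smul_left, H.cross_smul_right, star_neg, star_star, star_add]
    module

/-- The description of a sum. -/
def InnerData.add {H : HermitianCubicNormStructure R α J} {f g f' g': Module.End R (QuadExt R α × J)}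
    (h : H.InnerData f g) (h' : H.InnerData f' g') : H.InnerData (f + f') (g + g') where
  l := h.l + h'.l
  m := h.m + h'.m
  Δ := h.Δ + h'.Δ
  hf c := by
    rw [LinearMap.add_apply, h.hf, h'.hf]; ext1
    · simp; ring
    · simp; module
  hg c := by
    rw [LinearMap.add_apply, h.hg, h'.hg]; ext1
    · simp; ring
    · simp; module
  hT c d := by
    simp only [LinearMap.add_apply, map_add, h.hT, h'.hT, star_add]
    ring
  hX c d := by
    simp only [LinearMap.add_apply, map_add, h.hX, h'.hX]
    module

/-- The description of a scalar multiple. -/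
def InnerData.smul {H : HermitianCubicNormStructure R α J} (r : R)
    {f g : Module.End R (QuadExt R α × J)}
    (h : H.InnerData f g) : H.InnerData (r • f) (r • g) where
  l := r • h.l
  m := r • h.m
  Δ := r • h.Δ
  hf c := by
    rw [LinearMap.smul_apply, h.hf]; ext1
    · simp [smul_sub]
    · simp [smul_sub]; rw [smul_comm]
  hg c := by
    rw [LinearMap.smul_apply, h.hg]; ext1
    · simp [smul_add, star_smul']
    · simp [smul_sub, smul_add, star_smul', add_smul]; rw [smul_comm]
  hT c d := by
    simp [h.hT, star_smul', smul_sub, smul_add, ← smul_add]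
  hX c d := by
    simp [h.hX, smul_sub, smul_add, ← smul_add]

/-- The inner structure algebra `I`, the `R`-span of the pairs `(V_{a,b}, -V_{b,a})`. It is closed
under the componentwise commutator, see `comm_mem`. -/
def inner : Submodule R (Module.End R (QuadExt R α × J) × Module.End R (QuadExt R α × J)) :=
  Submodule.span R {p | ∃ a b, p = (H.V a b, -H.V b a)}

theorem exists_innerData {p : Module.End R (QuadExt R α × J) × Module.End R (QuadExt R α × J)}
    (hp : p ∈ H.inner) : Nonempty (H.InnerData p.1 p.2) := by
  induction hp using Submodule.span_induction with
  | mem x h => obtain ⟨a, b, rfl⟩ := h; exact ⟨InnerData.ofV H a b⟩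
  | zero => exact ⟨by simpa using InnerData.smul 0 (InnerData.ofV H 0 0)⟩
  | add x y _ _ hx hy => exact ⟨hx.some.add hy.some⟩
  | smul r x _ hx => exact ⟨hx.some.smul r⟩

theorem V_mem (a b : QuadExt R α × J) : (H.V a b, -H.V b a) ∈ H.inner :=
  Submodule.subset_span ⟨a, b, rfl⟩

theorem comm_V {p : Module.End R (QuadExt R α × J) × Module.End R (QuadExt R α × J)}
    (hp : p ∈ H.inner) (c d : QuadExt R α × J) :
    p.1 * H.V c d - H.V c d * p.1 = H.V (p.1 c) d + H.V c (p.2 d) := by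
  obtain ⟨h⟩ := H.exists_innerData hp
  exact LinearMap.ext fun e => h.V_comm c d e

theorem comm_V' {p : Module.End R (QuadExt R α × J) × Module.End R (QuadExt R α × J)}
    (hp : p ∈ H.inner) (c d : QuadExt R α × J) :
    p.2 * H.V c d - H.V c d * p.2 = H.V (p.2 c) d + H.V c (p.1 d) := by
  obtain ⟨h⟩ := H.exists_innerData hp
  exact LinearMap.ext fun e => h.swap.V_comm c d e

theorem comm_mem {p q : Module.End R (QuadExt R α × J) × Module.End R (QuadExt R α × J)}
    (hp : p ∈ H.inner) (hq : q ∈ H.inner) : p * q - q * p ∈ H.inner := by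
  induction hq using Submodule.span_induction with
  | mem x h =>
    obtain ⟨c, d, rfl⟩ := h
    rw [show p * (H.V c d, -H.V d c) - (H.V c d, -H.V d c) * p = (H.V (p.1 c) d, -H.V d (p.1 c))
        + (H.V c (p.2 d), -H.V (p.2 d) c) from
      Prod.ext (H.comm_V hp c d) (by
        have := H.comm_V' hp d c
        refine LinearMap.ext fun e => ?_
        have := LinearMap.congr_fun this e
        simp only [LinearMap.sub_apply, Module.End.mul_apply, LinearMap.add_apply] at this
        simp only [Prod.snd_sub, Prod.snd_mul, Prod.snd_add, LinearMap.sub_apply,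
          Module.End.mul_apply, LinearMap.add_apply, LinearMap.neg_apply, map_neg]
        linear_combination (norm := abel) -this)]
    exact add_mem (H.V_mem _ _) (H.V_mem _ _)
  | zero => simp
  | add x y _ _ hx hy =>
    rw [mul_add, add_mul, add_sub_add_comm]; exact add_mem hx hy
  | smul r x _ hx =>
    rw [mul_smul_comm, smul_mul_assoc, ← smul_sub]; exact Submodule.smul_mem _ _ hx

/-- `x ȳ - y x̄`, which is an element of `R (t - t̄)`. -/
def psi (x y : QuadExt R α × J) : QuadExt.skew R α :=
  ⟨(H.mul x (bar y) - H.mul y (bar x)).1, by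
    have h : (H.mul x (bar y) - H.mul y (bar x)).1
        = (H.mul x (bar y)).1 - star (H.mul x (bar y)).1 := by
      simp [mul_apply, bar_apply, H.star_T, mul_comm]
    rw [h]
    exact QuadExt.sub_star_mem_skew _⟩

theorem mul_bar_sub (x y : QuadExt R α × J) :
    H.mul x (bar y) - H.mul y (bar x) = ((H.psi x y : QuadExt R α), 0) := by
  ext1
  · rfl
  · simp [mul_apply, bar_apply, H.cross_comm]
    abel

theorem psi_coe (x y : QuadExt R α × J) : (H.psi x y : QuadExt R α) =
    x.1 * star y.1 + H.T x.2 y.2 - (y.1 * star x.1 + H.T y.2 x.2) := rfl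

/-- The scalar by which `(f, g) ∈ I` acts on the component `R (t - t̄)` of degree `2`: the trace of
the `K`-component of `f 1`. -/
def chi (f : Module.End R (QuadExt R α × J)) : R := QuadraticAlgebra.trace (f (1, 0)).1

theorem smul_eq (r : R) (k : QuadExt R α) : r • k = algebraMap R _ r * k := Algebra.smul_def _ _

theorem star_skew (s : QuadExt.skew R α) : star (s : QuadExt R α) = -s :=
  QuadExt.star_of_mem_skew s.2

theorem InnerData.chi_eq {H : HermitianCubicNormStructure R α J}
    {f g : Module.End R (QuadExt R α × J)} (h : H.InnerData f g) :
    algebraMap R (QuadExt R α) (chi f) = h.l + star h.l := by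
  rw [chi, QuadraticAlgebra.algebraMap_trace_eq_add_star, h.hf]; simp

theorem chi_V (x y : QuadExt R α × J) : algebraMap R (QuadExt R α) (chi (H.V x y)) =
    -(x.1 * star y.1 + star x.1 * y.1 + H.T x.2 y.2 + H.T y.2 x.2) := by
  rw [(InnerData.ofV H x y).chi_eq]
  simp [InnerData.ofV, H.star_T]; ring

section InnerFacts

variable {p q : Module.End R (QuadExt R α × J) × Module.End R (QuadExt R α × J)}

theorem chi_snd (hp : p ∈ H.inner) : chi p.2 = -chi p.1 := by
  obtain ⟨h⟩ := H.exists_innerData hp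
  apply QuadraticAlgebra.algebraMap_injective (a := -α) (b := 1)
  rw [map_neg, h.swap.chi_eq, h.chi_eq]
  simp [InnerData.swap]

theorem psi_inner (hp : p ∈ H.inner) (x y : QuadExt R α × J) :
    (H.psi (p.1 x) y + H.psi x (p.1 y) : QuadExt R α) =
      algebraMap R _ (chi p.1) * (H.psi x y : QuadExt R α) := by
  obtain ⟨h⟩ := H.exists_innerData hp
  have h1 := H.T_cross_comm h.m x.2 y.2
  have h2 := H.T_cross_left h.m x.2 y.2
  have h3 := H.T_cross_left h.m y.2 x.2
  have h4 := H.T_cross_comm h.m y.2 x.2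
  rw [h.chi_eq]
  simp only [psi_coe, h.hf, map_sub, LinearMap.sub_apply, h.hT, H.T_smul_left, H.T_smul_right,
    star_sub, star_star, star_mul', H.star_T]
  rw [H.cross_comm y.2 x.2] at *
  linear_combination -h2 + h3 - h4 + h1

theorem chi_comm (hp : p ∈ H.inner) (hq : q ∈ H.inner) : chi (p * q - q * p).1 = 0 := by
  obtain ⟨h⟩ := H.exists_innerData hp
  obtain ⟨h'⟩ := H.exists_innerData hq
  apply QuadraticAlgebra.algebraMap_injective (a := -α) (b := 1)
  rw [chi, QuadraticAlgebra.algebraMap_trace_eq_add_star]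
  simp [h.hf, h'.hf, H.star_T]
  ring

theorem inner_smul (hp : p ∈ H.inner) (s : QuadExt.skew R α) (y : QuadExt R α × J) :
    p.1 ((s : QuadExt R α) • y) = (s : QuadExt R α) • p.2 y +
      (algebraMap R (QuadExt R α) (chi p.1) * s) • y := by
  obtain ⟨h⟩ := H.exists_innerData hp
  rw [h.chi_eq, h.hf, h.hg]
  ext1
  · simp only [Prod.fst_add, Prod.smul_fst, Prod.smul_snd, H.T_smul_right, star_skew, smul_eq_mul]
    ring
  · simp only [Prod.snd_add, Prod.smul_fst, Prod.smul_snd, H.cross_smul_right, star_skew,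
      LinearMap.map_smul, smul_eq_mul, star_mul']
    module

theorem psi_smul_right (x y : QuadExt R α × J) (s : QuadExt.skew R α) :
    (H.psi x ((s : QuadExt R α) • y) : QuadExt R α) = algebraMap R _ (chi (H.V x y)) * s := by
  rw [H.chi_V]
  simp only [psi_coe, Prod.smul_fst, Prod.smul_snd, smul_eq_mul, star_mul', H.T_smul_left,
    H.T_smul_right, star_skew]
  ring

theorem psi_smul (x y z : QuadExt R α × J) :
    (H.psi x y : QuadExt R α) • z = H.V y z x - H.V x z y := by
  have h : (H.psi x y : QuadExt R α) • z = H.mul ((H.psi x y : QuadExt R α), 0) z := by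
    ext1 <;> simp [mul_apply]
  rw [h, ← mul_bar_sub]
  simp only [V_apply, map_sub, LinearMap.sub_apply]
  abel

theorem V_smul_left (x y z : QuadExt R α × J) (s : QuadExt.skew R α) :
    H.V ((s : QuadExt R α) • x) y z - H.V ((s : QuadExt R α) • y) x z =
      -((s * H.psi x y : QuadExt R α) • z) := by
  simp only [V_formula, psi_coe, D]
  ext1
  · simp only [Prod.fst_sub, Prod.smul_fst, Prod.smul_snd, smul_eq_mul, star_mul', H.T_smul_left,
      H.T_smul_right, H.cross_smul_left, H.cross_smul_right, star_skew, Prod.fst_neg, map_add,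
      LinearMap.add_apply, star_neg, H.cross_comm y.2 x.2, smul_smul]
    ring
  · simp only [Prod.snd_sub, Prod.smul_fst, Prod.smul_snd, smul_eq_mul, star_mul', H.T_smul_left,
      H.T_smul_right, H.cross_smul_left, H.cross_smul_right, star_skew, Prod.snd_neg, map_add,
      LinearMap.add_apply, star_neg, H.cross_comm y.2 x.2, smul_smul, H.cross_comm z.2,
      star_star, map_sub, LinearMap.sub_apply]
    module

theorem V_smul_right (x y z : QuadExt R α × J) (s : QuadExt.skew R α) :
    H.V x ((s : QuadExt R α) • y) z - H.V y ((s : QuadExt R α) • x) z =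
      (H.psi x y * s : QuadExt R α) • z := by
  simp only [V_formula, psi_coe, D]
  ext1
  · simp only [Prod.fst_sub, Prod.smul_fst, Prod.smul_snd, smul_eq_mul, star_mul', H.T_smul_left,
      H.T_smul_right, H.cross_smul_left, H.cross_smul_right, star_skew, Prod.fst_neg, map_add,
      LinearMap.add_apply, star_neg, H.cross_comm y.2 x.2, smul_smul]
    ring
  · simp only [Prod.snd_sub, Prod.smul_fst, Prod.smul_snd, smul_eq_mul, star_mul', H.T_smul_left,
      H.T_smul_right, H.cross_smul_left, H.cross_smul_right, star_skew, Prod.snd_neg, map_add,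
      LinearMap.add_apply, star_neg, H.cross_comm y.2 x.2, smul_smul, H.cross_comm z.2,
      star_star, map_sub, LinearMap.sub_apply]
    module

end InnerFacts

theorem V_one_one : H.V (1, 0) (1, 0) = -1 := by
  refine LinearMap.ext fun c => ?_
  rw [V_formula]
  ext1
  · simp; ring
  · simp [D]

/-- Multiplication by an element of `K` on `A`. -/
def lsmul (k : QuadExt R α) : Module.End R (QuadExt R α × J) :=
  Algebra.lsmul R R (QuadExt R α × J) k

theorem lsmul_mem (s r : QuadExt.skew R α) :
    (lsmul (J := J) (s * r : QuadExt R α), -lsmul (J := J) (s * r : QuadExt R α)) ∈ H.inner := by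
  obtain ⟨a, ha⟩ := Submodule.mem_span_singleton.1 s.2
  obtain ⟨b, hb⟩ := Submodule.mem_span_singleton.1 r.2
  have h : (s * r : QuadExt R α) = algebraMap R _ (a * b * (1 - 4 * α)) := by
    rw [← ha, ← hb, QuadraticAlgebra.algebraMap_eq]
    ext <;> simp <;> ring
  have h' : lsmul (J := J) (s * r : QuadExt R α) = -((a * b * (1 - 4 * α)) • H.V (1, 0) (1, 0)) := by
    rw [h, H.V_one_one]
    refine LinearMap.ext fun c => ?_
    simp only [lsmul, Algebra.lsmul_coe, algebraMap_smul, LinearMap.neg_apply,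
      LinearMap.smul_apply, Module.End.one_apply, smul_neg, neg_neg]
  have := H.inner.neg_mem (H.inner.smul_mem (a * b * (1 - 4 * α)) (H.V_mem (1, 0) (1, 0)))
  convert this using 1
  rw [h']
  ext1
  · rfl
  · simp

/-- The Lie algebra `R (t - t̄) ⊕ A ⊕ I ⊕ A ⊕ R (t - t̄)`, with the components listed from degree
`2` to degree `-2`. -/
def LieAlg : Type (max u v) := QuadExt.skew R α × (QuadExt R α × J) × H.inner × (QuadExt R α × J) ×
  QuadExt.skew R α

namespace LieAlg

variable {H}

instance : AddCommGroup H.LieAlg :=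
  inferInstanceAs (AddCommGroup (QuadExt.skew R α × (QuadExt R α × J) × H.inner ×
    (QuadExt R α × J) × QuadExt.skew R α))

instance : Module R H.LieAlg :=
  inferInstanceAs (Module R (QuadExt.skew R α × (QuadExt R α × J) × H.inner ×
    (QuadExt R α × J) × QuadExt.skew R α))

/-- The element with the given components. -/
def mk (s : QuadExt.skew R α) (x : QuadExt R α × J) (p : H.inner) (y : QuadExt R α × J)
    (r : QuadExt.skew R α) : H.LieAlg := (s, x, p, y, r)

/-- The component of degree `2`. -/
def s (X : H.LieAlg) : QuadExt.skew R α := X.1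
/-- The component of degree `1`. -/
def x (X : H.LieAlg) : QuadExt R α × J := X.2.1
/-- The component of degree `0`. -/
def p (X : H.LieAlg) : H.inner := X.2.2.1
/-- The component of degree `-1`. -/
def y (X : H.LieAlg) : QuadExt R α × J := X.2.2.2.1
/-- The component of degree `-2`. -/
def r (X : H.LieAlg) : QuadExt.skew R α := X.2.2.2.2

/-- The first entry of the component of degree `0`. -/
def f (X : H.LieAlg) : Module.End R (QuadExt R α × J) := X.p.1.1
/-- The second entry of the component of degree `0`. -/
def g (X : H.LieAlg) : Module.End R (QuadExt R α × J) := X.p.1.2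

@[ext] theorem ext {X Y : H.LieAlg} (hs : (X.s : QuadExt R α) = Y.s) (hx : X.x = Y.x) (hf : X.f = Y.f)
    (hg : X.g = Y.g) (hy : X.y = Y.y) (hr : (X.r : QuadExt R α) = Y.r) : X = Y :=
  Prod.ext (Subtype.ext hs) (Prod.ext hx (Prod.ext (Subtype.ext (Prod.ext hf hg))
    (Prod.ext hy (Subtype.ext hr))))

/-- The bracket: `(f, g) ∈ I` acts on `A₁ × A₋₁` as `(f, g)` and on `I` by the commutator; moreover
`[(x, y), (x', y')] = (x x̄' - x' x̄)₂ + (V_{x,y'} - V_{x',y}, -V_{y',x} + V_{y,x'})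
+ (y ȳ' - y' ȳ)₋₂` for `x, x' ∈ A₁` and `y, y' ∈ A₋₁`. The remaining brackets are forced by these,
by the Jacobi identity: `[y₋₁, s₂] = (s y)₁`, `[x₁, r₋₂] = (r x)₋₁`, `[s₂, r₋₂] = (s r, -s r)`,
and `(f, g)` acts on the components of degrees `2` and `-2` by the scalars `chi f` and `chi g`. -/
instance : Bracket H.LieAlg H.LieAlg where
  bracket X Y := mk
    (H.psi X.x Y.x + chi X.f • Y.s - chi Y.f • X.s)
    (X.f Y.x - Y.f X.x + (Y.s : QuadExt R α) • X.y - (X.s : QuadExt R α) • Y.y)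
    (⟨_, H.V_mem X.x Y.y⟩ - ⟨_, H.V_mem Y.x X.y⟩ + ⟨_, H.lsmul_mem X.s Y.r⟩
      - ⟨_, H.lsmul_mem Y.s X.r⟩ + ⟨_, H.comm_mem X.p.2 Y.p.2⟩)
    (X.g Y.y - Y.g X.y + (Y.r : QuadExt R α) • X.x - (X.r : QuadExt R α) • Y.x)
    (H.psi X.y Y.y + chi X.g • Y.r - chi Y.g • X.r)

variable (X Y : H.LieAlg) (a : R)

theorem add_s : (X + Y).s = X.s + Y.s := rfl
theorem add_x : (X + Y).x = X.x + Y.x := rfl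
theorem add_p : (X + Y).p = X.p + Y.p := rfl
theorem add_f : (X + Y).f = X.f + Y.f := rfl
theorem add_g : (X + Y).g = X.g + Y.g := rfl
theorem add_y : (X + Y).y = X.y + Y.y := rfl
theorem add_r : (X + Y).r = X.r + Y.r := rfl
theorem smul_s : (a • X).s = a • X.s := rfl
theorem smul_x : (a • X).x = a • X.x := rfl
theorem smul_p : (a • X).p = a • X.p := rfl
theorem smul_f : (a • X).f = a • X.f := rfl
theorem smul_g : (a • X).g = a • X.g := rfl
theorem smul_y : (a • X).y = a • X.y := rfl
theorem smul_r : (a • X).r = a • X.r := rfl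
theorem lie_s : (⁅X, Y⁆.s : QuadExt R α) = 
    H.psi X.x Y.x + chi X.f • (Y.s : QuadExt R α) - chi Y.f • (X.s : QuadExt R α) := rfl
theorem lie_x : ⁅X, Y⁆.x =
    X.f Y.x - Y.f X.x + (Y.s : QuadExt R α) • X.y - (X.s : QuadExt R α) • Y.y := rfl
theorem lie_f : ⁅X, Y⁆.f = H.V X.x Y.y - H.V Y.x X.y + lsmul (X.s * Y.r : QuadExt R α)
    - lsmul (Y.s * X.r : QuadExt R α) + (X.f * Y.f - Y.f * X.f) := rfl
theorem lie_g : ⁅X, Y⁆.g = -H.V Y.y X.x - -H.V X.y Y.x + -lsmul (J := J) (X.s * Y.r : QuadExt R α)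
    - -lsmul (J := J) (Y.s * X.r : QuadExt R α) + (X.g * Y.g - Y.g * X.g) := rfl
theorem lie_y : ⁅X, Y⁆.y =
    X.g Y.y - Y.g X.y + (Y.r : QuadExt R α) • X.x - (X.r : QuadExt R α) • Y.x := rfl
theorem lie_r : (⁅X, Y⁆.r : QuadExt R α) = 
    H.psi X.y Y.y + chi X.g • (Y.r : QuadExt R α) - chi Y.g • (X.r : QuadExt R α) := rfl

end LieAlg

end HermitianCubicNormStructure

namespace HermitianCubicNormStructure

variable {R : Type u} [CommRing R] {α : R} {J : Type v} [AddCommGroup J] [Module (QuadExt R α) J]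
  [Module R J] [IsScalarTower R (QuadExt R α) J] {H : HermitianCubicNormStructure R α J}

theorem chi_add (f f' : Module.End R (QuadExt R α × J)) : chi (f + f') = chi f + chi f' := by
  simp [chi]

theorem chi_smul (a : R) (f : Module.End R (QuadExt R α × J)) : chi (a • f) = a * chi f := by
  simp [chi]

theorem chi_sub (f f' : Module.End R (QuadExt R α × J)) : chi (f - f') = chi f - chi f' := by
  simp [chi]

theorem psi_add_left (x x' y : QuadExt R α × J) :
    (H.psi (x + x') y : QuadExt R α) = H.psi x y + H.psi x' y := by
  simp [psi_coe, add_mul, mul_add]; ring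

theorem psi_smul_left (a : R) (x y : QuadExt R α × J) :
    (H.psi (a • x) y : QuadExt R α) = a • (H.psi x y : QuadExt R α) := by
  simp [psi_coe, smul_sub, smul_add, star_smul']

theorem psi_swap (x y : QuadExt R α × J) : (H.psi y x : QuadExt R α) = -H.psi x y := by
  simp [psi_coe]

theorem swap_mem {p : Module.End R (QuadExt R α × J) × Module.End R (QuadExt R α × J)}
    (hp : p ∈ H.inner) : (p.2, p.1) ∈ H.inner := by
  induction hp using Submodule.span_induction with
  | mem x h =>
    obtain ⟨a, b, rfl⟩ := h
    rw [show (((H.V a b, -H.V b a).2, (H.V a b, -H.V b a).1) :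
      Module.End R (QuadExt R α × J) × Module.End R (QuadExt R α × J)) = -(H.V b a, -H.V a b) from
      Prod.ext rfl (neg_neg _).symm]
    exact neg_mem (H.V_mem b a)
  | zero => exact zero_mem _
  | add x y _ _ hx hy => exact add_mem hx hy
  | smul r x _ hx => exact Submodule.smul_mem _ r hx

theorem lsmul_apply (k : QuadExt R α) (z : QuadExt R α × J) : lsmul k z = k • z := rfl

theorem chi_lsmul (s r : QuadExt.skew R α) :
    algebraMap R (QuadExt R α) (chi (lsmul (J := J) (s * r : QuadExt R α))) = 2 * (s * r) := by
  rw [chi, QuadraticAlgebra.algebraMap_trace_eq_add_star, lsmul_apply]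
  simp only [Prod.smul_fst, smul_eq_mul, mul_one, star_mul', star_skew]
  ring

theorem psi_add_right (x y y' : QuadExt R α × J) :
    (H.psi x (y + y') : QuadExt R α) = H.psi x y + H.psi x y' := by
  rw [psi_swap, psi_add_left, psi_swap x, psi_swap x]; ring

theorem psi_neg_left (x y : QuadExt R α × J) :
    (H.psi (-x) y : QuadExt R α) = -H.psi x y := by
  have := psi_smul_left (H := H) (-1) x y
  simpa using this

theorem psi_neg_right (x y : QuadExt R α × J) :
    (H.psi x (-y) : QuadExt R α) = -H.psi x y := by
  rw [psi_swap, psi_neg_left, psi_swap x, neg_neg]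

namespace LieAlg

/-- The bijection reversing the order of the components. -/
def flip : H.LieAlg ≃ₗ[R] H.LieAlg :=
  LinearEquiv.ofInvolutive
    { toFun := fun X => mk X.r X.y ⟨(X.g, X.f), by
        exact swap_mem X.p.2⟩ X.x X.s
      map_add' := fun X Y => rfl
      map_smul' := fun a X => rfl } (fun X => rfl)

variable (X Y Z : H.LieAlg)

theorem flip_s : (flip X).s = X.r := rfl
theorem flip_x : (flip X).x = X.y := rfl
theorem flip_f : (flip X).f = X.g := rfl
theorem flip_g : (flip X).g = X.f := rfl
theorem flip_y : (flip X).y = X.x := rfl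
theorem flip_r : (flip X).r = X.s := rfl

theorem flip_lie : flip ⁅X, Y⁆ = ⁅flip X, flip Y⁆ := by
  apply LieAlg.ext
  · rw [flip_s, lie_r, lie_s, flip_x, flip_x, flip_f, flip_f, flip_s, flip_s]
  · rw [flip_x, lie_x, lie_y, flip_x, flip_x, flip_f, flip_f, flip_s, flip_s, flip_y, flip_y]
  · rw [flip_f, lie_f, lie_g, flip_x, flip_x, flip_y, flip_y, flip_f, flip_f, flip_s, flip_s,
      flip_r, flip_r, mul_comm (X.r : QuadExt R α), mul_comm (Y.r : QuadExt R α)]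
    abel
  · rw [flip_g, lie_f, lie_g, flip_x, flip_x, flip_y, flip_y, flip_g, flip_g, flip_s, flip_s,
      flip_r, flip_r, mul_comm (X.r : QuadExt R α), mul_comm (Y.r : QuadExt R α)]
    abel
  · rw [flip_y, lie_x, lie_y, flip_x, flip_x, flip_g, flip_g, flip_r, flip_r, flip_y, flip_y]
  · rw [flip_r, lie_r, lie_s, flip_y, flip_y, flip_g, flip_g, flip_r, flip_r]

theorem lie_add_left : ⁅X + Y, Z⁆ = ⁅X, Z⁆ + ⁅Y, Z⁆ := by
  apply LieAlg.ext
  · simp only [lie_s, add_s, add_x, add_f, Submodule.coe_add, psi_add_left, chi_add]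
    module
  · simp only [lie_x, add_s, add_x, add_f, add_y, Submodule.coe_add, map_add, LinearMap.add_apply]
    module
  · simp only [lie_f, add_s, add_x, add_f, add_y, add_r, Submodule.coe_add, map_add,
      LinearMap.add_apply, add_mul, mul_add, lsmul]
    abel
  · simp only [lie_g, add_s, add_x, add_g, add_y, add_r, Submodule.coe_add, map_add,
      LinearMap.add_apply, add_mul, mul_add, lsmul]
    abel
  · simp only [lie_y, add_s, add_x, add_g, add_y, add_r, Submodule.coe_add, map_add,
      LinearMap.add_apply]
    module
  · simp only [lie_r, add_s, add_y, add_g, add_r, Submodule.coe_add, psi_add_left, chi_add]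
    module

theorem smul_lie' (a : R) : ⁅a • X, Y⁆ = a • ⁅X, Y⁆ := by
  apply LieAlg.ext
  · simp only [lie_s, smul_s, smul_x, smul_f, Submodule.coe_smul, psi_smul_left, chi_smul, smul_sub,
      smul_add, mul_smul, smul_comm a]
  · simp only [lie_x, smul_s, smul_x, smul_f, smul_y, Submodule.coe_smul, map_smul,
      LinearMap.smul_apply, smul_sub, smul_add, smul_assoc, smul_comm a]
  · simp only [lie_f, smul_s, smul_x, smul_f, smul_y, smul_r, Submodule.coe_smul, map_smul,
      LinearMap.smul_apply, smul_mul_assoc, mul_smul_comm, lsmul, smul_sub, smul_add]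
  · simp only [lie_g, smul_s, smul_x, smul_g, smul_y, smul_r, Submodule.coe_smul, map_smul,
      LinearMap.smul_apply, smul_mul_assoc, mul_smul_comm, lsmul, smul_sub, smul_add, smul_neg]
  · simp only [lie_y, smul_r, smul_x, smul_g, smul_y, Submodule.coe_smul, map_smul,
      LinearMap.smul_apply, smul_sub, smul_add, smul_assoc, smul_comm a]
  · simp only [lie_r, smul_r, smul_y, smul_g, Submodule.coe_smul, psi_smul_left, chi_smul, smul_sub,
      smul_add, mul_smul, smul_comm a]

theorem lie_self' : ⁅X, X⁆ = 0 := by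
  apply LieAlg.ext
  · simp only [lie_s, psi_coe, sub_self, add_sub_cancel_right]; rfl
  · simp only [lie_x]; abel_nf; rfl
  · simp only [lie_f]; abel_nf; rfl
  · simp only [lie_g, mul_comm (X.r : QuadExt R α)]; abel_nf; rfl
  · simp only [lie_y]; abel_nf; rfl
  · simp only [lie_r, psi_coe, sub_self, add_sub_cancel_right]; rfl


theorem psi_f (a b : QuadExt R α × J) : (H.psi (X.f a) b + H.psi a (X.f b) : QuadExt R α) =
    algebraMap R _ (chi X.f) * (H.psi a b : QuadExt R α) := psi_inner H X.p.2 a b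

theorem chi_f_comm : chi (X.f * Y.f) = chi (Y.f * X.f) :=
  sub_eq_zero.1 ((chi_sub _ _).symm.trans (chi_comm H X.p.2 Y.p.2))

theorem jacobi_s : (⁅X, ⁅Y, Z⁆⁆.s : QuadExt R α) = ⁅⁅X, Y⁆, Z⁆.s + ⁅Y, ⁅X, Z⁆⁆.s := by
  have a1 := psi_f X Z.x Y.x
  have a2 := psi_f Y X.x Z.x
  have a3 := psi_f Z Y.x X.x
  have b1 := psi_smul_right H X.x Y.y Z.s
  have b2 := psi_smul_right H Y.x Z.y X.s
  have b3 := psi_smul_right H Z.x X.y Y.s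
  have c1 := psi_smul_right H X.x Z.y Y.s
  have c2 := psi_smul_right H Y.x X.y Z.s
  have c3 := psi_smul_right H Z.x Y.y X.s
  simp only [lie_s, lie_x, lie_f, smul_eq, sub_eq_add_neg (_ : QuadExt R α × J), psi_add_left,
    psi_neg_left, psi_add_right, psi_neg_right, chi_add, chi_sub, chi_f_comm X, chi_f_comm Y Z, map_add, map_sub,
    chi_lsmul, map_zero, psi_swap X.x Z.x, psi_swap X.x Y.x, psi_swap Y.x Z.x,
    psi_swap (X.f _), psi_swap (Y.f _), psi_swap (Z.f _),
    psi_swap X.x ((_ : QuadExt R α) • _), psi_swap Y.x ((_ : QuadExt R α) • _),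
    psi_swap Z.x ((_ : QuadExt R α) • _)] at a1 a2 a3 ⊢
  linear_combination a1 + a2 + a3 + b1 + b2 + b3 - c1 - c2 - c3

theorem f_smul (s : QuadExt.skew R α) (y : QuadExt R α × J) : X.f ((s : QuadExt R α) • y) =
    (s : QuadExt R α) • X.g y + (algebraMap R (QuadExt R α) (chi X.f) * s) • y :=
  inner_smul H X.p.2 s y

theorem jacobi_x : ⁅X, ⁅Y, Z⁆⁆.x = ⁅⁅X, Y⁆, Z⁆.x + ⁅Y, ⁅X, Z⁆⁆.x := by
  have a1 := H.psi_smul Y.x Z.x X.y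
  have a2 := H.psi_smul Z.x X.x Y.y
  have a3 := H.psi_smul X.x Y.x Z.y
  rw [psi_swap X.x Z.x] at a2
  simp only [lie_s, lie_x, lie_f, lie_y, smul_eq, map_add, map_sub, f_smul, LinearMap.add_apply,
    LinearMap.sub_apply, Module.End.mul_apply, lsmul_apply]
  linear_combination (norm := module) a1 + a2 + a3

theorem V_f (a b c : QuadExt R α × J) :
    X.f (H.V a b c) - H.V a b (X.f c) = H.V (X.f a) b c + H.V a (X.g b) c :=
  LinearMap.congr_fun (H.comm_V X.p.2 a b) c

theorem chi_g : chi X.g = -chi X.f := chi_snd H X.p.2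

theorem f_smul_mul (s r : QuadExt.skew R α) (a : QuadExt R α × J) :
    X.f ((s * r : QuadExt R α) • a) = (s * r : QuadExt R α) • X.f a := by
  have hg : X.g ((r : QuadExt R α) • a) = (r : QuadExt R α) • X.f a +
    (algebraMap R (QuadExt R α) (chi X.g) * r) • a := inner_smul H (swap_mem X.p.2) r a
  rw [mul_smul, f_smul, hg, chi_g, map_neg]
  module

theorem jacobi_f : ⁅X, ⁅Y, Z⁆⁆.f = ⁅⁅X, Y⁆, Z⁆.f + ⁅Y, ⁅X, Z⁆⁆.f := by
  refine LinearMap.ext fun e => ?_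
  have a1 := V_f X Y.x Z.y e
  have a2 := V_f Y Z.x X.y e
  have a3 := V_f Z X.x Y.y e
  have b1 := V_f X Z.x Y.y e
  have b2 := V_f Y X.x Z.y e
  have b3 := V_f Z Y.x X.y e
  have c1 := V_smul_left H Y.y Z.y e X.s
  have c2 := V_smul_left H Z.y X.y e Y.s
  have c3 := V_smul_left H X.y Y.y e Z.s
  have d1 := V_smul_right H Y.x Z.x e X.r
  have d2 := V_smul_right H Z.x X.x e Y.r
  have d3 := V_smul_right H X.x Y.x e Z.r
  rw [psi_swap X.y Z.y] at c2
  rw [psi_swap X.x Z.x] at d2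
  simp only [lie_s, lie_x, lie_f, lie_y, lie_r, smul_eq, map_add, map_sub, f_smul_mul,
    LinearMap.add_apply, LinearMap.sub_apply, Module.End.mul_apply, lsmul_apply, chi_g, map_neg]
  linear_combination (norm := module) a1 + a2 + a3 - b1 - b2 - b3 + c1 + c2 + c3 + d1 + d2 + d3

theorem jacobi : ⁅X, ⁅Y, Z⁆⁆ = ⁅⁅X, Y⁆, Z⁆ + ⁅Y, ⁅X, Z⁆⁆ := by
  apply LieAlg.ext
  · rw [add_s, Submodule.coe_add, jacobi_s]
  · rw [add_x, jacobi_x]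
  · rw [add_f, jacobi_f]
  · have := jacobi_f (flip X) (flip Y) (flip Z)
    rwa [← flip_lie, ← flip_lie, ← flip_lie, ← flip_lie, ← flip_lie, ← flip_lie] at this
  · have := jacobi_x (flip X) (flip Y) (flip Z)
    rwa [← flip_lie, ← flip_lie, ← flip_lie, ← flip_lie, ← flip_lie, ← flip_lie] at this
  · have := jacobi_s (flip X) (flip Y) (flip Z)
    rwa [← flip_lie, ← flip_lie, ← flip_lie, ← flip_lie, ← flip_lie, ← flip_lie] at this

theorem lie_swap' : ⁅X, Y⁆ = -⁅Y, X⁆ := by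
  have h : ∀ X Y : H.LieAlg, (X = -Y) = (X = (-1 : R) • Y) := fun X Y => by rw [neg_one_smul]
  rw [h]
  apply LieAlg.ext
  · rw [smul_s, Submodule.coe_smul, lie_s, lie_s, psi_swap Y.x]
    module
  · rw [smul_x, lie_x, lie_x]
    module
  · rw [smul_f, lie_f, lie_f]
    module
  · rw [smul_g, lie_g, lie_g]
    module
  · rw [smul_y, lie_y, lie_y]
    module
  · rw [smul_r, Submodule.coe_smul, lie_r, lie_r, psi_swap Y.y]
    module

instance : LieRing H.LieAlg where
  add_lie := lie_add_left
  lie_add X Y Z := by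
    rw [lie_swap' X, lie_add_left, neg_add, ← lie_swap', ← lie_swap']
  lie_self := lie_self'
  leibniz_lie := jacobi

instance : LieAlgebra R H.LieAlg where
  lie_smul a X Y := by
    rw [lie_swap' X, smul_lie', lie_swap' X, smul_neg]

/-- The automorphism of the Lie algebra that reverses the order of the components. -/
def flipEquiv : H.LieAlg ≃ₗ⁅R⁆ H.LieAlg :=
  { flip with map_lie' := fun {X Y} => flip_lie X Y }

/-- The homogeneous component of degree `i`. -/
def grade (i : ℤ) : Submodule R H.LieAlg where
  carrier := {X | (i ≠ 2 → X.s = 0) ∧ (i ≠ 1 → X.x = 0) ∧ (i ≠ 0 → X.p = 0) ∧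
    (i ≠ -1 → X.y = 0) ∧ (i ≠ -2 → X.r = 0)}
  zero_mem' := ⟨fun _ => rfl, fun _ => rfl, fun _ => rfl, fun _ => rfl, fun _ => rfl⟩
  add_mem' := by
    rintro X Y ⟨h1, h2, h3, h4, h5⟩ ⟨k1, k2, k3, k4, k5⟩
    exact ⟨fun h => by rw [add_s, h1 h, k1 h, add_zero],
      fun h => by rw [add_x, h2 h, k2 h, add_zero],
      fun h => by rw [add_p, h3 h, k3 h, add_zero],
      fun h => by rw [add_y, h4 h, k4 h, add_zero],
      fun h => by rw [add_r, h5 h, k5 h, add_zero]⟩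
  smul_mem' := by
    rintro a X ⟨h1, h2, h3, h4, h5⟩
    exact ⟨fun h => by rw [smul_s, h1 h, smul_zero],
      fun h => by rw [smul_x, h2 h, smul_zero],
      fun h => by rw [smul_p, h3 h, smul_zero],
      fun h => by rw [smul_y, h4 h, smul_zero],
      fun h => by rw [smul_r, h5 h, smul_zero]⟩

variable (H)

/-- The embedding of `R (t - t̄)` as the component of degree `2`. -/
def two (s : QuadExt.skew R α) : H.LieAlg := mk s 0 0 0 0

/-- The embedding of `A` as the component of degree `1`. -/
def one (x : QuadExt R α × J) : H.LieAlg := mk 0 x 0 0 0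

/-- The embedding of `A` as the component of degree `-1`. -/
def negOne (y : QuadExt R α × J) : H.LieAlg := mk 0 0 0 y 0

end LieAlg

variable (H)

/-- The group `G` of pairs `(x, y) = ((a, v), (u, a v + v♯))` such that `u + ū = a ā + T(v, v)`;
such a pair is determined by `a`, `v` and `u`. -/
structure G where
  a : QuadExt R α
  v : J
  u : QuadExt R α
  add_star_u : u + star u = a * star a + H.T v v

namespace G

variable {H} (g : H.G)

/-- The first entry `(a, v)` of an element of `G`. -/
def x : QuadExt R α × J := (g.a, g.v)

/-- The second entry `(u, a v + v♯)` of an element of `G`. -/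
def y : QuadExt R α × J := (g.u, g.a • g.v + H.sharp g.v)

/-- `Q_{(x, y)} c = (x c̄) x - y c`. -/
def Q (c : QuadExt R α × J) : QuadExt R α × J :=
  H.mul (H.mul g.x (bar c)) g.x - H.mul g.y c

/-- `T_{(x, y)} c = F - F̄`, where, for `c = (b, w)`,
`F = (T(v, v) - ū) a b̄ + (a ā - ū) T(v, w) + a T(w, v♯) + b N(v) - T(w, v × v♯)`. -/
def cubic (c : QuadExt R α × J) : QuadExt.skew R α :=
  let F : QuadExt R α := (H.T g.v g.v - star g.u) * g.a * star c.1
    + (g.a * star g.a - star g.u) * H.T g.v c.2 + g.a * H.T c.2 (H.sharp g.v)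
    + c.1 * H.N g.v - H.T c.2 (H.cross g.v (H.sharp g.v))
  ⟨F - star F, QuadExt.sub_star_mem_skew F⟩

/-- `φ` is the automorphism `exp_+(x, y) = 1 + φ₁ + φ₂ + φ₃ + φ₄`: the map `φᵢ` raises the degree
by `i`, `φ₁ = ad x₁`, `φ₂ c₋₁ = (Q_{(x, y)} c)₁` and `φ₃ c₋₁ = (T_{(x, y)} c)₂`. -/
def IsExpPlus (φ : H.LieAlg ≃ₗ⁅R⁆ H.LieAlg) : Prop :=
  ∃ φ₁ φ₂ φ₃ φ₄ : Module.End R H.LieAlg,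
    (∀ X, φ X = X + φ₁ X + φ₂ X + φ₃ X + φ₄ X) ∧
    (∀ i, ∀ X ∈ LieAlg.grade i, φ₁ X ∈ LieAlg.grade (i + 1) ∧ φ₂ X ∈ LieAlg.grade (i + 2) ∧
      φ₃ X ∈ LieAlg.grade (i + 3) ∧ φ₄ X ∈ LieAlg.grade (i + 4)) ∧
    (∀ X, φ₁ X = ⁅LieAlg.one H g.x, X⁆) ∧
    (∀ c, φ₂ (LieAlg.negOne H c) = LieAlg.one H (g.Q c)) ∧
    ∀ c, φ₃ (LieAlg.negOne H c) = LieAlg.two H (g.cubic c)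

/-- `φ` is the automorphism `exp_-(x, y)`, which is `exp_+(x, y)` with the grading reversed. -/
def IsExpMinus (φ : H.LieAlg ≃ₗ⁅R⁆ H.LieAlg) : Prop :=
  g.IsExpPlus ((LieAlg.flipEquiv.trans φ).trans LieAlg.flipEquiv)

/-- Some `exp_-(g_l) exp_+(g) exp_-(g_r)` reverses the grading. -/
def OneInvertible : Prop :=
  ∃ (gl gr : H.G) (φl φ φr : H.LieAlg ≃ₗ⁅R⁆ H.LieAlg),
    gl.IsExpMinus φl ∧ g.IsExpPlus φ ∧ gr.IsExpMinus φr ∧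
      ∀ i : ℤ, (LieAlg.grade i).map ((φr.trans φ).trans φl : H.LieAlg →ₗ[R] H.LieAlg) =
        LieAlg.grade (-i)

/-- The quartic norm `ν = u ū - a ā T(v, v) + a N(v) + ā N(v)̄ - T(v♯, v♯)`. This element of `K` lies
in `R`, see `algebraMap_quarticNorm`. -/
def quarticNorm : R :=
  (g.u * star g.u - g.a * star g.a * H.T g.v g.v + g.a * H.N g.v + star g.a * star (H.N g.v)
    - H.T (H.sharp g.v) (H.sharp g.v)).re

theorem algebraMap_quarticNorm : algebraMap R (QuadExt R α) g.quarticNorm =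
    g.u * star g.u - g.a * star g.a * H.T g.v g.v + g.a * H.N g.v + star g.a * star (H.N g.v)
      - H.T (H.sharp g.v) (H.sharp g.v) := by
  refine QuadraticAlgebra.ext rfl (Eq.symm ?_)
  have h : ∀ z : QuadExt R α, star z = z → z.im = 0 := fun z hz => by
    simpa using congrArg QuadraticAlgebra.re hz
  apply h
  simp only [star_sub, star_add, star_mul', star_star, H.star_T]
  ring

end G

end HermitianCubicNormStructure

/-! Write ν = ν(g) and z = t - t̄, so that z² = 1 - 4α is invertible. The image `lowest` of z₋₂
under exp_+(g) has degree-2 component νz. An automorphism exp_- fixes L₋₂ pointwise and does not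
change the degree-2 component of any element. So if exp_-(g_l) exp_+(g) exp_-(g_r) maps L₋₂ onto L₂,
then some multiple of ν is 1 (`OneInvertible.isUnit_quarticNorm`).

Conversely, let ν be invertible. An explicit h in G, the `partner` of g, satisfies exp_-(h) z₂ = ν⁻¹
exp_+(g) z₋₂ (`flip_lowest_partner`). Degree 1 forces its first entry to be ν⁻¹ times `adj`, and
degree 0 forces its u. Degrees -1 and -2 then express that taking `adj` twice gives back the first
entry of g up to ν², and that the quartic norm of the unscaled partner is ν³. Both need the value of
N on the J-component of `adj`, which involves N(v♯). There the hypothesis on N(v♯) enters: the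
identity T(a, a♯) = 3 N(a) alone yields only three times it. If h' is the partner of g⁻¹, then
exp_-(h⁻¹) exp_+(g) exp_-(h') interchanges Rz₂ and Rz₋₂ with mutually inverse scalars. It therefore
reverses the grading, because z₂ and z₋₂ characterise L₁ and L₋₁ through their adjoint actions,
while L₀ is spanned by [L₁, L₋₁] (`map_grade_eq`).

Most of the work is the existence of exp_+(g) over an arbitrary R, without dividing by 2 or 3. Since
L is generated by L₁ and L₋₁, a linear map that respects brackets with these two components is a
homomorphism. The brackets of L₀ with L₋₁ amount to the equivariance of Q and T_{(x,y)} under I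
(`Q_inner`, `cubic_inner`). The brackets of L₋₁ with itself are computed on K, and then carried over
to J by an inner transformation that moves 1 to w (`lie_expNeg_J_J`). Generation by L₁ and L₋₁ also
gives the uniqueness of exp_+(g). -/

/-! ### Partial linearisations, read off as coefficients over R[X]. -/

section Coefficients

open Polynomial

variable {R : Type u} [CommRing R] {M : Type*} [AddCommGroup M] [Module R M]

/-- The coefficient of `X ^ n` of an element of `R[X] ⊗ M`. -/
noncomputable def tensorCoeff (n : ℕ) : R[X] ⊗[R] M →ₗ[R] M :=
  (TensorProduct.lid R M).toLinearMap ∘ₗ (Polynomial.lcoeff R n).rTensor M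

theorem tensorCoeff_tmul (n : ℕ) (p : R[X]) (m : M) :
    tensorCoeff n (p ⊗ₜ[R] m) = p.coeff n • m := by
  simp [tensorCoeff]

end Coefficients

namespace HermitianCubicNormStructure

section PolynomialLaws

open Polynomial

variable {R : Type u} [CommRing R] {α : R} {J : Type v} [AddCommGroup J] [Module (QuadExt R α) J]
  [Module R J] [IsScalarTower R (QuadExt R α) J] (H : HermitianCubicNormStructure R α J)
  (S : Type u) [CommRing S] [Algebra R S]

theorem smulExt_tmul (p q : S) (k : QuadExt R α) (m : J) :
    smulExt S (p ⊗ₜ[R] k) (q ⊗ₜ[R] m) = (p * q) ⊗ₜ[R] (k • m) := by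
  simp [smulExt, bilinExt, TensorProduct.map₂_apply_tmul]

theorem bilinExt_tmul {M N P : Type*} [AddCommGroup M] [Module R M] [AddCommGroup N]
    [Module R N] [AddCommGroup P] [Module R P] (f : M →ₗ[R] N →ₗ[R] P) (p q : S) (m : M) (n : N) :
    bilinExt S f (p ⊗ₜ[R] m) (q ⊗ₜ[R] n) = (p * q) ⊗ₜ[R] f m n := by
  simp [bilinExt, TensorProduct.map₂_apply_tmul]

theorem conjExt_tmul (p : S) (k : QuadExt R α) :
    conjExt S (p ⊗ₜ[R] k) = p ⊗ₜ[R] star k := by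
  simp [conjExt, QuadExt.conj]

theorem N_tmul (p : S) (a : J) : H.N.toFun' S (p ⊗ₜ[R] a) = (p ^ 3) ⊗ₜ[R] H.N a := by
  have h := H.N_smul S (p ⊗ₜ[R] 1) (1 ⊗ₜ[R] a)
  rw [smulExt_tmul, mul_one, one_smul, ← PolynomialLaw.one_tmul_ground_apply'] at h
  rw [h, Algebra.TensorProduct.tmul_pow, Algebra.TensorProduct.tmul_mul_tmul]
  simp

theorem sharp_tmul (p : S) (a : J) : H.sharp.toFun' S (p ⊗ₜ[R] a) = (p ^ 2) ⊗ₜ[R] H.sharp a := by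
  have h := H.sharp_smul S (p ⊗ₜ[R] 1) (1 ⊗ₜ[R] a)
  rw [smulExt_tmul, mul_one, one_smul, ← PolynomialLaw.one_tmul_ground_apply', conjExt_tmul,
    Algebra.TensorProduct.tmul_pow, smulExt_tmul] at h
  simpa using h

theorem N_add_tmul (p q : S) (a b : J) : H.N.toFun' S (p ⊗ₜ[R] a + q ⊗ₜ[R] b) =
    (p ^ 3) ⊗ₜ[R] H.N a + (p ^ 2 * q) ⊗ₜ[R] H.T b (H.sharp a) +
      (p * q ^ 2) ⊗ₜ[R] H.T a (H.sharp b) + (q ^ 3) ⊗ₜ[R] H.N b := by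
  have h := H.N_linearisation S p q (1 ⊗ₜ[R] a) (1 ⊗ₜ[R] b)
  simpa only [TensorProduct.smul_tmul', smul_eq_mul, mul_one, N_tmul, sharp_tmul, bilinExt_tmul,
    one_pow] using h

/-- Compare the coefficients of X in N((1 + X)a) = (1 + X)³ N(a). Specialising the linearisation
over R would not separate the degrees. -/
theorem N_self_coeff (a : J) : H.T a (H.sharp a) = 3 * H.N a := by
  have h := N_add_tmul H R[X] 1 X a a
  rw [← TensorProduct.add_tmul, N_tmul] at h
  have h1 := congrArg (tensorCoeff 1) h
  simp only [map_add, tensorCoeff_tmul] at h1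
  have e : ((1 + X : R[X]) ^ 3).coeff 1 = 3 := by
    rw [add_comm, coeff_X_add_one_pow]; simp
  rw [e] at h1
  simp [coeff_X_pow, coeff_one] at h1
  rw [← h1, ofNat_smul_eq_nsmul R 3, nsmul_eq_mul]; simp

theorem sharp_smul' (k : QuadExt R α) (a : J) : H.sharp (k • a) = star k ^ 2 • H.sharp a := by
  have h := H.sharp_smul R (1 ⊗ₜ[R] k) (1 ⊗ₜ[R] a)
  simp only [smulExt_tmul, conjExt_tmul, Algebra.TensorProduct.tmul_pow, sharp_tmul, mul_one,
    one_pow] at h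
  exact one_tmul_inj h

theorem N_smul' (k : QuadExt R α) (a : J) : H.N (k • a) = k ^ 3 * H.N a := by
  have h := H.N_smul R (1 ⊗ₜ[R] k) (1 ⊗ₜ[R] a)
  simp only [smulExt_tmul, Algebra.TensorProduct.tmul_pow, N_tmul, mul_one,
    one_pow, Algebra.TensorProduct.tmul_mul_tmul] at h
  exact one_tmul_inj h

theorem cross_self (a : J) : H.cross a a = (2 : QuadExt R α) • H.sharp a := by
  have h := H.sharp_add' a a
  rw [← two_smul (QuadExt R α) a, sharp_smul', star_ofNat] at h
  linear_combination (norm := module) -h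

theorem sharp_poly (a b : J) : H.sharp.toFun' R[X] (1 ⊗ₜ[R] a + X ⊗ₜ[R] b) =
    1 ⊗ₜ[R] H.sharp a + X ⊗ₜ[R] H.cross a b + (X ^ 2) ⊗ₜ[R] H.sharp b := by
  rw [H.sharp_add, sharp_tmul, sharp_tmul, bilinExt_tmul]
  simp only [one_pow, one_mul]; abel

theorem sharp_sharp_poly (a b : J) :
    H.sharp.toFun' R[X] (H.sharp.toFun' R[X] (1 ⊗ₜ[R] a + X ⊗ₜ[R] b)) =
    smulExt R[X] (H.N.toFun' R[X] (1 ⊗ₜ[R] a + X ⊗ₜ[R] b)) (1 ⊗ₜ[R] a + X ⊗ₜ[R] b) :=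
  H.sharp_sharp _ _

/-- This is the coefficient of X in (c♯)♯ = N(c) c at c = a + Xb; the next lemma is the coefficient
of X². Repeated arguments stay undoubled, so these are stronger than the multilinear identities when
2 is not invertible. -/
theorem sharp_cross_cross (a b : J) : H.cross (H.sharp a) (H.cross a b) =
    H.N a • b + H.T b (H.sharp a) • a := by
  have h := congrArg (tensorCoeff 1) (H.sharp_sharp_poly a b)
  rw [sharp_poly, H.sharp_add, H.sharp_add, N_add_tmul] at h
  simp only [sharp_tmul, map_add, LinearMap.add_apply, bilinExt_tmul, smulExt_tmul,
    tensorCoeff_tmul, one_pow, one_mul, mul_one, ← pow_mul, ← pow_succ', ← pow_succ] at h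
  simp [coeff_X_pow, coeff_one] at h
  rw [h, add_comm]

theorem sharp_cross (a b : J) : H.cross (H.sharp a) (H.sharp b) + H.sharp (H.cross a b) =
    H.T b (H.sharp a) • b + H.T a (H.sharp b) • a := by
  have h := congrArg (tensorCoeff 2) (H.sharp_sharp_poly a b)
  rw [sharp_poly, H.sharp_add, H.sharp_add, N_add_tmul] at h
  simp only [sharp_tmul, map_add, LinearMap.add_apply, bilinExt_tmul, smulExt_tmul,
    tensorCoeff_tmul, one_pow, one_mul, mul_one, ← pow_mul, ← pow_succ', ← pow_succ] at h
  simp [coeff_X_pow, coeff_one, coeff_X] at h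
  rw [add_comm, h, add_comm]

/-- The coefficient of X in the axiom `cross_cross` at a + Xc. -/
theorem cross_cross_left (a b c : J) :
    H.cross (H.cross (H.cross a c) b) a + H.cross (H.cross (H.sharp a) b) c =
      H.T (H.sharp a) c • b + H.T b c • H.sharp a + H.T b a • H.cross a c := by
  have h := congrArg (tensorCoeff 1)
    (H.cross_cross R[X] (1 ⊗ₜ[R] a + X ⊗ₜ[R] c) (1 ⊗ₜ[R] b))
  rw [sharp_poly, N_add_tmul] at h
  simp only [map_add, LinearMap.add_apply, bilinExt_tmul, smulExt_tmul, conjExt_tmul,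
    tensorCoeff_tmul, one_pow, one_mul, mul_one, ← pow_mul, ← pow_succ', ← pow_succ] at h
  simp [coeff_X_pow, coeff_one, coeff_X, H.star_T] at h
  linear_combination (norm := module) h

theorem N_adjoint' (a b : J) : H.N (H.T a b • a - H.cross (H.sharp a) b) =
    H.N a ^ 2 * star (H.N b) := by
  have h := H.N_adjoint R (1 ⊗ₜ[R] a) (1 ⊗ₜ[R] b)
  simp only [sharp_tmul, bilinExt_tmul, smulExt_tmul, conjExt_tmul, N_tmul, one_pow, mul_one,
    ← TensorProduct.tmul_sub, Algebra.TensorProduct.tmul_pow,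
    Algebra.TensorProduct.tmul_mul_tmul] at h
  exact one_tmul_inj h

end PolynomialLaws

end HermitianCubicNormStructure

/-! ### Identities for the elements v, v♯ and v × v♯. -/

namespace HermitianCubicNormStructure

section Generic

variable {R : Type u} [CommRing R] {α : R} {J : Type v} [AddCommGroup J] [Module (QuadExt R α) J]
  [Module R J] [IsScalarTower R (QuadExt R α) J] (H : HermitianCubicNormStructure R α J)

theorem T_sharp_self (v : J) : H.T (H.sharp v) v = 3 * star (H.N v) := by
  rw [← H.star_T, N_self_coeff, star_mul', star_ofNat]

theorem sharp_neg (v : J) : H.sharp (-v) = H.sharp v := by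
  have := H.sharp_smul' (-1) v
  simpa using this

theorem N_neg (v : J) : H.N (-v) = -H.N v := by
  have := H.N_smul' (-1) v
  simpa [show (-1 : QuadExt R α) ^ 3 = -1 by ring] using this

theorem cross_cross_sharp (v b : J) : H.cross (H.cross v b) (H.sharp v) =
    H.N v • b + H.T b (H.sharp v) • v := by
  rw [H.cross_comm, sharp_cross_cross]

theorem cross_sharp_cross (v b : J) : H.cross v (H.cross (H.sharp v) b) =
    star (H.N v) • b + H.T b v • H.sharp v := by
  rw [H.cross_comm, H.cross_cross']

theorem cross_cross_mid (a b c : J) :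
    H.cross (H.sharp a) (H.cross b c) + H.cross (H.cross a b) (H.cross a c) =
      H.T b (H.sharp a) • c + H.T c (H.sharp a) • b + H.T a (H.cross b c) • a := by
  have h := H.sharp_cross a (b + c)
  simp only [H.sharp_add', map_add, LinearMap.add_apply] at h
  linear_combination (norm := module) h - H.sharp_cross a b - H.sharp_cross a c

/-- The undoubled form of `D_cross_left` with two equal arguments; it is `cross_cross_left`
rewritten in terms of `D`. -/
theorem D_sharp_left (a c b : J) : H.D (H.sharp a) c b + H.D (H.cross a c) a b =
    (2 * H.T (H.sharp a) c) • b := by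
  have h := H.cross_cross_left a b c
  have h1 : H.T (H.cross a c) a = 2 * H.T (H.sharp a) c := by
    rw [H.cross_comm, H.T_cross_left, cross_self, H.T_smul_left]
  simp only [D, h1]
  linear_combination (norm := module) -h

theorem D_sharp_mid (a c b : J) : H.D c (H.sharp a) b + H.D a (H.cross a c) b =
    (2 * H.T c (H.sharp a)) • b := by
  have h := H.cross_cross_mid a b c
  have h1 : H.T a (H.cross a c) = 2 * H.T c (H.sharp a) := by
    rw [H.cross_comm, H.T_cross_comm, cross_self, H.T_smul_right, star_ofNat]
  have h2 : H.T b (H.cross a c) = H.T a (H.cross b c) := H.T_cross_comm _ _ _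
  simp only [D, h1, h2]
  rw [H.cross_comm (H.cross c b), H.cross_comm c b]
  linear_combination (norm := module) -h

/-- This lemma and its companions below reduce every `D` with both arguments among v, v♯, v × v♯ to
scalars, D_{v,v} and D_{v♯,v♯}. This is what makes `D_adj_adj` computable. -/
theorem D_sharp_self (v b : J) : H.D (H.sharp v) v b = (2 * star (H.N v)) • b := by
  rw [D, T_sharp_self, H.cross_cross']
  module

theorem D_self_sharp (v b : J) : H.D v (H.sharp v) b = (2 * H.N v) • b := by
  rw [D, N_self_coeff, cross_cross_sharp]
  module

/-- The element `v × v♯`. -/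
def crossSharp (v : J) : J := H.cross v (H.sharp v)

theorem cross_self_sharp (v : J) : H.cross v (H.sharp v) = H.crossSharp v := rfl

theorem cross_sharp_self (v : J) : H.cross (H.sharp v) v = H.crossSharp v := H.cross_comm _ _

theorem crossSharp_neg (v : J) : H.crossSharp (-v) = -H.crossSharp v := by
  simp [crossSharp, sharp_neg]

/-- Together with `sharp_crossSharp` and `sharp_crossSharp_self` this shows that the K-span of v, v♯
and v × v♯ is closed under ♯ and ×, with coefficients polynomial in N(v), its conjugate, T(v,v) and
T(v♯,v♯). The element `adj` lies in this span. -/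
theorem cross_crossSharp (v : J) : H.cross v (H.crossSharp v) =
    star (H.N v) • v + H.T v v • H.sharp v := by
  rw [← H.cross_sharp_self, cross_sharp_cross]

theorem cross_crossSharp' (v : J) : H.cross (H.crossSharp v) v =
    star (H.N v) • v + H.T v v • H.sharp v := by
  rw [H.cross_comm, cross_crossSharp]

theorem sharp_crossSharp (v : J) : H.cross (H.sharp v) (H.crossSharp v) =
    H.N v • H.sharp v + H.T (H.sharp v) (H.sharp v) • v := by
  rw [crossSharp, sharp_cross_cross]

theorem sharp_crossSharp' (v : J) : H.cross (H.crossSharp v) (H.sharp v) =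
    H.N v • H.sharp v + H.T (H.sharp v) (H.sharp v) • v := by
  rw [H.cross_comm, sharp_crossSharp]

theorem T_crossSharp (v : J) : H.T v (H.crossSharp v) = 2 * H.T (H.sharp v) (H.sharp v) := by
  rw [← cross_sharp_self, H.T_cross_comm, cross_self, H.T_smul_right, star_ofNat]

theorem T_crossSharp' (v : J) : H.T (H.crossSharp v) v = 2 * H.T (H.sharp v) (H.sharp v) := by
  rw [← H.star_T, T_crossSharp, star_mul', star_ofNat, H.star_T]

theorem T_sharp_crossSharp (v : J) :
    H.T (H.sharp v) (H.crossSharp v) = 2 * star (H.N v) * H.T v v := by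
  rw [crossSharp, H.T_cross_comm, cross_self, H.sharp_sharp', H.T_smul_right, H.T_smul_right,
    star_ofNat, mul_assoc]

theorem T_sharp_crossSharp' (v : J) :
    H.T (H.crossSharp v) (H.sharp v) = 2 * H.N v * H.T v v := by
  rw [← H.star_T, T_sharp_crossSharp, star_mul', star_mul', star_ofNat, H.star_T, star_star]

theorem T_crossSharp_self (v : J) : H.T (H.crossSharp v) (H.crossSharp v) =
    H.T (H.sharp v) (H.sharp v) * H.T v v + 3 * H.N v * star (H.N v) := by
  have h := H.T_cross_left (H.crossSharp v) v (H.sharp v)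
  rw [cross_self_sharp, sharp_crossSharp'] at h
  rw [h, map_add, LinearMap.add_apply, H.T_smul_left, H.T_smul_left, T_sharp_self]
  ring

theorem sharp_crossSharp_self (v : J) : H.sharp (H.crossSharp v) =
    H.T (H.sharp v) (H.sharp v) • H.sharp v + (star (H.N v) * H.T v v) • v
      - star (H.N v) • H.crossSharp v := by
  have h := H.sharp_cross v (H.sharp v)
  rw [H.sharp_sharp', H.cross_smul_right, cross_sharp_self, cross_self_sharp, H.T_smul_right] at h
  linear_combination (norm := module) h

theorem N_sub' (a b : J) : H.N (a - b) =
    H.N a - H.T b (H.sharp a) + H.T a (H.sharp b) - H.N b := by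
  rw [sub_eq_add_neg, H.N_add', sharp_neg, N_neg, map_neg, LinearMap.neg_apply]
  ring

/-- Put a = b = v in the axiom on N(T(a,b)a - a♯ × b) and expand; every other term is already known.
-/
theorem N_crossSharp (v : J) : H.N (H.crossSharp v) =
    H.N v * H.T (H.sharp v) (H.sharp v) * H.T v v - H.N v ^ 2 * star (H.N v) := by
  have h := H.N_adjoint' v v
  rw [cross_sharp_self, N_sub', N_smul', H.sharp_smul', H.T_smul_right, H.T_smul_left,
    sharp_crossSharp_self] at h
  simp only [map_sub, map_add, H.T_smul_right, star_star, star_mul', H.star_T, star_pow,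
    T_crossSharp, T_sharp_crossSharp', N_self_coeff] at h
  linear_combination -h

theorem D_crossSharp_left (v b : J) : H.D (H.crossSharp v) v b =
    (2 * H.T (H.sharp v) (H.sharp v)) • b - H.D (H.sharp v) (H.sharp v) b := by
  have h := H.D_sharp_left v (H.sharp v) b
  rw [cross_self_sharp] at h
  linear_combination (norm := module) h

theorem D_crossSharp_mid (v b : J) : H.D v (H.crossSharp v) b =
    (2 * H.T (H.sharp v) (H.sharp v)) • b - H.D (H.sharp v) (H.sharp v) b := by
  have h := H.D_sharp_mid v (H.sharp v) b
  rw [cross_self_sharp] at h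
  linear_combination (norm := module) h

theorem D_sharp_crossSharp (v b : J) : H.D (H.sharp v) (H.crossSharp v) b =
    (2 * star (H.N v) * H.T v v) • b - star (H.N v) • H.D v v b := by
  have h := H.D_sharp_mid (H.sharp v) v b
  rw [cross_sharp_self, H.sharp_sharp', D_smul_mid, H.T_smul_right] at h
  linear_combination (norm := module) h

theorem D_crossSharp_sharp (v b : J) : H.D (H.crossSharp v) (H.sharp v) b =
    (2 * H.N v * H.T v v) • b - H.N v • H.D v v b := by
  have h := H.D_sharp_left (H.sharp v) v b
  rw [cross_sharp_self, H.sharp_sharp', D_smul_left, H.T_smul_left] at h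
  linear_combination (norm := module) h

theorem D_crossSharp_crossSharp (v b : J) : H.D (H.crossSharp v) (H.crossSharp v) b =
    (2 * H.T (H.sharp v) (H.sharp v) * H.T v v + 2 * H.N v * star (H.N v)) • b
      - H.T v v • H.D (H.sharp v) (H.sharp v) b - H.T (H.sharp v) (H.sharp v) • H.D v v b := by
  have h := H.D_cross_mid v (H.sharp v) (H.crossSharp v) b
  rw [cross_self_sharp, cross_crossSharp, sharp_crossSharp] at h
  simp only [D_add_mid, D_smul_mid, map_add, H.T_smul_right, star_star, H.star_T, D_sharp_self,
    D_self_sharp, N_self_coeff] at h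
  linear_combination (norm := module) h

end Generic

end HermitianCubicNormStructure

/-! ### Inner transformations and the degree-2 component of exp_+ on them. -/

/-- For z = x + yt the condition reads y = -2x, hence z = -x(t - t̄). No division by 2 occurs, and
the same coefficient -x is used in `skewCoord`. -/
theorem QuadExt.mem_skew_of_star {R : Type u} [CommRing R] {α : R} {z : QuadExt R α}
    (hz : star z = -z) : z ∈ QuadExt.skew R α := by
  refine Submodule.mem_span_singleton.2 ⟨-z.re, ?_⟩
  have h := congrArg QuadraticAlgebra.re hz
  simp at h
  ext
  · simp
  · simp
    linear_combination -h

namespace HermitianCubicNormStructure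

section Generic

variable {R : Type u} [CommRing R] {α : R} {J : Type v} [AddCommGroup J] [Module (QuadExt R α) J]
  [Module R J] [IsScalarTower R (QuadExt R α) J] {H : HermitianCubicNormStructure R α J}

theorem star_algebraMap_quadExt (r : R) :
    star (algebraMap R (QuadExt R α) r) = algebraMap R (QuadExt R α) r := by
  rw [Algebra.algebraMap_eq_smul_one, star_smul', star_one]

theorem D_sharp (a b c : J) : H.D b a (H.sharp c) =
    (2 * H.T b a) • H.sharp c - H.cross (H.D a b c) c := by
  have h := H.cross_cross_left c b a
  rw [D, D]
  simp only [map_add, map_sub, LinearMap.add_apply, LinearMap.sub_apply, H.cross_smul_left,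
    H.star_T, cross_self, H.cross_comm a c, H.cross_comm b (H.sharp c)]
  linear_combination (norm := module) -h

theorem T_D_sharp (a b c : J) : H.T (H.D a b c) (H.sharp c) = 2 * H.T a b * H.N c := by
  rw [D]
  simp only [map_add, map_sub, LinearMap.add_apply, LinearMap.sub_apply, H.T_smul_left,
    N_self_coeff]
  rw [H.cross_comm _ b, H.T_cross_left, H.cross_comm a c, sharp_cross_cross, map_add,
      LinearMap.add_apply,
    H.T_smul_left, H.T_smul_left]
  ring

/-- The compatibility with `♯` and `N` of the derivation underlying an inner transformation. -/
structure InnerData.Compatible {f g : Module.End R (QuadExt R α × J)} (h : H.InnerData f g) :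
    Prop where
  sharp (c : J) : h.Δ (H.sharp c) = H.cross (h.Δ c) c - h.l • H.sharp c
  norm (c : J) : H.T (h.Δ c) (H.sharp c) = (h.l + 2 * star h.l) * H.N c

/-- The fields of `InnerData` contain only the linearised rule for ×, from which the rules for ♯ and
N would follow only after dividing by 2 and 3. They are therefore checked on the spanning pairs, and
pass to sums and multiples because they are linear in the transformation. -/
theorem InnerData.compatible_ofV (a b : QuadExt R α × J) : (InnerData.ofV H a b).Compatible where
  sharp c := by
    simp only [InnerData.ofV, LinearMap.sub_apply, LinearMap.add_apply, LinearMap.smul_apply,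
      LinearMap.id_apply, DL, LinearMap.coe_mk, AddHom.coe_mk, D_sharp, map_add, map_sub,
      H.cross_smul_left, cross_self, star_sub, star_neg, star_mul', star_star, H.star_T]
    module
  norm c := by
    simp only [InnerData.ofV, LinearMap.sub_apply, LinearMap.add_apply, LinearMap.smul_apply,
      LinearMap.id_apply, DL, LinearMap.coe_mk, AddHom.coe_mk, map_add, map_sub,
      H.T_smul_left, T_D_sharp, N_self_coeff, star_sub, star_neg, star_mul', star_star, H.star_T,
      star_ofNat]
    ring

theorem InnerData.Compatible.add {f g f' g' : Module.End R (QuadExt R α × J)}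
    {h : H.InnerData f g} {h' : H.InnerData f' g'} (hc : h.Compatible) (hc' : h'.Compatible) :
    (h.add h').Compatible where
  sharp c := by
    simp only [InnerData.add, LinearMap.add_apply, hc.sharp, hc'.sharp, map_add]
    module
  norm c := by
    simp only [InnerData.add, LinearMap.add_apply, hc.norm, hc'.norm, map_add, star_add]
    ring

theorem InnerData.Compatible.smul (r : R) {f g : Module.End R (QuadExt R α × J)}
    {h : H.InnerData f g} (hc : h.Compatible) : (h.smul r).Compatible where
  sharp c := by
    simp only [InnerData.smul, LinearMap.smul_apply, hc.sharp, map_smul, smul_sub, smul_assoc]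
  norm c := by
    simp only [InnerData.smul, LinearMap.smul_apply, hc.norm, map_smul, star_smul', smul_eq,
      star_mul', star_algebraMap_quadExt]
    ring

theorem exists_compatible_innerData
    {p : Module.End R (QuadExt R α × J) × Module.End R (QuadExt R α × J)}
    (hp : p ∈ H.inner) : ∃ h : H.InnerData p.1 p.2, h.Compatible := by
  induction hp using Submodule.span_induction with
  | mem x h => obtain ⟨a, b, rfl⟩ := h; exact ⟨_, InnerData.compatible_ofV a b⟩
  | zero =>
    have : ∃ h : H.InnerData ((0 : R) • H.V 0 0) ((0 : R) • -H.V 0 0), h.Compatible :=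
      ⟨_, (InnerData.compatible_ofV 0 0).smul 0⟩
    rw [zero_smul, zero_smul] at this
    exact this
  | add x y _ _ hx hy =>
    obtain ⟨h, hc⟩ := hx
    obtain ⟨h', hc'⟩ := hy
    exact ⟨_, hc.add hc'⟩
  | smul r x _ hx =>
    obtain ⟨h, hc⟩ := hx
    exact ⟨_, hc.smul r⟩

/-- An inner transformation is determined by its first entry. -/
theorem inner_ext {p p' : Module.End R (QuadExt R α × J) × Module.End R (QuadExt R α × J)}
    (hp : p ∈ H.inner) (hp' : p' ∈ H.inner) (h : p.1 = p'.1) : p = p' := by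
  suffices ∀ q ∈ H.inner, q.1 = 0 → q = 0 from
    sub_eq_zero.1 (this _ (sub_mem hp hp') (by rw [Prod.fst_sub, h, sub_self]))
  intro q hq hq0
  obtain ⟨d⟩ := H.exists_innerData hq
  -- The value at 1 ∈ K shows l and m, and the values on J then show Δ; these three determine the
  -- second entry.
  have h1 := d.hf (1, 0)
  have hl : d.l = 0 := by simpa [hq0] using (congrArg Prod.fst h1).symm
  have hm : d.m = 0 := by simpa [hq0] using (congrArg Prod.snd h1).symm
  refine Prod.ext hq0 (LinearMap.ext fun c => ?_)
  have h2 := d.hf c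
  have hD : d.Δ c.2 = 0 := by simpa [hq0, hm] using (congrArg Prod.snd h2).symm
  rw [d.hg, hl, hm, hD]
  simp

namespace G

variable (g : H.G)

theorem Q_fst (c : QuadExt R α × J) : (g.Q c).1 = g.a ^ 2 * star c.1 + g.a * H.T c.2 g.v
    + c.1 * H.T g.v g.v - g.u * c.1 + H.T (H.sharp g.v) c.2 := by
  obtain ⟨b, w⟩ := c
  have h1 : H.T (H.cross g.v w) g.v = 2 * H.T (H.sharp g.v) w := by
    rw [H.cross_comm, H.T_cross_left, cross_self, H.T_smul_left]
  simp only [Q, mul_apply, bar_apply, x, y, Prod.fst_sub, map_add, LinearMap.add_apply,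
    H.T_smul_left, star_star, h1]
  ring

theorem Q_snd (c : QuadExt R α × J) : (g.Q c).2 = H.T g.v c.2 • g.v
    + (g.a * star g.a - g.u) • c.2 + (star g.a * c.1) • g.v + star g.a • H.cross g.v c.2
    + star c.1 • H.sharp g.v + H.cross (H.cross g.v c.2) g.v - H.cross (H.sharp g.v) c.2 := by
  obtain ⟨b, w⟩ := c
  simp only [Q, mul_apply, bar_apply, x, y, Prod.snd_sub, map_add, LinearMap.add_apply,
    H.cross_smul_left, star_star, cross_self, H.cross_comm w g.v]
  module

theorem cubic_coe (c : QuadExt R α × J) : (g.cubic c : QuadExt R α) =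
    (H.T g.v g.v - star g.u) * g.a * star c.1 - (H.T g.v g.v - g.u) * star g.a * c.1
    + ((g.a * star g.a - star g.u) * H.T g.v c.2 - (g.a * star g.a - g.u) * H.T c.2 g.v)
    + (g.a * H.T c.2 (H.sharp g.v) - star g.a * H.T (H.sharp g.v) c.2)
    + (c.1 * H.N g.v - star c.1 * star (H.N g.v))
    - (H.T c.2 (H.crossSharp g.v) - H.T (H.crossSharp g.v) c.2) := by
  simp only [cubic, star_add, star_sub, star_mul', star_star, H.star_T, crossSharp]
  ring

theorem star_u : star g.u = g.a * star g.a + H.T g.v g.v - g.u := by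
  rw [← g.add_star_u]; ring

theorem Q_add (c d : QuadExt R α × J) : g.Q (c + d) = g.Q c + g.Q d := by
  simp only [Q, map_add, LinearMap.add_apply]; abel

theorem Q_smul (r : R) (c : QuadExt R α × J) : g.Q (r • c) = r • g.Q c := by
  simp only [Q, map_smul, LinearMap.smul_apply, smul_sub]

theorem cubic_add (c d : QuadExt R α × J) : g.cubic (c + d) = g.cubic c + g.cubic d := by
  apply Subtype.ext
  rw [Submodule.coe_add]
  simp only [cubic_coe, Prod.fst_add, Prod.snd_add, map_add, LinearMap.add_apply, star_add]
  ring

theorem cubic_smul (r : R) (c : QuadExt R α × J) : g.cubic (r • c) = r • g.cubic c := by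
  apply Subtype.ext
  rw [Submodule.coe_smul]
  simp only [cubic_coe, Prod.smul_fst, Prod.smul_snd, map_smul, LinearMap.smul_apply, smul_eq,
    star_mul', star_algebraMap_quadExt]
  ring

/-- The component of degree `2` of the image of an inner transformation under `exp_+`. -/
def quadK (f : Module.End R (QuadExt R α × J)) : QuadExt R α :=
  (f (1, 0)).1 * star g.u - star (f (1, 0)).1 * g.u + star (f (1, 0)).1 * H.T g.v g.v
    - H.T g.v ((f (0, g.v)).2 - H.cross (f (1, 0)).2 g.v)
    - g.a * H.T g.v (f (1, 0)).2 + star g.a * H.T (f (1, 0)).2 g.v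
    - H.T (f (1, 0)).2 (H.sharp g.v) + H.T (H.sharp g.v) (f (1, 0)).2

theorem quadK_eq {f f' : Module.End R (QuadExt R α × J)} (h : H.InnerData f f') :
    g.quadK f = h.l * star g.u - star h.l * g.u + star h.l * H.T g.v g.v - H.T g.v (h.Δ g.v)
      + g.a * H.T g.v h.m - star g.a * H.T h.m g.v + H.T h.m (H.sharp g.v)
      - H.T (H.sharp g.v) h.m := by
  simp only [quadK, h.hf, mul_one, star_one, one_smul, map_zero, mul_zero, sub_zero, zero_sub,
    star_zero, zero_smul, map_neg, map_sub, LinearMap.neg_apply, LinearMap.zero_apply]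
  ring

theorem quadK_mem {p : Module.End R (QuadExt R α × J) × Module.End R (QuadExt R α × J)}
    (hp : p ∈ H.inner) : g.quadK p.1 ∈ QuadExt.skew R α := by
  obtain ⟨h⟩ := H.exists_innerData hp
  apply QuadExt.mem_skew_of_star
  rw [g.quadK_eq h]
  simp only [star_add, star_sub, star_mul', star_star, H.star_T, h.hT]
  ring

/-- The map of degree `2` from the inner structure algebra to `R (t - t̄)`. -/
def quad : H.inner →ₗ[R] QuadExt.skew R α where
  toFun p := ⟨g.quadK p.1.1, g.quadK_mem p.2⟩
  map_add' p p' := by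
    apply Subtype.ext
    simp only [quadK, Submodule.coe_add, Prod.fst_add, Prod.snd_add, LinearMap.add_apply, map_add,
      map_sub, star_add]
    ring
  map_smul' r p := by
    apply Subtype.ext
    simp only [quadK, Submodule.coe_smul, Prod.smul_fst, Prod.smul_snd, LinearMap.smul_apply,
      map_smul, map_sub, smul_eq, RingHom.id_apply, star_mul', star_algebraMap_quadExt]
    ring

theorem quad_coe (p : H.inner) : (g.quad p : QuadExt R α) = g.quadK p.1.1 := rfl

/-- This is the degree-2 part of exp_+[c₁, d₋₁] = [exp_+ c₁, exp_+ d₋₁], and so the value forced on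
the spanning elements. Since `quadK` is written in terms of f alone, there is no ambiguity from
different expressions of f as a sum of operators V. -/
theorem quadK_V (c d : QuadExt R α × J) : g.quadK (H.V c d) = (H.psi c (g.Q d) : QuadExt R α)
    - algebraMap R (QuadExt R α) (chi (H.V g.x d)) * H.psi g.x c := by
  obtain ⟨b, w⟩ := c
  obtain ⟨b', w'⟩ := d
  have hu := g.star_u
  rw [g.quadK_eq (InnerData.ofV H _ _), H.chi_V]
  simp only [psi_coe, Q_fst, Q_snd, InnerData.ofV, LinearMap.sub_apply, LinearMap.add_apply,
    LinearMap.smul_apply, LinearMap.id_apply, DL, LinearMap.coe_mk, AddHom.coe_mk, D, map_add,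
    map_sub, H.T_smul_left, H.T_smul_right, star_add, star_sub, star_mul', star_neg, star_star,
    H.star_T, star_ofNat, star_pow, x]
  have t1 : H.T g.v (H.cross (H.cross w' g.v) w) = H.T w (H.cross (H.cross g.v w') g.v) := by
    rw [H.cross_comm _ w, H.T_cross_comm, H.cross_comm g.v, H.cross_comm w']
  have t2 : H.T (H.cross (H.cross g.v w') g.v) w = H.T g.v (H.cross (H.cross w g.v) w') := by
    rw [H.T_cross_left, H.T_cross_comm]
  have t3 := H.T_cross_comm g.v w w'
  have t4 := H.T_cross_comm (H.sharp g.v) w w'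
  have t5 := H.T_cross_left g.v w w'
  have t6 := H.T_cross_left (H.sharp g.v) w w'
  rw [t1, t2, t3, t4, t5, t6, hu]
  ring

end G

end Generic

end HermitianCubicNormStructure

/-! ### Equivariance of Q and T_{(x,y)} under inner transformations. -/

namespace HermitianCubicNormStructure

section Generic

variable {R : Type u} [CommRing R] {α : R} {J : Type v} [AddCommGroup J] [Module (QuadExt R α) J]
  [Module R J] [IsScalarTower R (QuadExt R α) J] {H : HermitianCubicNormStructure R α J}

/-- This and the next lemma move w out of nested products until it is a whole argument of T. The
scalar identities below, all linear in w, are compared in this normal form. -/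
theorem T_cross_cross_right (a b c w : J) : H.T a (H.cross (H.cross w b) c) =
    H.T (H.cross (H.cross a c) b) w := by
  rw [H.T_cross_comm, H.T_cross_left]

theorem T_cross_cross_left (a b c w : J) : H.T (H.cross (H.cross w b) c) a =
    H.T w (H.cross (H.cross a c) b) := by
  rw [H.T_cross_left, H.T_cross_comm]

theorem T_self_cross (v m : J) : H.T v (H.cross v m) = 2 * H.T m (H.sharp v) := by
  rw [H.cross_comm, H.T_cross_comm, cross_self, H.T_smul_right, star_ofNat]

theorem T_cross_self (v m : J) : H.T (H.cross v m) v = 2 * H.T (H.sharp v) m := by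
  rw [H.cross_comm, H.T_cross_left, cross_self, H.T_smul_left]

namespace G

variable (g : H.G)

/-- The degree-1 part of exp_+[p, e₋₁] = [exp_+ p, exp_+ e₋₁], where exp_+ p has components p, -p x
and `quadK` in degrees 0, 1, 2. -/
theorem Q_inner {p : Module.End R (QuadExt R α × J) × Module.End R (QuadExt R α × J)}
    (hp : p ∈ H.inner) (e : QuadExt R α × J) :
    g.Q (p.2 e) = p.1 (g.Q e) + H.V g.x e (p.1 g.x) - g.quadK p.1 • e := by
  obtain ⟨h, hc⟩ := exists_compatible_innerData hp
  obtain ⟨b, w⟩ := e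
  have hu := g.star_u
  have hN := hc.norm g.v
  rw [g.quadK_eq h]
  ext1
  · simp only [h.hf, h.hg, Q_fst, Q_snd, V_formula, Prod.fst_add, Prod.fst_sub, Prod.smul_fst, D, x,
      map_add, map_sub, LinearMap.add_apply, LinearMap.sub_apply, H.T_smul_left, H.T_smul_right,
      star_add, star_sub, star_mul', star_neg, star_star, H.star_T, star_ofNat, star_pow, h.hT,
      hc.sharp, smul_eq_mul, hu]
    have t := h.hT (H.sharp g.v) w
    simp only [H.cross_comm g.v w, H.cross_comm h.m w, H.cross_comm (H.sharp g.v) w,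
      H.T_cross_comm _ w, H.T_cross_left _ w, T_cross_cross_right _ _ _ w, map_sub,
      LinearMap.sub_apply, H.T_smul_left,
      T_cross_cross_left _ _ _ w, H.cross_comm h.m, T_self_cross, T_cross_self, hc.sharp] at t ⊢
    linear_combination t
  · simp only [h.hf, h.hg, Q_fst, Q_snd, V_formula, Prod.snd_add, Prod.snd_sub, Prod.smul_snd, D, x,
      map_add, map_sub, LinearMap.add_apply, LinearMap.sub_apply, H.T_smul_left, H.T_smul_right,
      star_add, star_sub, star_mul', star_neg, star_star, H.star_T, star_ofNat, star_pow, h.hT,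
          h.hX,
      hc.sharp, smul_eq_mul, hu, LinearMap.map_smul, H.cross_smul_left, H.cross_smul_right, D]
    -- After the rules for Δ are applied, the remaining triple products of v, v, w, m cancel by
    -- linearisations of the two adjoint identities.
    have r1 := H.cross_cross_mid g.v w h.m
    have r2 := H.cross_cross_left g.v w h.m
    have r4 := H.cross_cross_linear g.v g.v w h.m
    simp only [H.cross_comm w g.v, H.cross_comm h.m g.v, H.cross_comm h.m w,
      H.cross_comm (H.cross _ _) w, H.cross_comm (H.cross _ _) g.v, H.cross_comm (H.cross _ _) h.m,
      H.cross_comm _ (H.sharp g.v), H.cross_comm (H.cross g.v h.m) (H.cross g.v w),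
      H.cross_comm (h.Δ _) g.v, H.cross_comm (h.Δ _) w, H.T_cross_left g.v w h.m,
      T_cross_self] at r1 r2 r4 ⊢
    linear_combination (norm := (match_scalars <;> ring_nf)) r4 - r1 - r2

/-- The degree-2 part of the same bracket relation. Here N(v) occurs without the factor 3, so the
`norm` field of `Compatible` is indispensable. -/
theorem cubic_inner {p : Module.End R (QuadExt R α × J) × Module.End R (QuadExt R α × J)}
    (hp : p ∈ H.inner) (e : QuadExt R α × J) :
    (g.cubic (p.2 e) : QuadExt R α) = algebraMap R (QuadExt R α) (chi p.1) * g.cubic e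
      - H.psi (p.1 g.x) (g.Q e) - algebraMap R (QuadExt R α) (chi (H.V g.x e)) * g.quadK p.1 := by
  obtain ⟨h, hc⟩ := exists_compatible_innerData hp
  obtain ⟨b, w⟩ := e
  have hu := g.star_u
  have hN := hc.norm g.v
  rw [g.quadK_eq h, h.chi_eq, H.chi_V]
  simp only [h.hf, h.hg, Q_fst, Q_snd, cubic_coe, psi_coe, x,
      map_add, map_sub, LinearMap.add_apply, LinearMap.sub_apply, H.T_smul_left, H.T_smul_right,
      star_add, star_sub, star_mul', star_neg, star_star, H.star_T, star_ofNat, star_pow, h.hT,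
          h.hX,
      hc.sharp, smul_eq_mul, hu, LinearMap.map_smul, H.cross_smul_left, H.cross_smul_right]
  simp only [H.cross_comm g.v w, H.cross_comm h.m w, H.cross_comm (H.sharp g.v) w,
      H.cross_comm (h.Δ _) w,
      H.T_cross_comm _ w, H.T_cross_left _ w, T_cross_cross_right _ _ _ w, map_sub,
      LinearMap.sub_apply, H.T_smul_left,
      T_cross_cross_left _ _ _ w, H.cross_comm h.m, T_self_cross, T_cross_self, hc.sharp]
  have hN' := congrArg star hN
  simp only [star_add, star_mul', star_star, H.star_T, star_ofNat] at hN'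
  have k1 : H.T (H.cross g.v h.m) (H.sharp g.v) = H.T (H.crossSharp g.v) h.m := by
    rw [H.cross_comm, H.T_cross_left, cross_sharp_self]
  have k2 : H.T (H.sharp g.v) (H.cross g.v h.m) = H.T h.m (H.crossSharp g.v) := by
    rw [H.cross_comm, H.T_cross_comm, cross_sharp_self]
  have k3 : ∀ z, H.T g.v (H.cross z g.v) = 2 * H.T z (H.sharp g.v) := by
    intro z; rw [H.cross_comm, T_self_cross]
  have k4 : H.cross (H.cross (H.cross g.v h.m) g.v) g.v = H.T (H.sharp g.v) h.m • g.v
      + H.T g.v h.m • H.sharp g.v + H.T g.v g.v • H.cross g.v h.m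
      - H.cross (H.crossSharp g.v) h.m := by
    have := H.cross_cross_left g.v g.v h.m
    rw [cross_sharp_self] at this
    linear_combination (norm := module) this
  -- Δ is moved off w and onto the elements built from v, so that w is again left alone in one
  -- argument.
  have k5 : ∀ Y, H.T Y (h.Δ w) = (h.l + star h.l) * H.T Y w - H.T (h.Δ Y) w := by
    intro Y; rw [h.hT]; ring
  have k6 : h.Δ (H.crossSharp g.v) = H.cross (h.Δ g.v) (H.sharp g.v)
      + H.cross (H.cross (h.Δ g.v) g.v) g.v - (star h.l + h.l) • H.crossSharp g.v := by
    simp only [crossSharp, h.hX, hc.sharp, map_sub, H.cross_smul_right,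
      H.cross_comm g.v (H.cross _ _)]
    module
  simp only [T_cross_cross_right _ _ _ (h.Δ w), H.T_cross_comm _ w, h.hT w,
    H.cross_comm (H.cross _ _) w, H.cross_comm (H.cross _ _) (h.Δ w), H.T_cross_comm _ (h.Δ w)]
  simp only [cross_self_sharp, cross_sharp_self, cross_self, k1, k2, k3, k4, k5, k6, hN, hN',
    N_self_coeff, hc.sharp, map_add, map_sub, LinearMap.map_smul, H.cross_smul_left, star_ofNat,
        LinearMap.sub_apply, LinearMap.add_apply,
    H.T_smul_left, H.T_smul_right, cross_cross_sharp, h.hX, H.T_cross_comm _ w,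
    H.cross_comm g.v (h.Δ _), H.cross_comm (H.sharp g.v) (h.Δ _), star_add, star_sub, star_mul',
        star_star, H.star_T]
  have k7 : H.T (H.cross (h.Δ w) g.v) (H.sharp g.v) = H.T (H.crossSharp g.v) (h.Δ w) := by
    rw [H.T_cross_left, cross_sharp_self]
  have k8 : H.T g.v (H.cross (h.Δ w) (H.sharp g.v)) = H.T (h.Δ w) (H.crossSharp g.v) := by
    rw [H.T_cross_comm, cross_self_sharp]
  rw [k7, k8, k5, h.hT w, k6, H.cross_comm g.v (H.cross _ _)]
  simp only [map_add, map_sub, LinearMap.add_apply, LinearMap.sub_apply, H.T_smul_left,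
    H.T_smul_right, star_add, star_star]
  ring

end G

end Generic

end HermitianCubicNormStructure

/-! ### Images of degree -1: brackets between J and K. -/

namespace HermitianCubicNormStructure

section Generic

variable {R : Type u} [CommRing R] {α : R} {J : Type v} [AddCommGroup J] [Module (QuadExt R α) J]
  [Module R J] [IsScalarTower R (QuadExt R α) J] {H : HermitianCubicNormStructure R α J}

namespace LieAlg

theorem mk_s (s : QuadExt.skew R α) (x : QuadExt R α × J) (p : H.inner) (y : QuadExt R α × J)
    (r : QuadExt.skew R α) : (mk s x p y r).s = s := rfl
theorem mk_x (s : QuadExt.skew R α) (x : QuadExt R α × J) (p : H.inner) (y : QuadExt R α × J)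
    (r : QuadExt.skew R α) : (mk s x p y r).x = x := rfl
theorem mk_p (s : QuadExt.skew R α) (x : QuadExt R α × J) (p : H.inner) (y : QuadExt R α × J)
    (r : QuadExt.skew R α) : (mk s x p y r).p = p := rfl
theorem mk_f (s : QuadExt.skew R α) (x : QuadExt R α × J) (p : H.inner) (y : QuadExt R α × J)
    (r : QuadExt.skew R α) : (mk s x p y r).f = p.1.1 := rfl
theorem mk_g (s : QuadExt.skew R α) (x : QuadExt R α × J) (p : H.inner) (y : QuadExt R α × J)
    (r : QuadExt.skew R α) : (mk s x p y r).g = p.1.2 := rfl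
theorem mk_y (s : QuadExt.skew R α) (x : QuadExt R α × J) (p : H.inner) (y : QuadExt R α × J)
    (r : QuadExt.skew R α) : (mk s x p y r).y = y := rfl
theorem mk_r (s : QuadExt.skew R α) (x : QuadExt R α × J) (p : H.inner) (y : QuadExt R α × J)
    (r : QuadExt.skew R α) : (mk s x p y r).r = r := rfl

end LieAlg

theorem cross_cross_cross_self (v m : J) : H.cross (H.cross (H.cross v m) v) v =
    H.T (H.sharp v) m • v + H.T v m • H.sharp v + H.T v v • H.cross v m
      - H.cross (H.crossSharp v) m := by
  have := H.cross_cross_left v v m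
  rw [cross_sharp_self] at this
  linear_combination (norm := module) this

namespace G

variable (g : H.G)

/-- The image of an element of degree `-1` under `exp_+`. -/
def expNeg (c : QuadExt R α × J) : H.LieAlg :=
  LieAlg.mk (g.cubic c) (g.Q c) ⟨_, H.V_mem g.x c⟩ c 0

theorem expNeg_s (c : QuadExt R α × J) : (g.expNeg c).s = g.cubic c := rfl
theorem expNeg_x (c : QuadExt R α × J) : (g.expNeg c).x = g.Q c := rfl
theorem expNeg_f (c : QuadExt R α × J) : (g.expNeg c).f = H.V g.x c := rfl
theorem expNeg_g (c : QuadExt R α × J) : (g.expNeg c).g = -H.V c g.x := rfl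
theorem expNeg_y (c : QuadExt R α × J) : (g.expNeg c).y = c := rfl
theorem expNeg_r (c : QuadExt R α × J) : (g.expNeg c).r = 0 := rfl

/-- J and K commute in degree -1, so the images must commute as well. Only the components of degrees
1 and 2 are computed by hand; the others follow from brackets with the images of degree 1 in
`lie_expNeg_J_K`. -/
theorem lie_expNeg_x (w : J) (k : QuadExt R α) : ⁅g.expNeg (0, w), g.expNeg (k, 0)⁆.x = 0 := by
  have hu := g.star_u
  rw [LieAlg.lie_x]
  simp only [expNeg_s, expNeg_x, expNeg_f, expNeg_y]
  ext1
  · simp only [Q_fst, Q_snd, cubic_coe, V_formula, Prod.fst_add, Prod.fst_sub, Prod.smul_fst, D, x,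
      map_add, map_sub, LinearMap.add_apply, LinearMap.sub_apply, H.T_smul_left, H.T_smul_right,
      star_add, star_sub, star_mul', star_neg, star_star, H.star_T, star_ofNat, star_pow, map_zero,
      LinearMap.zero_apply, star_zero, Prod.fst_zero, H.cross_smul_left, H.cross_smul_right,
      smul_eq_mul, hu, cross_self, cross_self_sharp, H.cross_comm w g.v]
    simp only [H.cross_comm g.v w, H.cross_comm (H.sharp g.v) w,
      H.T_cross_comm _ w, H.T_cross_left _ w, T_cross_cross_right _ _ _ w,
      T_cross_cross_left _ _ _ w]
    simp only [cross_self, cross_self_sharp, cross_sharp_self, H.T_smul_left, H.T_smul_right,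
      H.cross_smul_left, star_ofNat]
    ring_nf
  · simp only [Q_fst, Q_snd, cubic_coe, V_formula, Prod.snd_add, Prod.snd_sub, Prod.smul_snd, D, x,
      map_add, map_sub, LinearMap.add_apply, LinearMap.sub_apply, H.T_smul_left, H.T_smul_right,
      star_add, star_sub, star_mul', star_neg, star_star, H.star_T, star_ofNat, star_pow, map_zero,
      LinearMap.zero_apply, star_zero, Prod.snd_zero, H.cross_smul_left, H.cross_smul_right,
      smul_eq_mul, hu, cross_self, cross_self_sharp, H.cross_comm w g.v, smul_zero, zero_smul,
      add_zero, zero_add, mul_zero, zero_mul]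
    simp only [H.cross_comm w (H.sharp g.v), H.cross_comm g.v (H.cross _ _), cross_cross_sharp,
      H.cross_cross', cross_cross_cross_self, T_sharp_self]
    match_scalars <;> ring_nf

theorem lie_expNeg_s (w : J) (k : QuadExt R α) :
    (⁅g.expNeg (0, w), g.expNeg (k, 0)⁆.s : QuadExt R α) = 0 := by
  have hu := g.star_u
  rw [LieAlg.lie_s]
  simp only [expNeg_s, expNeg_x, expNeg_f, expNeg_y]
  simp only [smul_eq, H.chi_V, psi_coe, Q_fst, Q_snd, cubic_coe, x,
      map_add, map_sub, LinearMap.add_apply, LinearMap.sub_apply, H.T_smul_left, H.T_smul_right,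
      star_add, star_sub, star_mul', star_neg, star_star, H.star_T, star_ofNat, star_pow, map_zero,
      LinearMap.zero_apply, star_zero, Prod.snd_zero, H.cross_smul_left, H.cross_smul_right,
      smul_eq_mul, hu, cross_self, cross_self_sharp, H.cross_comm w g.v, smul_zero, zero_smul,
      add_zero, zero_add, mul_zero, zero_mul]
  simp only [H.cross_comm g.v w, H.cross_comm (H.sharp g.v) w,
      H.T_cross_comm _ w, H.T_cross_left _ w, T_cross_cross_right _ _ _ w,
      T_cross_cross_left _ _ _ w]
  simp only [cross_self, cross_self_sharp, cross_sharp_self, H.T_smul_left, H.T_smul_right,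
      H.cross_smul_left, star_ofNat, cross_crossSharp, cross_crossSharp', map_add,
      LinearMap.add_apply, H.sharp_sharp', star_star, H.star_T, star_mul', T_sharp_self,
          N_self_coeff]
  ring_nf

end G

end Generic

end HermitianCubicNormStructure

/-! ### Brackets between the images of K, and the quartic norm. -/

namespace HermitianCubicNormStructure

section Generic

variable {R : Type u} [CommRing R] {α : R} {J : Type v} [AddCommGroup J] [Module (QuadExt R α) J]
  [Module R J] [IsScalarTower R (QuadExt R α) J] {H : HermitianCubicNormStructure R α J}

theorem algebraMap_chi (f : Module.End R (QuadExt R α × J)) :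
    algebraMap R (QuadExt R α) (chi f) = (f (1, 0)).1 + star (f (1, 0)).1 := by
  rw [chi, QuadraticAlgebra.algebraMap_trace_eq_add_star]

theorem D_self_self (v : J) :
    H.D v v v = (2 * H.T v v) • v - (2 : QuadExt R α) • H.crossSharp v := by
  rw [D, cross_self, H.cross_smul_left, cross_sharp_self, star_ofNat]
  module

theorem D_self_sharp_arg (v : J) : H.D v v (H.sharp v) = (2 * star (H.N v)) • v := by
  rw [D, cross_self_sharp, cross_crossSharp', T_sharp_self]
  module

namespace G

variable (g : H.G)

/-- The component of degree `1` of the image of the element `1` of `K` in degree `-2`. -/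
def adj : QuadExt R α × J :=
  (g.a * (H.T g.v g.v - g.u) - star (H.N g.v),
    H.crossSharp g.v - star g.a • H.sharp g.v - (H.T g.v g.v - star g.u) • g.v)

/-- The component of degree `0` of the image of the element `s` of degree `-2`. -/
def adjZero (s : QuadExt R α) (c : QuadExt R α × J) : QuadExt R α × J :=
  (s * (g.u + g.a * star g.a - H.T g.v g.v) * c.1 - s * H.T (g.a • g.v - H.sharp g.v) c.2,
    s • (H.D g.v g.v c.2 - star g.u • c.2 - star c.1 • (g.a • g.v - H.sharp g.v))
      - star s • H.cross (g.a • g.v - H.sharp g.v) c.2)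

variable (k l : QuadExt R α)

/-- In this and the following lemmas k and l enter only through k l̄ - l k̄, which is the bracket
[k₋₁, l₋₁]. Hence the bracket of the images is a well-defined function of an element of degree -2.
-/
theorem lie_expNeg_K_x : ⁅g.expNeg (k, 0), g.expNeg (l, 0)⁆.x =
    (k * star l - l * star k) • g.adj := by
  have hu := g.star_u
  rw [LieAlg.lie_x]
  simp only [expNeg_s, expNeg_x, expNeg_f, expNeg_y]
  ext1
  · simp only [Q_fst, Q_snd, cubic_coe, V_formula, Prod.fst_add, Prod.fst_sub, Prod.smul_fst, D, x,
      map_add, map_sub, LinearMap.add_apply, LinearMap.sub_apply, H.T_smul_left, H.T_smul_right,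
      star_add, star_sub, star_mul', star_neg, star_star, H.star_T, star_ofNat, star_pow, map_zero,
      LinearMap.zero_apply, star_zero, H.cross_smul_left, H.cross_smul_right, adj, N_self_coeff,
      smul_eq_mul, hu, cross_self, cross_self_sharp, smul_zero]
    ring_nf
  · simp only [Q_fst, Q_snd, cubic_coe, V_formula, Prod.snd_add, Prod.snd_sub, Prod.smul_snd, D, x,
      map_add, map_sub, LinearMap.add_apply, LinearMap.sub_apply, H.T_smul_left, H.T_smul_right,
      star_add, star_sub, star_mul', star_neg, star_star, H.star_T, star_ofNat, star_pow, map_zero,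
      LinearMap.zero_apply, star_zero, H.cross_smul_left, H.cross_smul_right, adj, N_self_coeff,
      smul_eq_mul, hu, cross_self, cross_self_sharp, smul_zero, zero_smul, add_zero, zero_add,
      mul_zero, zero_mul]
    match_scalars <;> ring_nf

theorem lie_expNeg_K_f (c : QuadExt R α × J) : ⁅g.expNeg (k, 0), g.expNeg (l, 0)⁆.f c =
    g.adjZero (k * star l - l * star k) c := by
  have hu := g.star_u
  rw [LieAlg.lie_f]
  simp only [expNeg_s, expNeg_x, expNeg_f, expNeg_y, expNeg_r, LinearMap.add_apply,
    LinearMap.sub_apply, Module.End.mul_apply, ZeroMemClass.coe_zero, mul_zero, lsmul_apply,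
    zero_smul]
  ext1
  · simp only [Q_fst, Q_snd, cubic_coe, V_formula, Prod.fst_add, Prod.fst_sub, Prod.smul_fst, D, x,
      map_add, map_sub, LinearMap.add_apply, LinearMap.sub_apply, H.T_smul_left, H.T_smul_right,
      star_add, star_sub, star_mul', star_neg, star_star, H.star_T, star_ofNat, star_pow, map_zero,
      LinearMap.zero_apply, star_zero, H.cross_smul_left, H.cross_smul_right, adjZero, N_self_coeff,
      smul_eq_mul, hu, cross_self, cross_self_sharp, smul_zero, zero_smul, add_zero, zero_add,
      mul_zero, zero_mul, T_self_cross, T_cross_self, Prod.fst_zero, sub_zero]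
    ring_nf
  · simp only [Q_fst, Q_snd, cubic_coe, V_formula, Prod.snd_add, Prod.snd_sub, Prod.smul_snd, D, x,
      map_add, map_sub, LinearMap.add_apply, LinearMap.sub_apply, H.T_smul_left, H.T_smul_right,
      star_add, star_sub, star_mul', star_neg, star_star, H.star_T, star_ofNat, star_pow, map_zero,
      LinearMap.zero_apply, star_zero, H.cross_smul_left, H.cross_smul_right, adjZero, N_self_coeff,
      smul_eq_mul, hu, cross_self, cross_self_sharp, smul_zero, zero_smul, add_zero, zero_add,
      mul_zero, zero_mul, Prod.snd_zero, sub_zero, H.cross_comm g.v (H.cross _ _)]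
    match_scalars <;> ring_nf

/-- Here the quartic norm enters: it is the matrix coefficient of exp_+ from degree -2 to degree 2.
-/
theorem lie_expNeg_K_s : (⁅g.expNeg (k, 0), g.expNeg (l, 0)⁆.s : QuadExt R α) =
    (k * star l - l * star k) * algebraMap R _ g.quarticNorm := by
  have hu := g.star_u
  rw [LieAlg.lie_s, algebraMap_quarticNorm]
  simp only [expNeg_s, expNeg_x, expNeg_f, expNeg_y, smul_eq, H.chi_V]
  simp only [psi_coe, Q_fst, Q_snd, cubic_coe, V_formula, Prod.fst_add, Prod.fst_sub,
      Prod.smul_fst, D, x,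
      map_add, map_sub, LinearMap.add_apply, LinearMap.sub_apply, H.T_smul_left, H.T_smul_right,
      star_add, star_sub, star_mul', star_neg, star_star, H.star_T, star_ofNat, star_pow, map_zero,
      LinearMap.zero_apply, star_zero, H.cross_smul_left, H.cross_smul_right, N_self_coeff,
      T_sharp_self,
      smul_eq_mul, hu, cross_self, cross_self_sharp, smul_zero, zero_smul, add_zero, zero_add,
      mul_zero, zero_mul, T_self_cross, T_cross_self, Prod.fst_zero, sub_zero]
  ring_nf

theorem lie_expNeg_K_y : ⁅g.expNeg (k, 0), g.expNeg (l, 0)⁆.y =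
    (k * star l - l * star k) • g.x := by
  rw [LieAlg.lie_y]
  simp only [expNeg_s, expNeg_x, expNeg_g, expNeg_y, expNeg_r, ZeroMemClass.coe_zero, zero_smul,
    LinearMap.neg_apply]
  have h := H.psi_smul (k, 0) (l, 0) g.x
  simp only [psi_coe, map_zero, add_zero, LinearMap.zero_apply] at h
  rw [h]
  abel

theorem lie_expNeg_K_r : (⁅g.expNeg (k, 0), g.expNeg (l, 0)⁆.r : QuadExt R α) =
    k * star l - l * star k := by
  rw [LieAlg.lie_r]
  simp only [expNeg_y, expNeg_r, ZeroMemClass.coe_zero, psi_coe, map_zero, smul_zero, sub_zero,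
    add_zero, LinearMap.zero_apply]

/-- Needed because degrees -1 and -2 commute. As before, only the top components are computed
directly, and `lie_expNeg_lowest` deduces the rest. -/
theorem lie_expNeg_K_K_x (m : QuadExt R α) :
    ⁅g.expNeg (m, 0), ⁅g.expNeg (k, 0), g.expNeg (l, 0)⁆⁆.x = 0 := by
  have hu := g.star_u
  have hs : star (k * star l - l * star k) = -(k * star l - l * star k) := by
    simp only [star_sub, star_mul', star_star]; ring
  rw [LieAlg.lie_x, lie_expNeg_K_x, lie_expNeg_K_y, lie_expNeg_K_f, lie_expNeg_K_s,
    algebraMap_quarticNorm]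
  -- Of the bracket value only s̄ = -s matters from here on.
  generalize k * star l - l * star k = s at *
  simp only [expNeg_s, expNeg_x, expNeg_f, expNeg_y]
  ext1
  · simp only [Q_fst, Q_snd, cubic_coe, V_formula, Prod.fst_add, Prod.fst_sub, Prod.smul_fst, D_add,
      D_smul, D_self_self, D_self_sharp_arg, x, Prod.smul_snd, T_crossSharp, T_crossSharp',
      T_sharp_crossSharp, T_sharp_crossSharp', cross_crossSharp, cross_sharp_self,
      map_add, map_sub, LinearMap.add_apply, LinearMap.sub_apply, H.T_smul_left, H.T_smul_right,
      star_add, star_sub, star_mul', star_neg, star_star, H.star_T, star_ofNat, star_pow, map_zero,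
      LinearMap.zero_apply, star_zero, H.cross_smul_left, H.cross_smul_right, adjZero, N_self_coeff,
      T_sharp_self, hs, adj,
      smul_eq_mul, hu, cross_self, cross_self_sharp, smul_zero, zero_smul, add_zero, zero_add,
      mul_zero, zero_mul, T_self_cross, T_cross_self, Prod.fst_zero, sub_zero]
    ring_nf
  · have hD : ∀ z : J, H.D (0 : J) g.v z = 0 ∧ H.D g.v (0 : J) z = 0 := by
      intro z; simp [D]
    simp only [Q_fst, Q_snd, cubic_coe, V_formula, Prod.snd_add, Prod.snd_sub, Prod.smul_snd, D_add,
      D_smul, D_self_self, D_self_sharp_arg, x, Prod.smul_fst, T_crossSharp, T_crossSharp',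
      T_sharp_crossSharp, T_sharp_crossSharp', cross_crossSharp, cross_sharp_self, hD,
      map_add, map_sub, LinearMap.add_apply, LinearMap.sub_apply, H.T_smul_left, H.T_smul_right,
      star_add, star_sub, star_mul', star_neg, star_star, H.star_T, star_ofNat, star_pow, map_zero,
      LinearMap.zero_apply, star_zero, H.cross_smul_left, H.cross_smul_right, adjZero, N_self_coeff,
      T_sharp_self, hs, adj, H.sharp_sharp',
      smul_eq_mul, hu, cross_self, cross_self_sharp, smul_zero, zero_smul, add_zero, zero_add,
      mul_zero, zero_mul, T_self_cross, T_cross_self, Prod.snd_zero, sub_zero]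
    match_scalars <;> ring_nf

theorem lie_expNeg_K_K_s (m : QuadExt R α) :
    (⁅g.expNeg (m, 0), ⁅g.expNeg (k, 0), g.expNeg (l, 0)⁆⁆.s : QuadExt R α) = 0 := by
  have hu := g.star_u
  have hs : star (k * star l - l * star k) = -(k * star l - l * star k) := by
    simp only [star_sub, star_mul', star_star]; ring
  rw [LieAlg.lie_s, smul_eq, smul_eq, algebraMap_chi ⁅g.expNeg (k, 0), g.expNeg (l, 0)⁆.f,
      lie_expNeg_K_f, lie_expNeg_K_s,
    algebraMap_quarticNorm, lie_expNeg_K_x]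
  generalize k * star l - l * star k = s at *
  simp only [expNeg_s, expNeg_x, expNeg_f, expNeg_y, H.chi_V, psi_coe]
  simp only [Q_fst, Q_snd, cubic_coe, Prod.fst_add, Prod.fst_sub, Prod.smul_fst, D_add,
      x, Prod.smul_snd, T_crossSharp, T_crossSharp',
      T_sharp_crossSharp, T_sharp_crossSharp', cross_crossSharp, cross_sharp_self,
      map_add, map_sub, LinearMap.add_apply, LinearMap.sub_apply, H.T_smul_left, H.T_smul_right,
      star_add, star_sub, star_mul', star_neg, star_star, H.star_T, star_ofNat, star_pow, map_zero,
      LinearMap.zero_apply, star_zero, H.cross_smul_left, H.cross_smul_right, adjZero, N_self_coeff,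
      T_sharp_self, hs, adj, star_one, mul_one,
      smul_eq_mul, hu, cross_self, cross_self_sharp, smul_zero, zero_smul, add_zero, zero_add,
      mul_zero, zero_mul, T_self_cross, T_cross_self, Prod.fst_zero, sub_zero]
  ring_nf

end G

end Generic

end HermitianCubicNormStructure

/-! ### Generation of the Lie algebra by its components of degrees 1 and -1. -/

namespace HermitianCubicNormStructure

section Generic

variable {R : Type u} [CommRing R] {α : R} {J : Type v} [AddCommGroup J] [Module (QuadExt R α) J]
  [Module R J] [IsScalarTower R (QuadExt R α) J] {H : HermitianCubicNormStructure R α J}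

theorem skew_gen_sq : (QuadraticAlgebra.omega - star QuadraticAlgebra.omega : QuadExt R α) ^ 2 =
    algebraMap R _ (1 - 4 * α) := by
  rw [QuadraticAlgebra.algebraMap_eq, pow_two]
  ext <;> simp <;> ring

theorem isUnit_skew_gen (H : HermitianCubicNormStructure R α J) :
    IsUnit (QuadraticAlgebra.omega - star QuadraticAlgebra.omega : QuadExt R α) := by
  have h : IsUnit ((QuadraticAlgebra.omega - star QuadraticAlgebra.omega : QuadExt R α) ^ 2) := by
    rw [skew_gen_sq]
    exact H.isUnit_disc.map _
  exact (isUnit_pow_iff two_ne_zero).1 h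

/-- The coordinate with respect to the generator `t - t̄` of `R (t - t̄)`. -/
def skewCoord : QuadExt.skew R α →ₗ[R] R where
  toFun r := -(r : QuadExt R α).re
  map_add' r r' := by simp; ring
  map_smul' a r := by simp

/-- The generator `t - t̄` of `R (t - t̄)`. -/
def skewGen : QuadExt.skew R α :=
  ⟨QuadraticAlgebra.omega - star QuadraticAlgebra.omega, QuadExt.sub_star_mem_skew _⟩

theorem skewCoord_smul (r : QuadExt.skew R α) : skewCoord r • skewGen = r := by
  obtain ⟨r, hr⟩ := r
  obtain ⟨a, rfl⟩ := Submodule.mem_span_singleton.1 hr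
  apply Subtype.ext
  simp [skewCoord, skewGen]

theorem skewCoord_gen : skewCoord (skewGen : QuadExt.skew R α) = 1 := by
  simp [skewCoord, skewGen]

/-- Testing e = 1 and e = t on the element 1 suffices: the first kills the J-component, and a
combination of both gives (t - t̄)k = 0, where t - t̄ is a unit because 1 - 4α is. -/
theorem V_eq_zero {z : QuadExt R α × J} (hz : ∀ e, H.V e z = 0) : z = 0 := by
  obtain ⟨k, z⟩ := z
  have h1 := LinearMap.congr_fun (hz (1, 0)) (1, 0)
  have h2 := LinearMap.congr_fun (hz (QuadraticAlgebra.omega, 0)) (1, 0)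
  rw [V_formula] at h1 h2
  have h3 := congrArg Prod.snd h1
  have h4 := congrArg Prod.fst h1
  have h5 := congrArg Prod.fst h2
  simp only [map_zero, LinearMap.zero_apply, smul_zero, star_one, one_mul, mul_one, add_zero, D,
    Prod.snd_zero, Prod.fst_zero, sub_zero, zero_smul, one_smul, zero_sub, neg_eq_zero,
    sub_self] at h3 h4 h5
  have h6 : (QuadraticAlgebra.omega - star QuadraticAlgebra.omega : QuadExt R α) * k = 0 := by
    linear_combination -h5 + QuadraticAlgebra.omega * h4
  rw [(isUnit_skew_gen H).mul_right_eq_zero] at h6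
  rw [h6, h3]; rfl

namespace LieAlg

theorem ext_of_f {X Y : H.LieAlg} (hs : (X.s : QuadExt R α) = Y.s) (hx : X.x = Y.x)
    (hf : X.f = Y.f) (hy : X.y = Y.y) (hr : (X.r : QuadExt R α) = Y.r) : X = Y :=
  LieAlg.ext hs hx hf (congrArg Prod.snd (inner_ext X.p.2 Y.p.2 hf)) hy hr

variable (H) in
/-- The embedding of the inner structure algebra as the component of degree `0`. -/
def zero (p : H.inner) : H.LieAlg := mk 0 0 p 0 0

variable (H) in
/-- The embedding of `R (t - t̄)` as the component of degree `-2`. -/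
def negTwo (r : QuadExt.skew R α) : H.LieAlg := mk 0 0 0 0 r

theorem neg_s (X : H.LieAlg) : (-X).s = -X.s := rfl
theorem neg_x (X : H.LieAlg) : (-X).x = -X.x := rfl
theorem neg_f (X : H.LieAlg) : (-X).f = -X.f := rfl
theorem neg_y (X : H.LieAlg) : (-X).y = -X.y := rfl
theorem neg_r (X : H.LieAlg) : (-X).r = -X.r := rfl
theorem zero_s : (0 : H.LieAlg).s = 0 := rfl
theorem zero_x : (0 : H.LieAlg).x = 0 := rfl
theorem zero_f : (0 : H.LieAlg).f = 0 := rfl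

theorem eq_sum (X : H.LieAlg) :
    X = two H X.s + one H X.x + zero H X.p + negOne H X.y + negTwo H X.r := by
  apply LieAlg.ext_of_f <;>
    simp [add_s, add_x, add_f, add_y, add_r, two, one, zero, negOne, negTwo, mk_s, mk_x, mk_f,
      mk_y, mk_r] <;> rfl

theorem zero_map_add (p q : H.inner) : zero H (p + q) = zero H p + zero H q := by
  apply LieAlg.ext_of_f <;>
    simp [add_s, add_x, add_f, add_y, add_r, zero, mk_s, mk_x, mk_f, mk_y, mk_r]

theorem zero_map_smul (a : R) (p : H.inner) : zero H (a • p) = a • zero H p := by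
  apply LieAlg.ext_of_f <;>
    simp [smul_s, smul_x, smul_f, smul_y, smul_r, zero, mk_s, mk_x, mk_f, mk_y, mk_r]

theorem lie_one_negOne (a b : QuadExt R α × J) :
    ⁅one H a, negOne H b⁆ = zero H ⟨_, H.V_mem a b⟩ := by
  apply LieAlg.ext_of_f <;>
    simp [lie_s, lie_x, lie_f, lie_y, lie_r, two, one, zero, negOne, negTwo, mk_s, mk_x, mk_f,
      mk_y, mk_r, mk_g, psi_coe, chi, lsmul]

theorem lie_one_one (a b : QuadExt R α × J) : ⁅one H a, one H b⁆ = two H (H.psi a b) := by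
  apply LieAlg.ext_of_f <;>
    simp [lie_s, lie_x, lie_f, lie_y, lie_r, two, one, zero, negOne, negTwo, mk_s, mk_x, mk_f,
      mk_y, mk_r, mk_g, psi_coe, chi, lsmul]

theorem lie_negOne_negOne (a b : QuadExt R α × J) :
    ⁅negOne H a, negOne H b⁆ = negTwo H (H.psi a b) := by
  apply LieAlg.ext_of_f <;>
    simp [lie_s, lie_x, lie_f, lie_y, lie_r, two, one, zero, negOne, negTwo, mk_s, mk_x, mk_f,
      mk_y, mk_r, mk_g, psi_coe, chi, lsmul]

theorem lie_zero_negOne (p : H.inner) (c : QuadExt R α × J) :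
    ⁅zero H p, negOne H c⁆ = negOne H (p.1.2 c) := by
  apply LieAlg.ext_of_f <;>
    simp [lie_s, lie_x, lie_f, lie_y, lie_r, two, one, zero, negOne, negTwo, mk_s, mk_x, mk_f,
      mk_y, mk_r, mk_g, psi_coe, chi, lsmul]

theorem lie_one_negTwo (a : QuadExt R α × J) (r : QuadExt.skew R α) :
    ⁅one H a, negTwo H r⁆ = negOne H ((r : QuadExt R α) • a) := by
  apply LieAlg.ext_of_f <;>
    simp [lie_s, lie_x, lie_f, lie_y, lie_r, two, one, zero, negOne, negTwo, mk_s, mk_x, mk_f,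
      mk_y, mk_r, mk_g, psi_coe, chi, lsmul]

theorem lie_negOne_negTwo (a : QuadExt R α × J) (r : QuadExt.skew R α) :
    ⁅negOne H a, negTwo H r⁆ = 0 := by
  apply LieAlg.ext_of_f <;>
    simp [lie_s, lie_x, lie_f, lie_y, lie_r, two, one, zero, negOne, negTwo, mk_s, mk_x, mk_f,
      mk_y, mk_r, mk_g, psi_coe, chi, lsmul] <;> rfl

theorem psi_omega_one : H.psi (QuadraticAlgebra.omega, 0) (1, 0) = skewGen := by
  apply Subtype.ext
  simp [psi_coe, skewGen]

theorem two_eq (s : QuadExt.skew R α) : two H s = skewCoord s •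
    ⁅one H (QuadraticAlgebra.omega, 0), one H (1, 0)⁆ := by
  rw [lie_one_one, psi_omega_one]
  conv_lhs => rw [← skewCoord_smul s]
  apply LieAlg.ext_of_f <;> simp [smul_s, smul_x, smul_f, smul_y, smul_r, two, mk_s, mk_x, mk_f,
      mk_y, mk_r]

theorem negTwo_eq (s : QuadExt.skew R α) : negTwo H s = skewCoord s •
    ⁅negOne H (QuadraticAlgebra.omega, 0), negOne H (1, 0)⁆ := by
  rw [lie_negOne_negOne, psi_omega_one]
  conv_lhs => rw [← skewCoord_smul s]
  apply LieAlg.ext_of_f <;> simp [smul_s, smul_x, smul_f, smul_y, smul_r, negTwo, mk_s, mk_x,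
      mk_f, mk_y, mk_r]

/-- The Lie algebra is generated by its components of degrees `1` and `-1`. -/
theorem eq_top_of_one_mem {S : LieSubalgebra R H.LieAlg} (h1 : ∀ e, one H e ∈ S)
    (h2 : ∀ c, negOne H c ∈ S) : S = ⊤ := by
  rw [eq_top_iff]
  intro X _
  rw [eq_sum X, two_eq, negTwo_eq]
  refine add_mem (add_mem (add_mem (add_mem ?_ (h1 _)) ?_) (h2 _)) ?_
  · exact S.smul_mem _ (S.lie_mem (h1 _) (h1 _))
  · obtain ⟨p, hp⟩ := X.p
    induction hp using Submodule.span_induction with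
    | mem p h =>
      obtain ⟨a, b, rfl⟩ := h
      rw [← lie_one_negOne]
      exact S.lie_mem (h1 _) (h2 _)
    | zero => exact S.zero_mem
    | add p q hp hq h h' => exact (zero_map_add (H := H) ⟨p, hp⟩ ⟨q, hq⟩) ▸ S.add_mem h h'
    | smul r p hp h => exact (zero_map_smul (H := H) r ⟨p, hp⟩) ▸ S.smul_mem r h
  · exact S.smul_mem _ (S.lie_mem (h2 _) (h2 _))

end LieAlg

end Generic

end HermitianCubicNormStructure

/-! ### Construction of exp_+ and its compatibility with all brackets. -/

namespace HermitianCubicNormStructure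

section Generic

variable {R : Type u} [CommRing R] {α : R} {J : Type v} [AddCommGroup J] [Module (QuadExt R α) J]
  [Module R J] [IsScalarTower R (QuadExt R α) J] {H : HermitianCubicNormStructure R α J}

open LieAlg

namespace G

variable (g : H.G)

theorem expNeg_add (c d : QuadExt R α × J) : g.expNeg (c + d) = g.expNeg c + g.expNeg d := by
  apply LieAlg.ext_of_f
  · rw [add_s, expNeg_s, expNeg_s, expNeg_s, cubic_add]
  · rw [add_x, expNeg_x, expNeg_x, expNeg_x, Q_add]
  · rw [add_f, expNeg_f, expNeg_f, expNeg_f, map_add]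
  · rfl
  · simp [add_r, expNeg_r]

/-- The image of the generator of the component of degree `-2` under `exp_+`. -/
def lowest : H.LieAlg := ⁅g.expNeg (QuadraticAlgebra.omega, 0), g.expNeg (1, 0)⁆

theorem gen_eq : (QuadraticAlgebra.omega * star 1 - 1 * star QuadraticAlgebra.omega :
    QuadExt R α) = (skewGen : QuadExt.skew R α) := by
  simp [skewGen]

theorem lowest_x : g.lowest.x = ((skewGen : QuadExt.skew R α) : QuadExt R α) • g.adj := by
  rw [lowest, lie_expNeg_K_x, gen_eq]

theorem lowest_f (c : QuadExt R α × J) :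
    g.lowest.f c = g.adjZero (skewGen : QuadExt.skew R α) c := by
  rw [lowest, lie_expNeg_K_f, gen_eq]

theorem lowest_s : (g.lowest.s : QuadExt R α) =
    (skewGen : QuadExt.skew R α) * algebraMap R _ g.quarticNorm := by
  rw [lowest, lie_expNeg_K_s, gen_eq]

theorem lowest_y : g.lowest.y = ((skewGen : QuadExt.skew R α) : QuadExt R α) • g.x := by
  rw [lowest, lie_expNeg_K_y, gen_eq]

theorem lowest_r : g.lowest.r = skewGen := by
  apply Subtype.ext
  rw [lowest, lie_expNeg_K_r, gen_eq]

/-- The component of degree `2` of `exp_+`. -/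
def exp₂ : Module.End R H.LieAlg where
  toFun X := LieAlg.mk (g.quad X.p) (g.Q X.y) (skewCoord X.r • g.lowest.p) 0 0
  map_add' X Y := by
    apply LieAlg.ext_of_f <;>
      simp [add_s, add_x, add_f, add_y, add_r, mk_s, mk_x, mk_f, mk_y, mk_r, add_p, Q_add, add_smul]
  map_smul' a X := by
    apply LieAlg.ext_of_f <;>
      simp [smul_s, smul_x, smul_f, smul_y, smul_r, mk_s, mk_x, mk_f, mk_y, mk_r, smul_p, Q_smul,
        mul_smul]

/-- The component of degree `3` of `exp_+`. -/
def exp₃ : Module.End R H.LieAlg where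
  toFun X := LieAlg.mk (g.cubic X.y) (skewCoord X.r • g.lowest.x) 0 0 0
  map_add' X Y := by
    apply LieAlg.ext_of_f <;>
      simp [add_s, add_x, add_f, add_y, add_r, mk_s, mk_x, mk_f, mk_y, mk_r, add_p, cubic_add,
        add_smul]
  map_smul' a X := by
    apply LieAlg.ext_of_f <;>
      simp [smul_s, smul_x, smul_f, smul_y, smul_r, mk_s, mk_x, mk_f, mk_y, mk_r, smul_p,
          cubic_smul,
        mul_smul]

/-- The component of degree `4` of `exp_+`. -/
def exp₄ : Module.End R H.LieAlg where
  toFun X := LieAlg.mk (skewCoord X.r • g.lowest.s) 0 0 0 0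
  map_add' X Y := by
    apply LieAlg.ext_of_f <;>
      simp [add_s, add_x, add_f, add_y, add_r, mk_s, mk_x, mk_f, mk_y, mk_r, add_p, add_smul]
  map_smul' a X := by
    apply LieAlg.ext_of_f <;>
      simp [smul_s, smul_x, smul_f, smul_y, smul_r, mk_s, mk_x, mk_f, mk_y, mk_r, smul_p, mul_smul]

/-- The map `exp_+`. -/
def expMap : Module.End R H.LieAlg where
  toFun X := X + ⁅one H g.x, X⁆ + g.exp₂ X + g.exp₃ X + g.exp₄ X
  map_add' X Y := by simp only [map_add, lie_add]; abel
  map_smul' a X := by simp only [map_smul, lie_smul, RingHom.id_apply, smul_add]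

variable (X : H.LieAlg)

theorem expMap_apply : g.expMap X = X + ⁅one H g.x, X⁆ + g.exp₂ X + g.exp₃ X + g.exp₄ X := rfl

attribute [irreducible] expMap

theorem expMap_s : ((g.expMap X).s : QuadExt R α) = X.s + H.psi g.x X.x + g.quadK X.f + g.cubic X.y
    + skewCoord X.r • (g.lowest.s : QuadExt R α) := by
  simp [expMap_apply, add_s, lie_s, exp₂, exp₃, exp₄, one, mk_s, mk_x, mk_f, chi, quad_coe]
  rfl

theorem expMap_x : (g.expMap X).x = X.x - X.f g.x + g.Q X.y + skewCoord X.r • g.lowest.x := by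
  simp [expMap_apply, add_x, lie_x, exp₂, exp₃, exp₄, one, mk_s, mk_x, mk_f, mk_y]
  abel

theorem expMap_f : (g.expMap X).f = X.f + H.V g.x X.y + skewCoord X.r • g.lowest.f := by
  simp [expMap_apply, add_f, lie_f, exp₂, exp₃, exp₄, one, mk_s, mk_x, mk_f, mk_y, mk_r, lsmul]
  rfl

theorem expMap_y : (g.expMap X).y = X.y + (X.r : QuadExt R α) • g.x := by
  simp [expMap_apply, add_y, lie_y, exp₂, exp₃, exp₄, one, mk_s, mk_x, mk_f, mk_y, mk_r, mk_g]

theorem expMap_r : (g.expMap X).r = X.r := by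
  apply Subtype.ext
  simp [expMap_apply, add_r, lie_r, exp₂, exp₃, exp₄, one, mk_s, mk_x, mk_f, mk_y, mk_r, mk_g, chi,
    psi_coe]

theorem expMap_negOne (c : QuadExt R α × J) : g.expMap (negOne H c) = g.expNeg c := by
  apply LieAlg.ext_of_f
  · rw [expMap_s, expNeg_s]
    simp [negOne, mk_s, mk_x, mk_f, mk_y, mk_r, psi_coe, quadK]
  · rw [expMap_x, expNeg_x]
    simp [negOne, mk_s, mk_x, mk_f, mk_y, mk_r]
  · rw [expMap_f, expNeg_f]
    simp [negOne, mk_s, mk_x, mk_f, mk_y, mk_r]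
  · rw [expMap_y, expNeg_y]
    simp [negOne, mk_s, mk_x, mk_f, mk_y, mk_r]
  · rw [expMap_r, expNeg_r]
    simp [negOne, mk_s, mk_x, mk_f, mk_y, mk_r]

theorem expMap_negTwo (r : QuadExt.skew R α) : g.expMap (negTwo H r) = skewCoord r • g.lowest := by
  apply LieAlg.ext_of_f
  · rw [expMap_s]
    simp [negTwo, mk_s, mk_x, mk_f, mk_y, mk_r, psi_coe, quadK, smul_s, cubic_coe]
  · rw [expMap_x]
    simp [negTwo, mk_s, mk_x, mk_f, mk_y, mk_r, smul_x]
    ext1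
    · simp [Q_fst]
    · simp [Q_snd]
  · rw [expMap_f]
    simp [negTwo, mk_s, mk_x, mk_f, mk_y, mk_r, smul_f]
  · rw [expMap_y]
    simp only [negTwo, mk_s, mk_x, mk_f, mk_y, mk_r, smul_y, lowest_y]
    conv_lhs => rw [← skewCoord_smul r]
    simp
  · rw [expMap_r]
    simp [negTwo, mk_s, mk_x, mk_f, mk_y, mk_r, smul_r, lowest_r, ← Submodule.coe_smul,
        skewCoord_smul]

theorem expMap_one (e : QuadExt R α × J) :
    g.expMap (one H e) = LieAlg.mk (H.psi g.x e) e 0 0 0 := by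
  apply LieAlg.ext_of_f
  · rw [expMap_s]
    simp [one, mk_s, mk_x, mk_f, mk_y, mk_r, quadK, cubic_coe]
  · rw [expMap_x]
    simp [one, mk_s, mk_x, mk_f, mk_y, mk_r]
    ext1
    · simp [Q_fst]
    · simp [Q_snd]
  · rw [expMap_f]
    simp [one, mk_s, mk_x, mk_f, mk_y, mk_r]
  · rw [expMap_y]
    simp [one, mk_s, mk_x, mk_f, mk_y, mk_r]
  · rw [expMap_r]
    simp [one, mk_s, mk_x, mk_f, mk_y, mk_r]

theorem expMap_zero (p : H.inner) :
    g.expMap (zero H p) = LieAlg.mk (g.quad p) (-p.1.1 g.x) p 0 0 := by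
  apply LieAlg.ext_of_f
  · rw [expMap_s]
    simp [zero, mk_s, mk_x, mk_f, mk_y, mk_r, quad_coe, cubic_coe, psi_coe]
  · rw [expMap_x]
    simp [zero, mk_s, mk_x, mk_f, mk_y, mk_r]
    ext1
    · simp [Q_fst]
    · simp [Q_snd]
  · rw [expMap_f]
    simp [zero, mk_s, mk_x, mk_f, mk_y, mk_r]
  · rw [expMap_y]
    simp [zero, mk_s, mk_x, mk_f, mk_y, mk_r]
  · rw [expMap_r]
    simp [zero, mk_s, mk_x, mk_f, mk_y, mk_r]

/-- The degree-2 component is `quadK_V`, and the degree-1 component is ψ(x, e)c = V_{e,c} x -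
V_{x,c} e. -/
theorem expMap_lie_one_negOne (e c : QuadExt R α × J) :
    g.expMap ⁅one H e, negOne H c⁆ = ⁅g.expMap (one H e), g.expMap (negOne H c)⁆ := by
  rw [lie_one_negOne, expMap_one, expMap_negOne, expMap_zero]
  apply LieAlg.ext_of_f
  · have h2 := g.quadK_V e c
    rw [lie_s]
    simp only [mk_s, mk_x, mk_f, mk_y, mk_r, expNeg_s, expNeg_x, expNeg_f, expNeg_y, quad_coe,
      smul_eq, h2]
    simp [chi]
  · have h1 := H.psi_smul g.x e c
    rw [lie_x]
    simp only [mk_s, mk_x, mk_f, mk_y, mk_r, expNeg_s, expNeg_x, expNeg_f, expNeg_y, h1]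
    simp
    abel
  · rw [lie_f]
    simp [mk_s, mk_x, mk_f, mk_y, mk_r, expNeg_s, expNeg_x, expNeg_f, expNeg_y, expNeg_r, lsmul]
  · rw [lie_y]
    simp [mk_s, mk_x, mk_f, mk_y, mk_r, mk_g, expNeg_s, expNeg_x, expNeg_f, expNeg_y, expNeg_r]
  · rw [lie_r]
    simp [mk_s, mk_x, mk_f, mk_y, mk_r, mk_g, expNeg_s, expNeg_x, expNeg_f, expNeg_y, expNeg_r,
      psi_coe, chi]

/-- Degrees 2, 1, 0 are `cubic_inner`, `Q_inner` and the commutator formula `comm_V`. -/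
theorem expMap_lie_zero_negOne (p : H.inner) (c : QuadExt R α × J) :
    g.expMap ⁅zero H p, negOne H c⁆ = ⁅g.expMap (zero H p), g.expMap (negOne H c)⁆ := by
  rw [lie_zero_negOne, expMap_zero, expMap_negOne, expMap_negOne]
  apply LieAlg.ext_of_f
  · rw [lie_s]
    simp only [mk_s, mk_x, mk_f, mk_y, mk_r, expNeg_s, expNeg_x, expNeg_f, expNeg_y, quad_coe,
      smul_eq, psi_neg_left, g.cubic_inner p.2]
    ring
  · rw [lie_x]
    simp only [mk_s, mk_x, mk_f, mk_y, mk_r, expNeg_s, expNeg_x, expNeg_f, expNeg_y, quad_coe,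
      g.Q_inner p.2, map_neg]
    simp
  · have := H.comm_V p.2 g.x c
    rw [lie_f]
    simp only [mk_s, mk_x, mk_f, mk_y, mk_r, expNeg_s, expNeg_x, expNeg_f, expNeg_y, expNeg_r,
      this, map_neg, LinearMap.neg_apply]
    simp [lsmul]
  · rw [lie_y]
    simp [mk_s, mk_x, mk_f, mk_y, mk_r, mk_g, expNeg_s, expNeg_x, expNeg_f, expNeg_y, expNeg_r]
  · rw [lie_r]
    simp [mk_s, mk_x, mk_f, mk_y, mk_r, mk_g, expNeg_s, expNeg_x, expNeg_f, expNeg_y, expNeg_r,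
      psi_coe, chi]

theorem expMap_two (s : QuadExt.skew R α) : g.expMap (two H s) = two H s := by
  apply LieAlg.ext_of_f
  · rw [expMap_s]
    simp [two, mk_s, mk_x, mk_f, mk_y, mk_r, quadK, cubic_coe, psi_coe]
  · rw [expMap_x]
    simp [two, mk_s, mk_x, mk_f, mk_y, mk_r]
    ext1
    · simp [Q_fst]
    · simp [Q_snd]
  · rw [expMap_f]
    simp [two, mk_s, mk_x, mk_f, mk_y, mk_r]
  · rw [expMap_y]
    simp [two, mk_s, mk_x, mk_f, mk_y, mk_r]
  · rw [expMap_r]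

theorem expMap_lie_one_one (a b : QuadExt R α × J) :
    g.expMap ⁅one H a, one H b⁆ = ⁅g.expMap (one H a), g.expMap (one H b)⁆ := by
  rw [lie_one_one, expMap_two, expMap_one, expMap_one]
  apply LieAlg.ext_of_f <;>
    simp [lie_s, lie_x, lie_f, lie_y, lie_r, two, mk_s, mk_x, mk_f, mk_y, mk_r, mk_g, chi, lsmul,
      psi_coe]

theorem expMap_lie_one_two (a : QuadExt R α × J) (s : QuadExt.skew R α) :
    g.expMap ⁅one H a, two H s⁆ = ⁅g.expMap (one H a), g.expMap (two H s)⁆ := by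
  have h : ⁅one H a, two H s⁆ = 0 := by
    apply LieAlg.ext_of_f <;>
    simp [lie_s, lie_x, lie_f, lie_y, lie_r, one, two, mk_s, mk_x, mk_f, mk_y, mk_r, mk_g, chi,
      lsmul, psi_coe] <;> rfl
  rw [h, map_zero, expMap_two, expMap_one]
  apply LieAlg.ext_of_f <;>
    simp [lie_s, lie_x, lie_f, lie_y, lie_r, two, mk_s, mk_x, mk_f, mk_y, mk_r, mk_g, chi, lsmul,
      psi_coe] <;> rfl

theorem expMap_lie_one_zero (a : QuadExt R α × J) (p : H.inner) :
    g.expMap ⁅one H a, zero H p⁆ = ⁅g.expMap (one H a), g.expMap (zero H p)⁆ := by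
  have h : ⁅one H a, zero H p⁆ = one H (-p.1.1 a) := by
    apply LieAlg.ext_of_f <;>
    simp [lie_s, lie_x, lie_f, lie_y, lie_r, one, zero, mk_s, mk_x, mk_f, mk_y, mk_r, mk_g, chi,
      lsmul, psi_coe]
  rw [h, expMap_zero, expMap_one, expMap_one]
  apply LieAlg.ext_of_f
  · have h1 := psi_inner H p.2 g.x a
    rw [psi_swap] at h1
    rw [lie_s]
    simp only [mk_s, mk_x, mk_f, psi_neg_right, smul_eq]
    simp [chi] at h1 ⊢
    linear_combination -h1
  all_goals
    simp [lie_s, lie_x, lie_f, lie_y, lie_r, mk_s, mk_x, mk_f, mk_y, mk_r, mk_g, chi, lsmul,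
      psi_coe]

variable {g} in
/-- A form of the Leibniz rule for the compatibility of `exp_+` with brackets. -/
theorem expMap_lie_lie {X Y Z : H.LieAlg} (h1 : g.expMap ⁅X, Y⁆ = ⁅g.expMap X, g.expMap Y⁆)
    (h2 : g.expMap ⁅X, Z⁆ = ⁅g.expMap X, g.expMap Z⁆)
    (h3 : g.expMap ⁅⁅X, Y⁆, Z⁆ = ⁅g.expMap ⁅X, Y⁆, g.expMap Z⁆)
    (h4 : g.expMap ⁅Y, ⁅X, Z⁆⁆ = ⁅g.expMap Y, g.expMap ⁅X, Z⁆⁆) :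
    g.expMap ⁅X, ⁅Y, Z⁆⁆ = ⁅g.expMap X, ⁅g.expMap Y, g.expMap Z⁆⁆ := by
  rw [leibniz_lie, map_add, h3, h4, h1, h2, ← leibniz_lie]

variable {g} in
theorem expMap_lie_symm {X Y : H.LieAlg} (h : g.expMap ⁅X, Y⁆ = ⁅g.expMap X, g.expMap Y⁆) :
    g.expMap ⁅Y, X⁆ = ⁅g.expMap Y, g.expMap X⁆ := by
  rw [← lie_skew, map_neg, h, lie_skew]

theorem expMap_negTwo_eq (r : QuadExt.skew R α) : g.expMap (negTwo H r) =
    skewCoord r • ⁅g.expNeg (QuadraticAlgebra.omega, 0), g.expNeg (1, 0)⁆ :=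
  g.expMap_negTwo r

theorem expMap_lie_one (e : QuadExt R α × J) (X : H.LieAlg) :
    g.expMap ⁅one H e, X⁆ = ⁅g.expMap (one H e), g.expMap X⁆ := by
  rw [eq_sum X]
  simp only [lie_add, map_add, expMap_lie_one_two, expMap_lie_one_one, expMap_lie_one_zero,
    expMap_lie_one_negOne]
  congr 1
  -- An element of degree -2 is a multiple of [t₋₁, 1₋₁], and exp_+ is defined on it by the bracket
  -- of the images. The Leibniz rule reduces the claim to brackets with degrees 1 and 0.
  rw [expMap_negTwo_eq, negTwo_eq, lie_smul, lie_smul, map_smul, ← expMap_negOne, ← expMap_negOne]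
  congr 1
  apply expMap_lie_lie
  · exact g.expMap_lie_one_negOne _ _
  · exact g.expMap_lie_one_negOne _ _
  · rw [lie_one_negOne]
    exact g.expMap_lie_zero_negOne _ _
  · rw [lie_one_negOne]
    exact expMap_lie_symm (g.expMap_lie_zero_negOne _ _)

theorem lie_expNeg_y (c d : QuadExt R α × J) :
    ⁅g.expNeg c, g.expNeg d⁆.y = (H.psi c d : QuadExt R α) • g.x := by
  rw [LieAlg.lie_y]
  simp only [expNeg_s, expNeg_x, expNeg_g, expNeg_y, expNeg_r, ZeroMemClass.coe_zero, zero_smul,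
    LinearMap.neg_apply, H.psi_smul]
  abel

theorem lie_expNeg_r (c d : QuadExt R α × J) : ⁅g.expNeg c, g.expNeg d⁆.r = H.psi c d := by
  apply Subtype.ext
  rw [LieAlg.lie_r]
  simp only [expNeg_y, expNeg_r, ZeroMemClass.coe_zero, smul_zero, sub_zero, add_zero]

theorem psi_J_K (w : J) (k : QuadExt R α) : H.psi (0, w) (k, 0) = 0 := by
  apply Subtype.ext
  simp [psi_coe]

/-- Components of degrees 2 and 1 vanish by calculation, those of degrees -1 and -2 because ψ
vanishes between J and K. For the degree-0 component f, bracket with the image of e₁: the result is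
0 by the Leibniz rule, and its degree-1 component is -f(e). -/
theorem lie_expNeg_J_K (w : J) (k : QuadExt R α) : ⁅g.expNeg (0, w), g.expNeg (k, 0)⁆ = 0 := by
  have hy : ⁅g.expNeg (0, w), g.expNeg (k, 0)⁆.y = 0 := by
    rw [lie_expNeg_y, psi_J_K]; simp
  have hr : ⁅g.expNeg (0, w), g.expNeg (k, 0)⁆.r = 0 := by
    rw [lie_expNeg_r, psi_J_K]
  apply LieAlg.ext_of_f
  · rw [lie_expNeg_s]; rfl
  · rw [lie_expNeg_x]; rfl
  · refine LinearMap.ext fun e => ?_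
    have h : ⁅g.expMap (one H e), ⁅g.expNeg (0, w), g.expNeg (k, 0)⁆⁆ = 0 := by
      rw [← expMap_negOne, ← expMap_negOne, ← expMap_lie_lie, lie_negOne_negOne, psi_J_K]
      · rw [lie_one_negTwo]
        have : negOne H (((0 : QuadExt.skew R α) : QuadExt R α) • e) = 0 := by
          rw [ZeroMemClass.coe_zero, zero_smul]; rfl
        rw [this, map_zero]
      · exact g.expMap_lie_one _ _
      · exact g.expMap_lie_one _ _
      · rw [lie_one_negOne]
        exact g.expMap_lie_zero_negOne _ _
      · rw [lie_one_negOne]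
        exact expMap_lie_symm (g.expMap_lie_zero_negOne _ _)
    have h2 := congrArg LieAlg.x h
    rw [lie_x, hy, expMap_one] at h2
    simpa [mk_s, mk_x, mk_f, mk_y, zero_f, zero_x] using h2
  · rw [hy]; rfl
  · rw [hr]; rfl

theorem lie_expNeg_K_K (k l : QuadExt R α) : ⁅g.expNeg (k, 0), g.expNeg (l, 0)⁆ =
    skewCoord (H.psi (k, 0) (l, 0)) • g.lowest := by
  have h : (k * star l - l * star k : QuadExt R α) =
      skewCoord (H.psi (k, 0) (l, 0)) • ((skewGen : QuadExt.skew R α) : QuadExt R α) := by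
    rw [← Submodule.coe_smul, skewCoord_smul]
    simp [psi_coe]
  apply LieAlg.ext_of_f
  · rw [smul_s, Submodule.coe_smul, lie_expNeg_K_s, lowest_s, h, smul_mul_assoc]
  · rw [smul_x, lie_expNeg_K_x, lowest_x, h, smul_assoc]
  · refine LinearMap.ext fun c => ?_
    rw [smul_f, LinearMap.smul_apply, lie_expNeg_K_f, lowest_f, h]
    ext1
    · simp [adjZero, smul_sub]
    · simp [adjZero, smul_sub, star_smul']
  · rw [smul_y, lie_expNeg_K_y, lowest_y, h, smul_assoc]
  · rw [smul_r, lie_expNeg_K_r, lowest_r, Submodule.coe_smul, h]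

/-- Apply an inner transformation to the known relation [1, d] = 0 between the images of K and J.
Choosing it so that 1 goes to w, the Leibniz rule expresses the bracket of w and d by one inside K,
up to brackets between K and J, which vanish. -/
theorem lie_expNeg_J_J (w d : J) : ⁅g.expNeg (0, w), g.expNeg (0, d)⁆ =
    ⁅g.expNeg (H.T w d, 0), g.expNeg (1, 0)⁆ := by
  -- On degree -1 this transformation sends 1 to w and d to T(w,d) + w × d.
  let p : H.inner := ⟨_, H.V_mem (1, 0) (0, w)⟩
  have hp : ∀ c, p.1.2 c = (H.T w c.2, star c.1 • w + H.cross w c.2) := by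
    intro c
    have : p.1.2 c = -H.V (0, w) (1, 0) c := rfl
    rw [this, V_formula]
    ext1 <;> simp [D]
    abel
  have h : ⁅g.expMap (zero H p), ⁅g.expNeg (1, 0), g.expNeg (0, d)⁆⁆ = 0 := by
    rw [← lie_skew (g.expNeg (1, 0)), lie_expNeg_J_K, neg_zero, lie_zero]
  rw [leibniz_lie, ← expMap_negOne, ← expMap_negOne, ← expMap_lie_zero_negOne,
    ← expMap_lie_zero_negOne, lie_zero_negOne, lie_zero_negOne, hp, hp] at h
  simp only [expMap_negOne, map_zero, star_one, one_smul, add_zero, star_zero, zero_smul,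
    zero_add] at h
  rw [show ((H.T w d, H.cross w d) : QuadExt R α × J) = (H.T w d, 0) + (0, H.cross w d) by simp,
    expNeg_add, lie_add, ← lie_skew (g.expNeg (1, 0)) (g.expNeg (0, H.cross w d)), lie_expNeg_J_K,
    neg_zero, add_zero, ← lie_skew (g.expNeg (1, 0)), ← sub_eq_add_neg, sub_eq_zero] at h
  exact h

theorem lie_expNeg (c d : QuadExt R α × J) : ⁅g.expNeg c, g.expNeg d⁆ =
    skewCoord (H.psi c d) • g.lowest := by
  obtain ⟨k, w⟩ := c
  obtain ⟨l, w'⟩ := d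
  have e1 : ((k, w) : QuadExt R α × J) = (k, 0) + (0, w) := by simp
  have e2 : ((l, w') : QuadExt R α × J) = (l, 0) + (0, w') := by simp
  have h : H.psi (k, w) (l, w') = H.psi (k, 0) (l, 0) + H.psi (H.T w w', 0) (1, 0) := by
    apply Subtype.ext
    simp [psi_coe, H.star_T]
    ring
  rw [h, e1, e2, expNeg_add, expNeg_add, add_lie, lie_add, lie_add, lie_expNeg_J_K,
    lie_expNeg_J_J, ← lie_skew (g.expNeg (k, 0)) (g.expNeg (0, w')), lie_expNeg_J_K, lie_expNeg_K_K,
    lie_expNeg_K_K, map_add, add_smul]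
  simp

theorem expMap_lie_negOne_negOne (c d : QuadExt R α × J) :
    g.expMap ⁅negOne H c, negOne H d⁆ = ⁅g.expMap (negOne H c), g.expMap (negOne H d)⁆ := by
  rw [expMap_negOne, expMap_negOne, lie_expNeg, lie_negOne_negOne, expMap_negTwo]

theorem expMap_lie_zero_negTwo (p : H.inner) (r : QuadExt.skew R α) :
    g.expMap ⁅zero H p, negTwo H r⁆ = ⁅g.expMap (zero H p), g.expMap (negTwo H r)⁆ := by
  rw [negTwo_eq, lie_smul, map_smul, map_smul, lie_smul, expMap_lie_negOne_negOne]
  congr 1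
  apply expMap_lie_lie
  · exact g.expMap_lie_zero_negOne _ _
  · exact g.expMap_lie_zero_negOne _ _
  · rw [lie_zero_negOne]
    exact g.expMap_lie_negOne_negOne _ _
  · rw [lie_zero_negOne]
    exact g.expMap_lie_negOne_negOne _ _

/-- Only brackets of lower complexity are used: [e₁, c₋₁] has degree 0 and [e₁, z₋₂] has degree -1.
The vanishing for every e determines the low components of [exp_+ c₋₁, `lowest`] one after the
other. -/
theorem lie_expMap_one_expNeg_lowest (e c : QuadExt R α × J) :
    ⁅g.expMap (one H e), ⁅g.expNeg c, g.lowest⁆⁆ = 0 := by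
  have hl : g.lowest = g.expMap (negTwo H skewGen) := by
    rw [expMap_negTwo, skewCoord_gen, one_smul]
  rw [hl, ← expMap_negOne, ← expMap_lie_lie, lie_negOne_negTwo, lie_zero, map_zero]
  · exact g.expMap_lie_one _ _
  · exact g.expMap_lie_one _ _
  · rw [lie_one_negOne]
    exact g.expMap_lie_zero_negTwo _ _
  · rw [lie_one_negTwo]
    exact g.expMap_lie_negOne_negOne _ _

theorem lie_expNeg_lowest_r (c : QuadExt R α × J) : ⁅g.expNeg c, g.lowest⁆.r = 0 := by
  apply Subtype.ext
  rw [lie_r, lowest_y, lowest_r, expNeg_y, expNeg_r, expNeg_g, psi_smul_right, smul_eq]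
  simp [chi]

/-- Once the degree -2 component is known to be 0, the degree-0 component of the bracket with the
image of e₁ is V_{e,y}; apply `V_eq_zero`. -/
theorem lie_expNeg_lowest_y (c : QuadExt R α × J) : ⁅g.expNeg c, g.lowest⁆.y = 0 := by
  apply V_eq_zero (H := H)
  intro e
  have h := congrArg LieAlg.f (g.lie_expMap_one_expNeg_lowest e c)
  rw [lie_f, expMap_one, lie_expNeg_lowest_r] at h
  simpa [mk_s, mk_x, mk_f, mk_y, mk_r, lsmul, zero_f] using h

theorem lie_expNeg_lowest_f (c : QuadExt R α × J) : ⁅g.expNeg c, g.lowest⁆.f = 0 := by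
  refine LinearMap.ext fun e => ?_
  have h := congrArg LieAlg.x (g.lie_expMap_one_expNeg_lowest e c)
  rw [lie_x, expMap_one, lie_expNeg_lowest_y] at h
  simpa [mk_s, mk_x, mk_f, mk_y, mk_r, lsmul, zero_x] using h

theorem lie_expNeg_lowest (c : QuadExt R α × J) : ⁅g.expNeg c, g.lowest⁆ = 0 := by
  obtain ⟨k, w⟩ := c
  rw [show ((k, w) : QuadExt R α × J) = (k, 0) + (0, w) by simp, expNeg_add, add_lie]
  -- `lowest` is a bracket of images of K, and the image of w commutes with both factors.
  have h1 : ⁅g.expNeg (0, w), g.lowest⁆ = 0 := by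
    rw [lowest, leibniz_lie, lie_expNeg_J_K, lie_expNeg_J_K]
    simp
  have h2 : ⁅g.expNeg (k, 0), g.lowest⁆ = 0 := by
    apply LieAlg.ext_of_f
    · rw [lowest, lie_expNeg_K_K_s]; rfl
    · rw [lowest, lie_expNeg_K_K_x]; rfl
    · rw [lie_expNeg_lowest_f]; rfl
    · rw [lie_expNeg_lowest_y]; rfl
    · rw [lie_expNeg_lowest_r]; rfl
  rw [h1, h2, add_zero]

theorem expMap_lie_two (s : QuadExt.skew R α) (X : H.LieAlg) :
    g.expMap ⁅two H s, X⁆ = ⁅g.expMap (two H s), g.expMap X⁆ := by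
  rw [two_eq, smul_lie, map_smul, map_smul, smul_lie, lie_lie, map_sub, expMap_lie_one,
    expMap_lie_one, expMap_lie_one, expMap_lie_one, expMap_lie_one, lie_lie]

theorem expMap_lie_negOne (c : QuadExt R α × J) (X : H.LieAlg) :
    g.expMap ⁅negOne H c, X⁆ = ⁅g.expMap (negOne H c), g.expMap X⁆ := by
  rw [eq_sum X]
  simp only [lie_add, map_add, expMap_lie_symm (g.expMap_lie_two _ (negOne H c)),
    expMap_lie_symm (g.expMap_lie_one _ (negOne H c)),
    expMap_lie_symm (g.expMap_lie_zero_negOne _ c), expMap_lie_negOne_negOne]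
  rw [lie_negOne_negTwo, expMap_negTwo, map_zero, lie_smul, expMap_negOne, lie_expNeg_lowest,
    smul_zero]

theorem expMap_lie (X Y : H.LieAlg) : g.expMap ⁅X, Y⁆ = ⁅g.expMap X, g.expMap Y⁆ := by
  -- By the Jacobi identity, the elements whose brackets with everything are respected form a
  -- subalgebra. It contains degrees 1 and -1, hence is everything.
  let S : LieSubalgebra R H.LieAlg :=
    { carrier := {X | ∀ Y, g.expMap ⁅X, Y⁆ = ⁅g.expMap X, g.expMap Y⁆}
      zero_mem' := fun Y => by simp
      add_mem' := fun {X X'} h h' Y => by rw [add_lie, map_add, h Y, h' Y, map_add, add_lie]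
      smul_mem' := fun a X h Y => by rw [smul_lie, map_smul, h Y, map_smul, smul_lie]
      lie_mem' := fun {X X'} h h' Y => by
        rw [lie_lie, map_sub, h, h', h, h', h, lie_lie] }
  have h : S = ⊤ := eq_top_of_one_mem g.expMap_lie_one g.expMap_lie_negOne
  have hX : X ∈ S := h ▸ LieSubalgebra.mem_top X
  exact hX Y

/-- The inverse element of the group `G`. -/
def inv : H.G where
  a := -g.a
  v := -g.v
  u := star g.u
  add_star_u := by
    rw [star_star, add_comm, g.add_star_u]; simp

theorem inv_inv : g.inv.inv = g := by
  cases g; simp [inv]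

theorem quarticNorm_inv : g.inv.quarticNorm = g.quarticNorm := by
  simp [quarticNorm, inv, N_neg, sharp_neg, mul_comm (star g.u)]

end G

end Generic

end HermitianCubicNormStructure

/-! ### Inverses: exp_+ as an automorphism. -/

namespace HermitianCubicNormStructure

section Generic

variable {R : Type u} [CommRing R] {α : R} {J : Type v} [AddCommGroup J] [Module (QuadExt R α) J]
  [Module R J] [IsScalarTower R (QuadExt R α) J] {H : HermitianCubicNormStructure R α J}

open LieAlg

theorem LieAlg.hom_ext {φ ψ : H.LieAlg →ₗ⁅R⁆ H.LieAlg} (h1 : ∀ e, φ (one H e) = ψ (one H e))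
    (h2 : ∀ c, φ (negOne H c) = ψ (negOne H c)) : φ = ψ := by
  let S : LieSubalgebra R H.LieAlg :=
    { LinearMap.eqLocus (φ : H.LieAlg →ₗ[R] H.LieAlg) (ψ : H.LieAlg →ₗ[R] H.LieAlg) with
      lie_mem' := fun {X X'} h h' => by
        have h1 : φ X = ψ X := h
        have h2 : φ X' = ψ X' := h'
        have h3 : φ ⁅X, X'⁆ = ψ ⁅X, X'⁆ := by rw [LieHom.map_lie, LieHom.map_lie, h1, h2]
        exact h3 }
  have h : S = ⊤ := eq_top_of_one_mem h1 h2
  refine LieHom.ext fun X => ?_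
  have hX : X ∈ S := h ▸ LieSubalgebra.mem_top X
  exact hX

namespace G

variable (g : H.G)

theorem inv_x : g.inv.x = -g.x := rfl

/-- This is the degree-1 part of exp_+(g⁻¹) exp_+(g) c₋₁ = c₋₁; `cubic_inv` is the degree-2 part.
Together they settle the inverse on the generators of degree -1. -/
theorem Q_inv (c : QuadExt R α × J) : g.inv.Q c = -(g.Q c) - H.V g.x c g.x := by
  have hu := g.star_u
  ext1
  · simp only [Q_fst, inv, V_formula, x, Prod.fst_sub, Prod.fst_neg, map_neg, map_add,
      LinearMap.neg_apply, LinearMap.add_apply, H.T_smul_left, sharp_neg, hu, T_cross_self]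
    ring
  · simp only [Q_snd, inv, V_formula, x, Prod.snd_sub, Prod.snd_neg, map_neg, map_add, D,
      LinearMap.neg_apply, LinearMap.add_apply, H.T_smul_left, sharp_neg, hu, T_cross_self,
          star_neg,
      star_star, star_mul', star_add, star_sub, H.star_T, H.cross_smul_left, cross_self,
      H.cross_comm c.2 g.v, star_ofNat]
    module

theorem cubic_inv (c : QuadExt R α × J) : (g.inv.cubic c : QuadExt R α) =
    H.psi g.x (g.Q c) - H.psi g.x (g.inv.Q c) - g.cubic c := by
  have hu := g.star_u
  simp only [Q_inv, sub_eq_add_neg, psi_add_right, psi_neg_right]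
  simp only [psi_coe, Q_fst, Q_snd, cubic_coe, inv, V_formula, x, Prod.fst_sub, Prod.fst_neg,
    map_neg, map_add, N_neg, crossSharp_neg, Prod.snd_sub, Prod.snd_neg, map_sub,
        LinearMap.sub_apply,
    LinearMap.neg_apply, LinearMap.add_apply, H.T_smul_left, H.T_smul_right, sharp_neg, hu,
    T_cross_self, star_neg, star_pow, T_self_cross, D, Prod.fst_add, Prod.snd_add,
    star_star, star_mul', star_add, star_sub, H.star_T, H.cross_smul_left, cross_self,
    H.cross_comm c.2 g.v, star_ofNat]
  ring

theorem expMap_toFun_lie : ∀ {X Y : H.LieAlg},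
    g.expMap.toFun ⁅X, Y⁆ = ⁅g.expMap.toFun X, g.expMap.toFun Y⁆ := @(g.expMap_lie)

/-- `exp_+` as an endomorphism of the Lie algebra. -/
def expHom : H.LieAlg →ₗ⁅R⁆ H.LieAlg := LieHom.mk g.expMap g.expMap_toFun_lie

/-- `exp_+` of the inverse is the inverse of `exp_+`. -/
theorem expMap_inv (X : H.LieAlg) : g.inv.expMap (g.expMap X) = X := by
  have h : g.inv.expHom.comp g.expHom = LieHom.id := by
    refine LieAlg.hom_ext (fun e => ?_) (fun c => ?_)
    · change g.inv.expMap (g.expMap (one H e)) = one H e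
      rw [expMap_one]
      apply LieAlg.ext_of_f
      · rw [expMap_s]
        simp [one, mk_s, mk_x, mk_f, mk_y, mk_r, quadK, cubic_coe, inv_x, psi_neg_left]
      · rw [expMap_x]
        simp [one, mk_s, mk_x, mk_f, mk_y, mk_r]
        ext1
        · simp [Q_fst]
        · simp [Q_snd]
      · rw [expMap_f]
        simp [one, mk_s, mk_x, mk_f, mk_y, mk_r]
      · rw [expMap_y]
        simp [one, mk_s, mk_x, mk_f, mk_y, mk_r]
      · rw [expMap_r]
        simp [one, mk_s, mk_x, mk_f, mk_y, mk_r]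
    · change g.inv.expMap (g.expMap (negOne H c)) = negOne H c
      have hp : (H.psi g.x g.x : QuadExt R α) = 0 := by rw [psi_coe]; ring
      rw [expMap_negOne]
      apply LieAlg.ext_of_f
      · rw [expMap_s, expNeg_s, expNeg_x, expNeg_f, expNeg_y, expNeg_r, quadK_V, cubic_inv, inv_x,
          psi_neg_left, psi_neg_left, hp]
        simp [negOne, mk_s]
        ring
      · rw [expMap_x, expNeg_x, expNeg_f, expNeg_y, expNeg_r, inv_x, Q_inv]
        simp [negOne, mk_x]
      · rw [expMap_f, expNeg_f, expNeg_y, expNeg_r, inv_x]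
        simp [negOne, mk_f]
      · rw [expMap_y, expNeg_y, expNeg_r]
        simp [negOne, mk_y]
      · rw [expMap_r, expNeg_r]; rfl
  exact LieHom.congr_fun h X

theorem expMap_inv' (X : H.LieAlg) : g.expMap (g.inv.expMap X) = X := by
  have h := g.inv.expMap_inv X
  rwa [inv_inv] at h

/-- `exp_+` as an automorphism of the Lie algebra. -/
def exp : H.LieAlg ≃ₗ⁅R⁆ H.LieAlg :=
  LieEquiv.mk g.expHom g.inv.expMap g.expMap_inv g.expMap_inv'

theorem exp_apply (X : H.LieAlg) : g.exp X = g.expMap X := rfl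

theorem exp_inv_exp (X : H.LieAlg) : g.inv.exp (g.exp X) = X := g.expMap_inv X

theorem isExpPlus_exp : g.IsExpPlus g.exp := by
  refine ⟨LieAlgebra.ad R H.LieAlg (one H g.x), g.exp₂, g.exp₃, g.exp₄, g.expMap_apply, ?_,
    fun X => rfl, fun c => ?_, fun c => ?_⟩
  · rintro i X ⟨h1, h2, h3, h4, h5⟩
    have hQ : g.Q 0 = 0 := by ext1 <;> simp [Q_fst, Q_snd]
    have hf : ∀ h : i ≠ 0, X.f = 0 := fun h => by rw [LieAlg.f, h3 h]; rfl
    refine ⟨⟨fun h => ?_, fun h => ?_, fun h => ?_, fun h => ?_, fun h => ?_⟩,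
      ⟨fun h => ?_, fun h => ?_, fun h => ?_, fun h => rfl, fun h => rfl⟩,
      ⟨fun h => ?_, fun h => ?_, fun h => rfl, fun h => rfl, fun h => rfl⟩,
      ⟨fun h => ?_, fun h => rfl, fun h => rfl, fun h => rfl, fun h => rfl⟩⟩
    · rw [LieAlgebra.ad_apply]
      apply Subtype.ext
      rw [lie_s]
      simp [one, mk_s, mk_x, mk_f, chi, h2 (by omega), psi_coe]
    · rw [LieAlgebra.ad_apply, lie_x]
      simp [one, mk_s, mk_x, mk_f, mk_y, hf (by omega)]
    · rw [LieAlgebra.ad_apply]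
      apply Subtype.ext
      apply inner_ext (Subtype.prop _) (Subtype.prop _)
      change LieAlg.f ⁅_, _⁆ = _
      rw [lie_f]
      simp [one, mk_s, mk_x, mk_f, mk_y, mk_r, lsmul, h4 (by omega)]
    · rw [LieAlgebra.ad_apply, lie_y]
      simp [one, mk_y, mk_x, mk_r, mk_g, h5 (by omega)]
    · rw [LieAlgebra.ad_apply]
      apply Subtype.ext
      rw [lie_r]
      simp [one, mk_y, mk_x, mk_r, mk_g, chi, psi_coe]
    · change g.quad X.p = 0
      rw [h3 (by omega), map_zero]
    · change g.Q X.y = 0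
      rw [h4 (by omega), hQ]
    · change skewCoord X.r • g.lowest.p = 0
      rw [h5 (by omega), map_zero, zero_smul]
    · change g.cubic X.y = 0
      rw [h4 (by omega)]
      apply Subtype.ext
      simp [cubic_coe]
    · change skewCoord X.r • g.lowest.x = 0
      rw [h5 (by omega), map_zero, zero_smul]
    · change skewCoord X.r • g.lowest.s = 0
      rw [h5 (by omega), map_zero, zero_smul]
  · apply LieAlg.ext_of_f <;> simp [exp₂, negOne, one, mk_s, mk_x, mk_f, mk_y, mk_r, mk_p]
  · apply LieAlg.ext_of_f <;> simp [exp₃, negOne, two, mk_s, mk_x, mk_f, mk_y, mk_r, mk_p]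

end G

end Generic

end HermitianCubicNormStructure

/-! ### Algebra of the adjoint element `adj`. -/

namespace HermitianCubicNormStructure

section Generic

variable {R : Type u} [CommRing R] {α : R} {J : Type v} [AddCommGroup J] [Module (QuadExt R α) J]
  [Module R J] [IsScalarTower R (QuadExt R α) J] {H : HermitianCubicNormStructure R α J}

theorem sharp_sub (a b : J) : H.sharp (a - b) = H.sharp a + H.sharp b - H.cross a b := by
  rw [sub_eq_add_neg, H.sharp_add', sharp_neg, map_neg]
  abel

namespace G

variable (g : H.G)

/-- The defect of the form `T(w, w) - ν T(v, v)`, up to a factor `3`, where `w` is the component in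
`J` of `g.adj`. -/
def defect : QuadExt R α :=
  H.N g.v * star (H.N g.v) + g.a * star g.a * H.T (H.sharp g.v) (H.sharp g.v)
    - g.a * H.N g.v * star g.u - star g.a * star (H.N g.v) * g.u

theorem star_defect : star g.defect = g.defect := by
  simp only [defect, star_add, star_sub, star_mul', star_star, H.star_T]
  ring

/-- Added to `T_adj_adj`, this gives the membership condition of the partner in G: the terms in
T(v,v) cancel, and the defects sum to 4 times `defect`, the trace of the summand 2 · `defect` in its
u. -/
theorem adj_fst_mul_star : g.adj.1 * star g.adj.1 =
    algebraMap R _ g.quarticNorm * (g.u + star g.u - H.T g.v g.v) + g.defect := by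
  have hu := g.star_u
  rw [algebraMap_quarticNorm]
  simp only [adj, defect, star_sub, star_mul', star_star, H.star_T, hu]
  ring

theorem T_adj_adj : H.T g.adj.2 g.adj.2 =
    algebraMap R _ g.quarticNorm * H.T g.v g.v + 3 * g.defect := by
  have hu := g.star_u
  rw [algebraMap_quarticNorm]
  simp only [adj, defect, map_sub, LinearMap.sub_apply, H.T_smul_left, H.T_smul_right, star_sub,
    star_add, star_mul', star_star, H.star_T, T_crossSharp, T_crossSharp', T_sharp_crossSharp,
    T_sharp_crossSharp', T_crossSharp_self, N_self_coeff, T_sharp_self, hu]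
  ring

theorem D_adj_adj (c : J) : H.D g.adj.2 g.adj.2 c =
    algebraMap R (QuadExt R α) g.quarticNorm • H.D g.v g.v c + (2 * g.defect) • c := by
  have hu := g.star_u
  rw [algebraMap_quarticNorm]
  simp only [adj, defect, D_sub_left, D_sub_mid, D_smul_left, D_smul_mid, star_sub,
    star_add, star_mul', star_star, H.star_T, D_crossSharp_left, D_crossSharp_mid,
    D_sharp_crossSharp, D_crossSharp_sharp, D_crossSharp_crossSharp, D_sharp_self, D_self_sharp, hu]
  match_scalars <;> ring

/-- The combination av - v♯ occurs in the degree-0 component of `lowest`; for `adj` it is, up to the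
factor -ν, the same element. This matches the degree-0 components of g and its partner. -/
theorem sharp_adj : H.sharp g.adj.2 = g.adj.1 • g.adj.2 +
    algebraMap R (QuadExt R α) g.quarticNorm • (g.a • g.v - H.sharp g.v) := by
  have hu := g.star_u
  rw [algebraMap_quarticNorm]
  simp only [adj, sharp_sub, H.sharp_smul', H.sharp_sharp', sharp_crossSharp_self, map_sub,
    LinearMap.sub_apply, H.cross_smul_left, H.cross_smul_right, star_sub, star_add,
    star_mul', star_star, H.star_T, cross_crossSharp', sharp_crossSharp', cross_sharp_self, hu]
  match_scalars <;> ring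

/-- The J-component of the statement that taking `adj` twice is multiplication by ν² on x, where the
unscaled partner has ν ū + 2 · `defect` in the place of u. `star_N_adj` is the K-component. -/
theorem crossSharp_adj : H.crossSharp g.adj.2 =
    star g.adj.1 • H.sharp g.adj.2
      + (H.T g.adj.2 g.adj.2 - (algebraMap R _ g.quarticNorm * g.u + 2 * g.defect)) • g.adj.2
      + (algebraMap R (QuadExt R α) g.quarticNorm ^ 2) • g.v := by
  have hu := g.star_u
  rw [crossSharp, T_adj_adj, sharp_adj]
  simp only [map_add, H.cross_smul_right, star_algebraMap_quadExt, cross_self, sharp_adj]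
  rw [algebraMap_quarticNorm]
  simp only [adj, defect, map_sub,
    LinearMap.sub_apply, H.cross_smul_left, H.cross_smul_right, star_sub, star_add,
    star_mul', star_star, H.star_T, cross_crossSharp', sharp_crossSharp', cross_sharp_self,
    cross_self_sharp, cross_self, H.sharp_sharp', hu]
  match_scalars <;> ring

variable {g} in
theorem star_N_adj (hg : H.N (H.sharp g.v) = star (H.N g.v) ^ 2) : star (H.N g.adj.2) =
    g.adj.1 * (H.T g.adj.2 g.adj.2 - (algebraMap R _ g.quarticNorm * star g.u + 2 * g.defect))
      - algebraMap R _ g.quarticNorm ^ 2 * g.a := by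
  have hu := g.star_u
  rw [T_adj_adj, algebraMap_quarticNorm]
  -- Expanding N on v × v♯ - ā v♯ - (T(v,v) - ū)v produces a multiple of N(v♯); this is the point
  -- where the hypothesis is needed.
  simp only [adj, defect, N_sub', N_smul', hg, N_crossSharp, H.sharp_smul', H.sharp_sharp',
    sharp_sub, sharp_crossSharp_self, map_sub, map_add, LinearMap.sub_apply, H.T_smul_left,
    H.T_smul_right, star_sub, star_add, LinearMap.add_apply, H.cross_smul_left, H.cross_smul_right,
    cross_crossSharp', sharp_crossSharp', cross_sharp_self, cross_self_sharp, star_pow,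
    star_mul', star_star, H.star_T, T_crossSharp, T_crossSharp', T_sharp_crossSharp,
    T_sharp_crossSharp', T_crossSharp_self, N_self_coeff, T_sharp_self, star_ofNat, hu]
  ring

variable {g} in
theorem norm_adj (hg : H.N (H.sharp g.v) = star (H.N g.v) ^ 2) :
    (algebraMap R _ g.quarticNorm * star g.u + 2 * g.defect)
        * (algebraMap R _ g.quarticNorm * g.u + 2 * g.defect)
      - g.adj.1 * star g.adj.1 * H.T g.adj.2 g.adj.2 + g.adj.1 * H.N g.adj.2
      + star g.adj.1 * star (H.N g.adj.2) - H.T (H.sharp g.adj.2) (H.sharp g.adj.2) =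
    algebraMap R _ g.quarticNorm ^ 3 := by
  have hu := g.star_u
  have hN : H.N g.adj.2 = star (star (H.N g.adj.2)) := (star_star _).symm
  rw [hN, star_star (star _), star_N_adj hg, sharp_adj]
  simp only [map_add, map_sub, LinearMap.add_apply, LinearMap.sub_apply, H.T_smul_left,
    H.T_smul_right, star_sub, star_add, star_mul', star_star, star_pow, star_algebraMap_quadExt,
    star_defect, H.star_T, T_adj_adj, star_ofNat, N_self_coeff, T_sharp_self]
  rw [algebraMap_quarticNorm]
  simp only [adj, defect, map_sub, LinearMap.sub_apply, H.T_smul_left,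
    H.T_smul_right, star_sub, star_add,
    star_mul', star_star, H.star_T, T_crossSharp, T_crossSharp', T_sharp_crossSharp,
    T_sharp_crossSharp', T_crossSharp_self, N_self_coeff, T_sharp_self, hu]
  ring

end G

end Generic

end HermitianCubicNormStructure

/-! ### The partner h with exp_-(h) z₂ proportional to exp_+(g) z₋₂. -/

namespace HermitianCubicNormStructure

section Generic

variable {R : Type u} [CommRing R] {α : R} {J : Type v} [AddCommGroup J] [Module (QuadExt R α) J]
  [Module R J] [IsScalarTower R (QuadExt R α) J] {H : HermitianCubicNormStructure R α J}

open LieAlg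

namespace G

variable (g : H.G)

/-- The first entry of an inner transformation determines l, m and Δ, and these determine the
second. The partner's second entry is compared with the first entry of g, since exp_- exchanges the
two. -/
theorem lowest_g (c : QuadExt R α × J) : g.lowest.g c =
    ((skewGen : QuadExt.skew R α) * (star g.u + g.a * star g.a - H.T g.v g.v) * c.1
      + (skewGen : QuadExt.skew R α) * H.T (g.a • g.v - H.sharp g.v) c.2,
    ((skewGen : QuadExt.skew R α) : QuadExt R α) •
      (H.D g.v g.v c.2 - g.u • c.2 + star c.1 • (g.a • g.v - H.sharp g.v)
        - H.cross (g.a • g.v - H.sharp g.v) c.2)) := by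
  obtain ⟨d⟩ := H.exists_innerData g.lowest.p.2
  have hs : star ((skewGen : QuadExt.skew R α) : QuadExt R α) = -(skewGen : QuadExt.skew R α) :=
    QuadExt.star_of_mem_skew (skewGen (R := R) (α := α)).2
  have hf : ∀ c, g.lowest.p.1.1 c = g.adjZero (skewGen : QuadExt.skew R α) c := g.lowest_f
  have hg : g.lowest.g c = g.lowest.p.1.2 c := rfl
  have hl : d.l = (skewGen : QuadExt.skew R α) * (g.u + g.a * star g.a - H.T g.v g.v) := by
    have h := congrArg Prod.fst (d.hf (1, 0))
    rw [hf] at h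
    simpa [adjZero] using h.symm
  have hm : d.m = ((skewGen : QuadExt.skew R α) : QuadExt R α) • (g.a • g.v - H.sharp g.v) := by
    have h := congrArg Prod.snd (d.hf (1, 0))
    rw [hf] at h
    have h' : -d.m = ((skewGen : QuadExt.skew R α) : QuadExt R α) •
        -(g.a • g.v - H.sharp g.v) := by simpa [adjZero, D] using h.symm
    rw [← neg_neg d.m, h', smul_neg, neg_neg]
  have hD : d.Δ c.2 = ((skewGen : QuadExt.skew R α) : QuadExt R α) •
      (H.D g.v g.v c.2 - star g.u • c.2) := by
    have h := congrArg Prod.snd (d.hf (0, c.2))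
    rw [hf, hm] at h
    simp only [adjZero, star_zero, zero_smul, sub_zero, H.cross_smul_left] at h
    exact (sub_left_inj.1 h).symm
  rw [hg, d.hg, hl, hm, hD]
  ext1
  · simp only [star_mul', star_sub, star_add, star_star, H.star_T, hs, H.T_smul_left]
    ring
  · simp only [star_mul', star_sub, star_add, star_star, H.star_T, hs, H.cross_smul_left]
    module

variable {k : R} (hk : k * g.quarticNorm = 1)

theorem algebraMap_mul_quarticNorm {g : H.G} {k : R} (hk : k * g.quarticNorm = 1) :
    algebraMap R (QuadExt R α) k * algebraMap R _ g.quarticNorm = 1 := by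
  rw [← map_mul, hk, map_one]

/-- The element `h` of `G` such that `exp_-(h)` and `exp_+(g)` map the component of degree `2`
respectively `-2` to the same submodule. -/
def partner : H.G where
  a := algebraMap R _ k * g.adj.1
  v := algebraMap R (QuadExt R α) k • g.adj.2
  u := algebraMap R _ k * star g.u + 2 * algebraMap R _ k ^ 2 * g.defect
  add_star_u := by
    have h := algebraMap_mul_quarticNorm hk
    have h1 := g.adj_fst_mul_star
    have h2 := g.T_adj_adj
    simp only [star_add, star_mul', star_star, star_pow, star_algebraMap_quadExt, star_defect,
      H.T_smul_left, H.T_smul_right, star_ofNat]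
    linear_combination (-(algebraMap R (QuadExt R α) k) ^ 2) * (h1 + h2)
      - algebraMap R (QuadExt R α) k * (g.u + star g.u) * h

theorem partner_x : (g.partner hk).x = algebraMap R (QuadExt R α) k • g.adj := rfl

theorem sharp_partner : H.sharp (g.partner hk).v = (g.partner hk).a • (g.partner hk).v +
    algebraMap R (QuadExt R α) k • (g.a • g.v - H.sharp g.v) := by
  have h := algebraMap_mul_quarticNorm hk
  simp only [partner, H.sharp_smul', star_algebraMap_quadExt, sharp_adj]
  linear_combination (norm := module)
    (algebraMap R (QuadExt R α) k • h) • (g.a • g.v - H.sharp g.v)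

theorem lowest_partner_g (c : QuadExt R α × J) : (g.partner hk).lowest.g c = k • g.lowest.f c := by
  have h := algebraMap_mul_quarticNorm hk
  have hs : star ((skewGen : QuadExt.skew R α) : QuadExt R α) = -(skewGen : QuadExt.skew R α) :=
    QuadExt.star_of_mem_skew (skewGen (R := R) (α := α)).2
  have hu := g.star_u
  have hm : (g.partner hk).a • (g.partner hk).v - H.sharp (g.partner hk).v =
      -(algebraMap R (QuadExt R α) k • (g.a • g.v - H.sharp g.v)) := by
    rw [sharp_partner]; abel
  have h1 := g.adj_fst_mul_star
  have h2 := g.T_adj_adj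
  rw [lowest_g, lowest_f, hm, ← algebraMap_smul (QuadExt R α) k]
  ext1
  · simp only [partner, adjZero, star_add, star_mul', star_star, star_pow, star_algebraMap_quadExt,
      star_defect, H.T_smul_left, H.T_smul_right, star_ofNat, map_neg, LinearMap.neg_apply,
      Prod.smul_fst, smul_eq_mul]
    linear_combination
      (algebraMap R (QuadExt R α) k ^ 2 * (skewGen : QuadExt.skew R α) * c.1) * (h1 - h2)
      + algebraMap R (QuadExt R α) k * (skewGen : QuadExt.skew R α) * c.1 * (g.u + star g.u - 2 *
          H.T g.v g.v) * h + algebraMap R (QuadExt R α) k * (skewGen : QuadExt.skew R α) * c.1 * hu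
  -- The scalar 2k² · `defect` appearing here is cancelled by the second summand in the definition
  -- of the partner's u.
  · have hD : ∀ c, H.D (g.partner hk).v (g.partner hk).v c =
      algebraMap R (QuadExt R α) k • H.D g.v g.v c
        + (2 * algebraMap R (QuadExt R α) k ^ 2 * g.defect) • c := by
      intro c
      simp only [partner, D_smul_left, D_smul_mid, D_adj_adj, star_algebraMap_quadExt]
      linear_combination (norm := module) (algebraMap R (QuadExt R α) k • h) • H.D g.v g.v c
    rw [hD]
    simp only [partner, adjZero, map_neg, LinearMap.neg_apply, Prod.smul_snd, H.cross_smul_left,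
      star_algebraMap_quadExt, hs]
    module

theorem quarticNorm_partner (hg : H.N (H.sharp g.v) = star (H.N g.v) ^ 2) :
    algebraMap R (QuadExt R α) (g.partner hk).quarticNorm = algebraMap R (QuadExt R α) k := by
  have h := algebraMap_mul_quarticNorm hk
  rw [algebraMap_quarticNorm]
  have h1 := norm_adj hg
  simp only [partner, star_add, star_mul', star_star, star_pow, star_algebraMap_quadExt,
      star_defect, H.T_smul_left, H.T_smul_right, star_ofNat, N_smul', H.sharp_smul']
  generalize algebraMap R (QuadExt R α) k = κ at *
  generalize algebraMap R (QuadExt R α) g.quarticNorm = ν at *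
  -- Scaling by κ turns the norm ν³ of `norm_adj` into κ⁴ν³, and κ⁴ν³ - κ = κ(1 + κν + κ²ν²)(κν -
  -- 1). The other coefficients replace κν by 1 in the scaled u.
  linear_combination κ ^ 4 * h1 + (κ * (1 + κ * ν + κ ^ 2 * ν ^ 2)
    - κ * star g.u * (κ * g.u + 2 * κ ^ 2 * g.defect)
    - (κ ^ 2 * ν * star g.u + 2 * κ ^ 2 * g.defect) * κ * g.u) * h

theorem adj_partner (hg : H.N (H.sharp g.v) = star (H.N g.v) ^ 2) :
    (g.partner hk).adj = algebraMap R (QuadExt R α) k • g.x := by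
  have h := algebraMap_mul_quarticNorm hk
  have h1 := star_N_adj hg
  have h2 := g.crossSharp_adj
  have hc : H.crossSharp (algebraMap R (QuadExt R α) k • g.adj.2) =
      (algebraMap R (QuadExt R α) k ^ 3) • H.crossSharp g.adj.2 := by
    simp only [crossSharp, H.sharp_smul', H.cross_smul_left, H.cross_smul_right, star_pow,
      star_algebraMap_quadExt]
    module
  rw [adj]
  ext1
  · simp only [x, Prod.smul_fst, smul_eq_mul]
    simp only [partner, N_smul', star_mul', star_pow, star_algebraMap_quadExt, h1, H.T_smul_left,
      H.T_smul_right]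
    generalize algebraMap R (QuadExt R α) k = κ at *
    generalize algebraMap R (QuadExt R α) g.quarticNorm = ν at *
    linear_combination (κ ^ 2 * g.adj.1 * star g.u + κ * g.a * (κ * ν + 1)) * h
  · simp only [x, Prod.smul_snd]
    simp only [partner, hc, h2, H.sharp_smul', star_mul', star_add, star_pow, star_star, star_ofNat,
      star_algebraMap_quadExt, H.T_smul_left, H.T_smul_right, star_defect]
    generalize algebraMap R (QuadExt R α) k = κ at *
    generalize algebraMap R (QuadExt R α) g.quarticNorm = ν at *
    linear_combination (norm := module) ((κ * (κ * ν + 1)) • h) • g.v - ((κ ^ 2 * g.u) • h) •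
        g.adj.2

/-- `exp_-(h)` maps the component of degree `2` to the image under `exp_+(g)` of that of
degree `-2`. -/
theorem flip_lowest_partner (hg : H.N (H.sharp g.v) = star (H.N g.v) ^ 2) :
    flip (g.partner hk).lowest = k • g.lowest := by
  have h := algebraMap_mul_quarticNorm hk
  apply LieAlg.ext_of_f
  · rw [flip_s, smul_s, lowest_r, Submodule.coe_smul, lowest_s, ← algebraMap_smul (QuadExt R α) k,
      smul_eq_mul]
    linear_combination (-((skewGen : QuadExt.skew R α) : QuadExt R α)) * h
  · rw [flip_x, smul_x, lowest_y, lowest_x, partner_x, ← algebraMap_smul (QuadExt R α) k, smul_comm]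
  · refine LinearMap.ext fun c => ?_
    rw [flip_f, smul_f, lowest_partner_g, LinearMap.smul_apply]
  · rw [flip_y, smul_y, lowest_y, lowest_x, adj_partner _ _ hg, ← algebraMap_smul (QuadExt R α) k,
      smul_comm]
  · rw [flip_r, smul_r, lowest_r, lowest_s, Submodule.coe_smul, ← algebraMap_smul (QuadExt R α) k,
      quarticNorm_partner _ _ hg, smul_eq_mul, mul_comm]

end G

end Generic

end HermitianCubicNormStructure

/-! ### The grading is determined by z₂ and z₋₂. -/

namespace HermitianCubicNormStructure

section Generic

variable {R : Type u} [CommRing R] {α : R} {J : Type v} [AddCommGroup J] [Module (QuadExt R α) J]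
  [Module R J] [IsScalarTower R (QuadExt R α) J] {H : HermitianCubicNormStructure R α J}

namespace LieAlg

theorem p_eq_zero {X : H.LieAlg} (h : X.f = 0) : X.p = 0 :=
  Subtype.ext (inner_ext X.p.2 H.inner.zero_mem h)

theorem flip_mem_grade {X : H.LieAlg} {i : ℤ} (h : X ∈ grade i) : flip X ∈ grade (-i) := by
  obtain ⟨h1, h2, h3, h4, h5⟩ := h
  refine ⟨fun h => h5 (by omega), fun h => h4 (by omega), fun h => ?_, fun h => h2 (by omega),
    fun h => h1 (by omega)⟩
  apply p_eq_zero
  have h0 := h3 (by omega)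
  rw [flip_f, LieAlg.g, h0]
  rfl

theorem two_mem_grade (s : QuadExt.skew R α) : two H s ∈ grade 2 :=
  ⟨fun h => absurd rfl h, fun _ => rfl, fun _ => rfl, fun _ => rfl, fun _ => rfl⟩

theorem one_mem_grade (x : QuadExt R α × J) : one H x ∈ grade 1 :=
  ⟨fun _ => rfl, fun h => absurd rfl h, fun _ => rfl, fun _ => rfl, fun _ => rfl⟩

theorem zero_mem_grade (p : H.inner) : zero H p ∈ grade 0 :=
  ⟨fun _ => rfl, fun _ => rfl, fun h => absurd rfl h, fun _ => rfl, fun _ => rfl⟩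

theorem negOne_mem_grade (y : QuadExt R α × J) : negOne H y ∈ grade (-1) :=
  ⟨fun _ => rfl, fun _ => rfl, fun _ => rfl, fun h => absurd rfl h, fun _ => rfl⟩

theorem negTwo_mem_grade (r : QuadExt.skew R α) : negTwo H r ∈ grade (-2) :=
  ⟨fun _ => rfl, fun _ => rfl, fun _ => rfl, fun _ => rfl, fun h => absurd rfl h⟩

theorem eq_two {X : H.LieAlg} (h : X ∈ grade 2) : X = two H X.s := by
  obtain ⟨h1, h2, h3, h4, h5⟩ := h
  exact Prod.ext rfl (Prod.ext (h2 (by decide)) (Prod.ext (h3 (by decide))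
    (Prod.ext (h4 (by decide)) (h5 (by decide)))))

theorem eq_one {X : H.LieAlg} (h : X ∈ grade 1) : X = one H X.x := by
  obtain ⟨h1, h2, h3, h4, h5⟩ := h
  exact Prod.ext (h1 (by decide)) (Prod.ext rfl (Prod.ext (h3 (by decide))
    (Prod.ext (h4 (by decide)) (h5 (by decide)))))

theorem eq_zero {X : H.LieAlg} (h : X ∈ grade 0) : X = zero H X.p := by
  obtain ⟨h1, h2, h3, h4, h5⟩ := h
  exact Prod.ext (h1 (by decide)) (Prod.ext (h2 (by decide)) (Prod.ext rfl
    (Prod.ext (h4 (by decide)) (h5 (by decide)))))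

theorem eq_negOne {X : H.LieAlg} (h : X ∈ grade (-1)) : X = negOne H X.y := by
  obtain ⟨h1, h2, h3, h4, h5⟩ := h
  exact Prod.ext (h1 (by decide)) (Prod.ext (h2 (by decide)) (Prod.ext (h3 (by decide))
    (Prod.ext rfl (h5 (by decide)))))

theorem eq_negTwo {X : H.LieAlg} (h : X ∈ grade (-2)) : X = negTwo H X.r := by
  obtain ⟨h1, h2, h3, h4, h5⟩ := h
  exact Prod.ext (h1 (by decide)) (Prod.ext (h2 (by decide)) (Prod.ext (h3 (by decide))
    (Prod.ext (h4 (by decide)) rfl)))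

theorem eq_zero_of_grade {X : H.LieAlg} {i : ℤ} (h : X ∈ grade i) (h1 : i ≠ 2) (h2 : i ≠ 1)
    (h3 : i ≠ 0) (h4 : i ≠ -1) (h5 : i ≠ -2) : X = 0 := by
  obtain ⟨k1, k2, k3, k4, k5⟩ := h
  exact Prod.ext (k1 h1) (Prod.ext (k2 h2) (Prod.ext (k3 h3) (Prod.ext (k4 h4) (k5 h5))))

theorem skewGen_mul_self : ((skewGen : QuadExt.skew R α) : QuadExt R α) *
    (skewGen : QuadExt.skew R α) = algebraMap R _ (1 - 4 * α) := by
  rw [← skew_gen_sq, pow_two]; rfl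

theorem lie_two_one (s : QuadExt.skew R α) (x : QuadExt R α × J) : ⁅two H s, one H x⁆ = 0 := by
  apply LieAlg.ext_of_f <;>
    simp [lie_s, lie_x, lie_f, lie_y, lie_r, one, two, mk_s, mk_x, mk_f, mk_y, mk_r, mk_g, chi,
      lsmul, psi_coe] <;> rfl

/-- Degree 1 is an eigenspace of ad z₂ ad z₋₂ with the invertible eigenvalue z² = 1 - 4α; this is
one of the two conditions in `mem_grade_one`. -/
theorem lie_two_negTwo_one (x : QuadExt R α × J) :
    ⁅two H skewGen, ⁅negTwo H skewGen, one H x⁆⁆ = (1 - 4 * α) • one H x := by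
  rw [← lie_skew (negTwo H skewGen), lie_one_negTwo, lie_neg]
  apply LieAlg.ext_of_f
  · simp [lie_s, smul_s, neg_s, one, two, negOne, mk_s, mk_x, mk_f, chi, psi_coe]
  · rw [neg_x, lie_x, smul_x]
    simp [one, two, negOne, mk_s, mk_x, mk_f, mk_y, smul_smul, skewGen_mul_self]
    rw [← map_mul, ← map_one (algebraMap R (QuadExt R α)), ← map_sub, algebraMap_smul]
  · simp [lie_f, smul_f, neg_f, one, two, negOne, mk_s, mk_x, mk_f, mk_r, mk_y, lsmul]
  · simp [lie_y, smul_y, neg_y, one, two, negOne, mk_s, mk_x, mk_f, mk_r, mk_y, mk_g]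
  · simp [lie_r, smul_r, neg_r, one, two, negOne, mk_s, mk_x, mk_f, mk_r, mk_y, mk_g, chi, psi_coe]

theorem smul_disc_eq_zero (H : HermitianCubicNormStructure R α J) {M : Type*} [AddCommGroup M]
    [Module R M] {m : M} (h : (1 - 4 * α) • m = 0) : m = 0 :=
  H.isUnit_disc.smul_eq_zero.1 h

/-- A characterisation of the elements of degree `1`. -/
theorem mem_grade_one {X : H.LieAlg} (h1 : ⁅two H skewGen, X⁆ = 0)
    (h2 : ⁅two H skewGen, ⁅negTwo H skewGen, X⁆⁆ = (1 - 4 * α) • X) : X ∈ grade 1 := by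
  have hc : chi X.f • ((skewGen : QuadExt.skew R α) : QuadExt R α) = 0 := by
    have h := congrArg (fun X : H.LieAlg => (X.s : QuadExt R α)) h1
    simpa [lie_s, two, mk_s, mk_x, mk_f, zero_s, chi, psi_coe] using h
  have hg : chi X.g • ((skewGen : QuadExt.skew R α) : QuadExt R α) = 0 := by
    rw [LieAlg.g, chi_snd H X.p.2, neg_smul]
    exact neg_eq_zero.2 hc
  refine ⟨fun _ => ?_, fun h => absurd rfl h, fun _ => ?_, fun _ => ?_, fun _ => ?_⟩
  -- On degree 2 the operator ad z₂ ad z₋₂ is multiplication by 2(1 - 4α). Comparison with 1 - 4α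
  -- leaves (1 - 4α)s = 0, so 2 need not be invertible.
  · apply smul_disc_eq_zero H
    have h := congrArg (fun X : H.LieAlg => (X.s : QuadExt R α)) h2
    apply Subtype.ext
    have h3 : ⁅negTwo H skewGen, X⁆.f =
        -lsmul (J := J) ((X.s : QuadExt R α) * ((skewGen : QuadExt.skew R α) : QuadExt R α)) := by
      simp [lie_f, negTwo, mk_s, mk_x, mk_f, mk_y, mk_r, lsmul]
    have h4 : ((two H skewGen).s : QuadExt R α) = (skewGen : QuadExt.skew R α) := rfl
    have h5 : (two H skewGen).x = 0 := rfl
    have h6 : (two H skewGen).f = 0 := rfl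
    have h7 (k : QuadExt R α) : chi (-lsmul (J := J) k) = -chi (lsmul (J := J) k) := by
      simp [chi]
    have h8 := skewGen_mul_self (R := R) (α := α)
    simp only [lie_s, h3, h4, h5, h6, smul_s, Submodule.coe_smul, smul_eq, h7, map_neg,
      chi_lsmul] at h
    have h9 : (H.psi 0 ⁅negTwo H skewGen, X⁆.x : QuadExt R α) = 0 := by simp [psi_coe]
    have h10 : chi (0 : Module.End R (QuadExt R α × J)) = 0 := by simp [chi]
    rw [h9, h10, map_zero] at h
    rw [Submodule.coe_smul, smul_eq, ZeroMemClass.coe_zero]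
    linear_combination h - 2 * (X.s : QuadExt R α) * h8
  · apply p_eq_zero
    apply smul_disc_eq_zero H
    have h := congrArg LieAlg.f h2
    rw [smul_f] at h
    -- The first condition says that f acts as 0 on z₂, hence g acts as 0 on z₋₂. The operator then
    -- produces nothing in degree 0.
    have hr : (⁅negTwo H skewGen, X⁆.r : QuadExt R α) = 0 := by
      simpa [lie_r, negTwo, mk_y, mk_g, mk_r, chi, psi_coe] using hg
    rw [← h, lie_f, hr]
    simp [two, negTwo, mk_s, mk_x, mk_f, mk_y, mk_r, lsmul]
  · apply smul_disc_eq_zero H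
    have h := congrArg LieAlg.y h2
    rw [smul_y] at h
    rw [← h, lie_y]
    simp [two, negTwo, mk_s, mk_x, mk_y, mk_g, mk_r, lie_x, mk_f]
  · apply smul_disc_eq_zero H
    have h := congrArg LieAlg.r h2
    rw [smul_r] at h
    rw [← h]
    apply Subtype.ext
    rw [lie_r]
    simp [two, negTwo, mk_s, mk_x, mk_y, mk_g, mk_r, lie_x, mk_f, chi, psi_coe]

theorem flip_two (s : QuadExt.skew R α) : flip (two H s) = negTwo H s := rfl

theorem flip_negTwo (s : QuadExt.skew R α) : flip (negTwo H s) = two H s := rfl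

theorem flip_one (c : QuadExt R α × J) : flip (one H c) = negOne H c := rfl

theorem flip_flip (X : H.LieAlg) : flip (flip X) = X := rfl

theorem lie_negTwo_negOne (r : QuadExt.skew R α) (c : QuadExt R α × J) :
    ⁅negTwo H r, negOne H c⁆ = 0 := by
  rw [← lie_skew, lie_negOne_negTwo, neg_zero]

theorem lie_negTwo_two_negOne (c : QuadExt R α × J) :
    ⁅negTwo H skewGen, ⁅two H skewGen, negOne H c⁆⁆ = (1 - 4 * α) • negOne H c := by
  have h := congrArg flip (lie_two_negTwo_one (H := H) c)
  rwa [flip_lie, flip_lie, map_smul, flip_two, flip_negTwo, flip_one] at h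

/-- A characterisation of the elements of degree `-1`. -/
theorem mem_grade_negOne {X : H.LieAlg} (h1 : ⁅negTwo H skewGen, X⁆ = 0)
    (h2 : ⁅negTwo H skewGen, ⁅two H skewGen, X⁆⁆ = (1 - 4 * α) • X) : X ∈ grade (-1) := by
  have h := congrArg flip h1
  have h' := congrArg flip h2
  rw [flip_lie, flip_negTwo, map_zero] at h
  rw [flip_lie, flip_lie, map_smul, flip_negTwo, flip_two] at h'
  have h3 := flip_mem_grade (mem_grade_one h h')
  rwa [flip_flip] at h3

theorem lie_mem_grade_zero {X Y : H.LieAlg} (hX : X ∈ grade (-1)) (hY : Y ∈ grade 1) :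
    ⁅X, Y⁆ ∈ grade 0 := by
  rw [eq_negOne hX, eq_one hY, ← lie_skew, lie_one_negOne]
  exact neg_mem (zero_mem_grade _)

theorem smul_two (a : R) (s : QuadExt.skew R α) : two H (a • s) = a • two H s := by
  apply LieAlg.ext_of_f <;>
    simp [smul_s, smul_x, smul_f, smul_y, smul_r, two, mk_s, mk_x, mk_f, mk_y, mk_r]

theorem smul_negTwo (a : R) (s : QuadExt.skew R α) : negTwo H (a • s) = a • negTwo H s := by
  apply LieAlg.ext_of_f <;>
    simp [smul_s, smul_x, smul_f, smul_y, smul_r, negTwo, mk_s, mk_x, mk_f, mk_y, mk_r]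

/-- An endomorphism that interchanges the components of degrees `2` and `-2` reverses the
grading. -/
theorem map_mem_grade {θ : H.LieAlg →ₗ⁅R⁆ H.LieAlg} {k l : R} (hkl : k * l = 1)
    (h1 : θ (two H skewGen) = k • negTwo H skewGen)
    (h2 : θ (negTwo H skewGen) = l • two H skewGen) {i : ℤ} {X : H.LieAlg} (hX : X ∈ grade i) :
    θ X ∈ grade (-i) := by
  have h3 : two H skewGen = k • θ (negTwo H skewGen) := by rw [h2, smul_smul, hkl, one_smul]
  have h4 : negTwo H skewGen = l • θ (two H skewGen) := by
    rw [h1, smul_smul, mul_comm, hkl, one_smul]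
  -- θ turns the relations characterising degree 1 into those characterising degree -1: the scalars
  -- k and l cancel in the double bracket since kl = 1.
  have hone : ∀ x, θ (one H x) ∈ grade (-1) := fun x => by
    apply mem_grade_negOne
    · rw [h4, smul_lie, ← LieHom.map_lie, lie_two_one, map_zero, smul_zero]
    · have e := congrArg θ (lie_two_negTwo_one x)
      simp only [LieHom.map_lie, h1, h2, smul_lie, lie_smul, smul_smul, mul_comm l k, hkl,
        one_smul, map_smul] at e
      with_reducible exact e
  have hneg : ∀ x, θ (negOne H x) ∈ grade 1 := fun x => by
    apply mem_grade_one
    · rw [h3, smul_lie, ← LieHom.map_lie, lie_negTwo_negOne, map_zero, smul_zero]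
    · have e := congrArg θ (lie_negTwo_two_negOne x)
      simp only [LieHom.map_lie, h1, h2, smul_lie, lie_smul, smul_smul, hkl, one_smul,
        map_smul] at e
      with_reducible exact e
  by_cases i1 : i = 2
  · subst i1
    rw [eq_two hX, ← skewCoord_smul X.s, smul_two, map_smul, h1]
    exact Submodule.smul_mem _ _ (Submodule.smul_mem _ _ (negTwo_mem_grade _))
  by_cases i2 : i = 1
  · subst i2
    rw [eq_one hX]
    exact hone _
  by_cases i3 : i = 0
  · subst i3
    rw [eq_zero hX, neg_zero]
    obtain ⟨p, hp⟩ := X.p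
    induction hp using Submodule.span_induction with
    | mem p h =>
      obtain ⟨a, b, rfl⟩ := h
      rw [← lie_one_negOne, LieHom.map_lie]
      exact lie_mem_grade_zero (hone _) (hneg _)
    | zero =>
      have h : zero H ⟨0, H.inner.zero_mem⟩ = 0 := rfl
      rw [h, map_zero]
      exact zero_mem _
    | add p q hp hq h h' =>
      have e := zero_map_add (H := H) ⟨p, hp⟩ ⟨q, hq⟩
      have e' : (⟨p, hp⟩ + ⟨q, hq⟩ : H.inner) = ⟨p + q, add_mem hp hq⟩ := rfl
      rw [← e', e, map_add]
      exact add_mem h h'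
    | smul r p hp h =>
      have e := zero_map_smul (H := H) r ⟨p, hp⟩
      have e' : (r • ⟨p, hp⟩ : H.inner) = ⟨r • p, Submodule.smul_mem _ r hp⟩ := rfl
      rw [← e', e, map_smul]
      exact Submodule.smul_mem _ r h
  by_cases i4 : i = -1
  · subst i4
    rw [eq_negOne hX, neg_neg]
    exact hneg _
  by_cases i5 : i = -2
  · subst i5
    rw [eq_negTwo hX, ← skewCoord_smul X.r, smul_negTwo, map_smul, h2, neg_neg]
    exact Submodule.smul_mem _ _ (Submodule.smul_mem _ _ (two_mem_grade _))
  rw [eq_zero_of_grade hX i1 i2 i3 i4 i5, map_zero]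
  exact zero_mem _

theorem map_grade_eq {θ : H.LieAlg ≃ₗ⁅R⁆ H.LieAlg} {k l : R} (hkl : k * l = 1)
    (h1 : θ (two H skewGen) = k • negTwo H skewGen)
    (h2 : θ (negTwo H skewGen) = l • two H skewGen) (i : ℤ) :
    (grade i).map (θ : H.LieAlg →ₗ[R] H.LieAlg) = grade (-i) := by
  apply le_antisymm
  · rintro _ ⟨X, hX, rfl⟩
    exact map_mem_grade (θ := θ.toLieHom) hkl h1 h2 hX
  · intro X hX
    have h3 : θ.symm (two H skewGen) = k • negTwo H skewGen := by
      rw [← θ.symm_apply_apply (k • negTwo H skewGen), map_smul, h2, smul_smul, hkl, one_smul]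
    have h4 : θ.symm (negTwo H skewGen) = l • two H skewGen := by
      rw [← θ.symm_apply_apply (l • two H skewGen), map_smul, h1, smul_smul, mul_comm, hkl,
        one_smul]
    have h5 := map_mem_grade (θ := θ.symm.toLieHom) hkl h3 h4 hX
    rw [neg_neg] at h5
    exact ⟨_, h5, θ.apply_symm_apply X⟩

end LieAlg

end Generic

end HermitianCubicNormStructure

/-! ### Uniqueness of the exponentials, and the two implications. -/

namespace HermitianCubicNormStructure

section Generic

variable {R : Type u} [CommRing R] {α : R} {J : Type v} [AddCommGroup J] [Module (QuadExt R α) J]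
  [Module R J] [IsScalarTower R (QuadExt R α) J] {H : HermitianCubicNormStructure R α J}

open LieAlg

namespace G

variable {g : H.G}

/-- The parts of degrees 2, 3, 4 would land in degrees 3, 4, 5, where L is zero. So the prescribed
data fix φ on degree 1 and, likewise, on degree -1. -/
theorem IsExpPlus.apply_one {φ : H.LieAlg ≃ₗ⁅R⁆ H.LieAlg} (h : g.IsExpPlus φ)
    (e : QuadExt R α × J) : φ (one H e) = one H e + ⁅one H g.x, one H e⁆ := by
  obtain ⟨φ₁, φ₂, φ₃, φ₄, h0, hi, h1, h2, h3⟩ := h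
  obtain ⟨-, k2, k3, k4⟩ := hi 1 _ (one_mem_grade e)
  rw [h0, h1, eq_zero_of_grade k2 (by decide) (by decide) (by decide) (by decide) (by decide),
    eq_zero_of_grade k3 (by decide) (by decide) (by decide) (by decide) (by decide),
    eq_zero_of_grade k4 (by decide) (by decide) (by decide) (by decide) (by decide),
    add_zero, add_zero, add_zero]

theorem IsExpPlus.apply_negOne {φ : H.LieAlg ≃ₗ⁅R⁆ H.LieAlg} (h : g.IsExpPlus φ)
    (c : QuadExt R α × J) : φ (negOne H c) =
      negOne H c + ⁅one H g.x, negOne H c⁆ + one H (g.Q c) + two H (g.cubic c) := by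
  obtain ⟨φ₁, φ₂, φ₃, φ₄, h0, hi, h1, h2, h3⟩ := h
  obtain ⟨-, -, -, k4⟩ := hi (-1) _ (negOne_mem_grade c)
  rw [h0, h1, h2, h3,
    eq_zero_of_grade k4 (by decide) (by decide) (by decide) (by decide) (by decide), add_zero]

/-- The uniqueness of `exp_+`. -/
theorem IsExpPlus.eq_exp {φ : H.LieAlg ≃ₗ⁅R⁆ H.LieAlg} (h : g.IsExpPlus φ) (X : H.LieAlg) :
    φ X = g.exp X := by
  have h' : φ.toLieHom = g.exp.toLieHom :=
    LieAlg.hom_ext (fun e => (h.apply_one e).trans (g.isExpPlus_exp.apply_one e).symm)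
      (fun c => (h.apply_negOne c).trans (g.isExpPlus_exp.apply_negOne c).symm)
  exact LieHom.congr_fun h' X

variable (g) in
/-- `exp_-` as an automorphism of the Lie algebra. -/
def expMinus : H.LieAlg ≃ₗ⁅R⁆ H.LieAlg := (flipEquiv.trans g.exp).trans flipEquiv

theorem expMinus_apply (X : H.LieAlg) : g.expMinus X = flip (g.exp (flip X)) := rfl

theorem isExpMinus_expMinus : g.IsExpMinus g.expMinus := g.isExpPlus_exp

theorem IsExpMinus.eq_expMinus {φ : H.LieAlg ≃ₗ⁅R⁆ H.LieAlg} (h : g.IsExpMinus φ) (X : H.LieAlg) :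
    φ X = g.expMinus X := by
  have h1 := IsExpPlus.eq_exp h (flip X)
  have h2 : ((flipEquiv.trans φ).trans flipEquiv) (flip X) = flip (φ X) := rfl
  rw [expMinus_apply, ← h1, h2, LieAlg.flip_flip]

theorem exp_negTwo : g.exp (negTwo H skewGen) = g.lowest := by
  rw [exp_apply, expMap_negTwo, skewCoord_gen, one_smul]

theorem exp_two (s : QuadExt.skew R α) : g.exp (two H s) = two H s := by
  rw [exp_apply, expMap_two]

theorem exp_exp_inv (X : H.LieAlg) : g.exp (g.inv.exp X) = X := g.expMap_inv' X

theorem expMinus_negTwo (s : QuadExt.skew R α) : g.expMinus (negTwo H s) = negTwo H s := by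
  rw [expMinus_apply, flip_negTwo, exp_two, flip_two]

theorem expMinus_inv_expMinus (X : H.LieAlg) : g.inv.expMinus (g.expMinus X) = X := by
  rw [expMinus_apply, expMinus_apply, LieAlg.flip_flip, exp_inv_exp, LieAlg.flip_flip]

theorem expMinus_s (X : H.LieAlg) : (g.expMinus X).s = X.s := by
  rw [expMinus_apply, flip_s, exp_apply, expMap_r, flip_r]

theorem lowest_s' : g.lowest.s = g.quarticNorm • skewGen := by
  apply Subtype.ext
  rw [lowest_s, Submodule.coe_smul, smul_eq, mul_comm]

theorem expMinus_partner_two {k : R} (hk : k * g.quarticNorm = 1)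
    (hg : H.N (H.sharp g.v) = star (H.N g.v) ^ 2) :
    (g.partner hk).expMinus (two H skewGen) = k • g.lowest := by
  rw [expMinus_apply, flip_two, exp_negTwo, flip_lowest_partner _ _ hg]

theorem OneInvertible.isUnit_quarticNorm (h : g.OneInvertible) : IsUnit g.quarticNorm := by
  -- Take the preimage of z₂ in L₋₂. The right factor fixes it, and the left factor does not alter
  -- degree 2, so the degree-2 coordinate reads (a scalar) · ν = 1.
  obtain ⟨gl, gr, φl, φ, φr, hl, hp, hr, hθ⟩ := h
  have h1 : two H skewGen ∈ grade (-(-2)) := two_mem_grade _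
  rw [← hθ (-2)] at h1
  obtain ⟨X, hX, h2⟩ := h1
  have h3 : φl (φ (φr X)) = two H skewGen := h2
  rw [hl.eq_expMinus, hp.eq_exp, hr.eq_expMinus, eq_negTwo hX, expMinus_negTwo,
    ← skewCoord_smul X.r, smul_negTwo, map_smul, exp_negTwo] at h3
  have h4 := congrArg (fun X : H.LieAlg => skewCoord X.s) h3
  have h5 : (two H skewGen).s = skewGen := rfl
  simp only [expMinus_s, smul_s, lowest_s', h5, map_smul, skewCoord_gen, smul_eq_mul, mul_one] at h4
  exact .of_mul_eq_one_right _ h4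

theorem oneInvertible_of_isUnit (hg : H.N (H.sharp g.v) = star (H.N g.v) ^ 2)
    (h : IsUnit g.quarticNorm) : g.OneInvertible := by
  obtain ⟨k, hk⟩ := h.exists_left_inv
  have hk' : k * g.inv.quarticNorm = 1 := by rwa [quarticNorm_inv]
  have hg' : H.N (H.sharp g.inv.v) = star (H.N g.inv.v) ^ 2 := by
    have hv : g.inv.v = -g.v := rfl
    rw [hv, sharp_neg, N_neg, star_neg, neg_sq, hg]
  -- The right factor sends z₂ to k exp_+(g⁻¹) z₋₂, which exp_+(g) takes to k z₋₂. The left factor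
  -- undoes exp_-(h), where exp_+(g) z₋₂ = ν exp_-(h) z₂.
  refine ⟨(g.partner hk).inv, g.inv.partner hk', _, _, _, isExpMinus_expMinus, g.isExpPlus_exp,
    isExpMinus_expMinus, fun i => map_grade_eq hk ?_ ?_ i⟩
  · change (g.partner hk).inv.expMinus (g.exp ((g.inv.partner hk').expMinus (two H skewGen))) = _
    rw [expMinus_partner_two hk' hg', map_smul, ← exp_negTwo, exp_exp_inv, map_smul,
      expMinus_negTwo]
  · change (g.partner hk).inv.expMinus (g.exp ((g.inv.partner hk').expMinus (negTwo H skewGen))) = _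
    have h1 : g.lowest = g.quarticNorm • (g.partner hk).expMinus (two H skewGen) := by
      rw [expMinus_partner_two hk hg, smul_smul, mul_comm, hk, one_smul]
    rw [expMinus_negTwo, exp_negTwo, h1, map_smul, expMinus_inv_expMinus]

end G

end Generic

end HermitianCubicNormStructure

theorem mainTheorem3 {R : Type u} [CommRing R] {α : R} {J : Type v} [AddCommGroup J]
    [Module (QuadExt R α) J] [Module R J] [IsScalarTower R (QuadExt R α) J]
    (H : HermitianCubicNormStructure R α J) (g : H.G)
    (hg : H.N (H.sharp g.v) = star (H.N g.v) ^ 2) :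
    g.OneInvertible ↔ IsUnit g.quarticNorm :=
  ⟨HermitianCubicNormStructure.G.OneInvertible.isUnit_quarticNorm,
    HermitianCubicNormStructure.G.oneInvertible_of_isUnit hg⟩
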